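/- For complex $a,b,c,e,f$ let $s=e+f-a-b-c$ (the excess) and call $(a,b,c;e,f)$ *regular* if none of $e,f,s$ lies in $\{0,-1,-2,\dots\}$. Write ${}_3F_2(a,b,c;e,f)$ for the hypergeometric function at unit argument: if $e,f\notin\{0,-1,-2,\dots\}$ and $\operatorname{Re}s>0$ it is the sum of the convergent series $\sum_{k\ge0}\frac{(a)_k(b)_k(c)_k}{(e)_k(f)_k\,k!}$, and otherwise it is the analytic continuation of this sum, jointly in the five parameters, to the set of regular parameters; this continuation exists. For integers $m,n$ put $$W_{m,n}(a,b,c)={}_3F_2\left(a,b,c;\tfrac12(a+b+1+m),\,2c+n\right).$$ Then the following sixteen evaluations hold, for all complex $a,b,c$ such that the parameters of every ${}_3F_2$ and $W_{m,n}$ that occurs are regular, no Gamma function in a numerator on the right is at a pole, and no explicit non-Gamma factor in a denominator on the right vanishes ($1/\Gamma$ is taken to be $0$ at the poles of $\Gamma$). In (4)–(6) $n$ is any integer $n\ge0$; in (12), (13) $m,n$ are any integers. (1) ${}_3F_2(a,b,2-b;c,2a+2-c)=\dfrac{\Gamma(2a+2-c)\Gamma(c)}{(1-b)(a-c+1)\Gamma(c+b-2)\Gamma(2+2a-b-c)}\left(\dfrac{\Gamma(a-\frac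 c2+1-\frac b2)\Gamma(\frac b2-1+\frac c2)}{2\,\Gamma(a+\frac b2-\frac c2)\Gamma(\frac c2-\frac b2)}-\dfrac{\Gamma(\frac32+a-\frac b2-\frac c2)\Gamma(\frac b2+\frac c2-\frac12)}{2\,\Gamma(a-\frac c2+\frac12+\frac b2)\Gamma(\frac c2-\frac b2+\frac12)}\right)$. (2) With $D=(a-1)(a-2)(a-3)(b-1)(b-2)(b-3)$: ${}_3F_2(a,2,b;c,4)=-\dfrac{6(2c-5+b-ab+a)\Gamma(c)\Gamma(2+c-a-b)}{D\,\Gamma(c-a)\Gamma(c-b)}+\dfrac{6(c-2)(c-1)(ab-3b-3a+3+2c)}{D}$. (3) With $D=(c-a-1)(c-a-2)(c-a-3)(c-b-1)(c-b-2)(c-b-3)$: ${}_3F_2(a,2,b;c,4+a+b-c)=\dfrac{(c-a-b-2)(c-a-b-3)(c-2)(c-1)(3-4c-ca+c^2+3a+ab+3b-bc)}{D}+\dfrac{(a+5-ca+c^2-4c+ab-bc+b)\Gamma(4+a+b-c)\Gamma(c)}{D\,\Gamma(a)\Gamma(b)}$. (4) For $b\ne n$: ${}_3F_2\left(a,b,-\frac{n(n-b+a)}{b-n};1+b-\frac{an}{b-n},1+a+n\right)=\dfrac{(-1)^n\sin(\pi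 b)\,\Gamma(1+b+\frac{an}{n-b})\Gamma(-b)}{\sin(\pi a)\,\Gamma(1+a)\Gamma(-a-n)\Gamma(n+1+\frac{an}{n-b})}$. (5) ${}_3F_2\left(3n-\frac32,n-a-\frac12,2a;2a+\frac12+n,3n-a-\frac12\right)=\dfrac{(\frac{2a}3+\frac13)\Gamma(\frac52-3n)\Gamma(a-n+\frac12)\Gamma(2a+\frac12+n)}{\Gamma(\frac12+n)\Gamma(\frac32+a-3n)\Gamma(2a+2)\Gamma(\frac32-n)}$. (6) For $b\ne-n$: ${}_3F_2\left(a,b,-n+\frac{an}{b+n};1+b+\frac{an}{b+n},a-n+1\right)=\dfrac{(-1)^n\sin(\pi b)\,\Gamma(1+b+\frac{an}{b+n})\Gamma(-b)}{\sin(\pi a)\,\Gamma(1+a)\Gamma(1-n+\frac{an}{b+n})\Gamma(n-a)}$. (7) ${}_3F_2\left(a,b,c;2c-1,\frac{a+b+1}2\right)=\sqrt\pi\,\Gamma(c-\frac12)\Gamma(\frac{a+b+1}2)\Gamma(c-\frac a2-\frac b2-\frac12)\left(\dfrac1{\Gamma(\frac{b+1}2)\Gamma(c-\frac12-\frac a2)\Gamma(c-\frac12-\frac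 b2)\Gamma(\frac{a+1}2)}+\dfrac1{\Gamma(\frac a2)\Gamma(\frac b2)\Gamma(c-\frac a2)\Gamma(c-\frac b2)}\right)$. (8) ${}_3F_2\left(a,b,c;1+2b,\frac{a+c}2\right)=\dfrac{\sqrt\pi\,\Gamma(\frac{a+c}2)\Gamma(1+2b)\Gamma(1+b-\frac a2-\frac c2)}{2^{1+2b-a}\,\Gamma(b+1)\Gamma(a)}\left(\dfrac{\Gamma(\frac a2)}{\Gamma(1+b-\frac c2)\Gamma(b-\frac a2+\frac12)\Gamma(\frac c2)}+\dfrac{\Gamma(\frac{a+1}2)}{\Gamma(\frac12+b-\frac c2)\Gamma(1+b-\frac a2)\Gamma(\frac{c+1}2)}\right)$. (9) ${}_3F_2(a,b,1-b;c,2a-c)=\Gamma(2a-c)\left(\dfrac{\sqrt\pi\,\Gamma(a-1)\Gamma(c)\Gamma(\frac b2+\frac c2-\frac12)}{2^{2a-b-c}\,\Gamma(a)\Gamma(\frac c2-\frac b2+\frac12)\Gamma(a-\frac b2-\frac c2)\Gamma(a+\frac b2-\frac c2-\frac12)\Gamma(c+b-1)}+\dfrac{\sqrt\pi\,\Gamma(\frac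 b2+\frac c2)\Gamma(a-1)\Gamma(c)}{2^{2a-b-c}\,\Gamma(a)\Gamma(\frac c2-\frac b2)\Gamma(a-\frac b2-\frac c2+\frac12)\Gamma(a+\frac b2-\frac c2)\Gamma(c+b-1)}\right)$. (10) ${}_3F_2(a,b,-b;c,2a-c+1)=\dfrac{\sqrt\pi\,\Gamma(2a-c+1)\Gamma(c)\Gamma(\frac b2+\frac c2)}{2^{2a-c+1-b}\,\Gamma(a-\frac c2+1+\frac b2)\Gamma(a-\frac b2-\frac c2+\frac12)\Gamma(\frac c2-\frac b2)\Gamma(c+b)}+\dfrac{\sqrt\pi\,\Gamma(2a-c+1)\Gamma(c)\Gamma(\frac b2+\frac c2+\frac12)}{2^{2a-c+1-b}\,\Gamma(a-\frac c2+\frac12+\frac b2)\Gamma(a-\frac c2+1-\frac b2)\Gamma(\frac c2-\frac b2+\frac12)\Gamma(c+b)}$. (11) ${}_3F_2\left(a,b,c;2c,1+\frac{a+b}2\right)=\dfrac{\Gamma(1+\frac{a+b}2)\Gamma(2c)\Gamma(1+c-\frac{a+b}2)}{\Gamma(2c-a)\Gamma(c)\Gamma(a)(\frac b2-\frac a2)(c-\frac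 a2-\frac b2)}\left(\dfrac{\Gamma(c-\frac a2)\Gamma(\frac a2)}{2\,\Gamma(c-\frac b2)\Gamma(\frac b2)}-\dfrac{\Gamma(c-\frac a2+\frac12)\Gamma(\frac{a+1}2)}{2\,\Gamma(c-\frac b2+\frac12)\Gamma(\frac{b+1}2)}\right)$. (12) ${}_3F_2\left(a,b,c;\frac{c+b+n+1+m}2,2a-n\right)=W_{m,n}(c,2a-b-n,a-n)\,\dfrac{\Gamma(a+\frac{-c-b-n+1+m}2)\Gamma(\frac{c+b+n+1+m}2)}{\Gamma(\frac{-c+b+n+1+m}2)\Gamma(a+\frac{c-b-n+1+m}2)}$. (13) ${}_3F_2(a,1+m-a,b;c,1+m+n+2b-c)=W_{m,n}(a-c+n+2b,\,1+m+n+2b-a-c,\,b)\,\dfrac{\Gamma(b+n)\Gamma(c)}{\Gamma(c-b)\Gamma(2b+n)}$. (14) ${}_3F_2(a,b,c;b+2-a,1+b-c)=-\dfrac{\sqrt\pi\,\Gamma(b+2-a)\Gamma(1+b-c)\Gamma(\frac b2-c-a+2)}{2^b(a-1)\Gamma(1-a+\frac b2)\Gamma(\frac b2-c+1)\Gamma(\frac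 b2+\frac12)\Gamma(b+2-a-c)}+\dfrac{\sqrt\pi\,\Gamma(b+2-a)\Gamma(1+b-c)\Gamma(\frac b2-c-a+\frac32)}{2^b(a-1)\Gamma(b+2-a-c)\Gamma(\frac b2)\Gamma(\frac b2+\frac32-a)\Gamma(\frac12+\frac b2-c)}$. (15) ${}_3F_2\left(a,b,c;1+\frac{b+c}2,2a-1\right)=\dfrac{\Gamma(1+\frac{b+c}2)\Gamma(a-\frac b2-\frac c2)\Gamma(a-\frac12)2^{c-b+2a-1}}{\sqrt\pi\,\Gamma(c+1)\Gamma(2a-b)(\frac b2-\frac c2)}\left(-\dfrac{c(2a-b-1)\Gamma(a-\frac b2)\Gamma(\frac{c+1}2)}{4\,\Gamma(a-\frac c2)\Gamma(\frac{b+1}2)}+\dfrac{\Gamma(1+\frac c2)\Gamma(a-\frac b2+\frac12)}{\Gamma(a-\frac c2-\frac12)\Gamma(\frac b2)}\right)$. (16) ${}_3F_2(a,1-a,b;c,2+2b-c)=\dfrac{\pi\,2^{-2b}\,\Gamma(2+2b-c)\Gamma(c)}{c-1-b}\left(-\dfrac1{\Gamma(\frac12+\frac a2-\frac c2+b)\Gamma(1+b-\frac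 a2-\frac c2)\Gamma(\frac{a+c}2)\Gamma(\frac{c-a+1}2)}+\dfrac1{\Gamma(1+b+\frac a2-\frac c2)\Gamma(\frac{c-a}2)\Gamma(\frac{a+c-1}2)\Gamma(\frac32+b-\frac a2-\frac c2)}\right)$. -/

import Mathlib

/-- `z` is not one of `0, -1, -2, …` (the poles of the Gamma function). -/
def NonPole (z : ℂ) : Prop := ∀ k : ℕ, z ≠ -(k : ℂ)

/-- The `k`-th term `(a)ₖ (b)ₖ (c)ₖ / ((e)ₖ (f)ₖ k!)` of the series `₃F₂(a, b, c; e, f; 1)`. -/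
noncomputable def hypTerm (a b c e f : ℂ) (k : ℕ) : ℂ :=
  ((ascPochhammer ℂ k).eval a * (ascPochhammer ℂ k).eval b * (ascPochhammer ℂ k).eval c) /
    ((ascPochhammer ℂ k).eval e * (ascPochhammer ℂ k).eval f * (k.factorial : ℂ))

/-- The parameters at which (the analytic continuation of) `₃F₂(a, b, c; e, f; 1)` is defined: the
bottom parameters `e`, `f` and the parametric excess `e + f - a - b - c` are not in
`{0, -1, -2, …}`. -/
def Regular (a b c e f : ℂ) : Prop :=
  NonPole e ∧ NonPole f ∧ NonPole (e + f - a - b - c)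

/-- `F a b c e f` is the function `₃F₂(a, b, c; e, f; 1)`: it is the sum of the hypergeometric
series at all parameters with excess of positive real part, and elsewhere it is given by analytic
continuation in the five parameters to the (connected, open) set of all regular parameters.
This determines `F` on the regular parameters; its values elsewhere are irrelevant. -/
structure IsHyp3F2One (F : ℂ → ℂ → ℂ → ℂ → ℂ → ℂ) : Prop where
  hasSum : ∀ a b c e f : ℂ, NonPole e → NonPole f → 0 < (e + f - a - b - c).re →
    HasSum (hypTerm a b c e f) (F a b c e f)
  analytic : AnalyticOnNhd ℂ
    (fun p : ℂ × ℂ × ℂ × ℂ × ℂ => F p.1 p.2.1 p.2.2.1 p.2.2.2.1 p.2.2.2.2)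
    {p | Regular p.1 p.2.1 p.2.2.1 p.2.2.2.1 p.2.2.2.2}

/-- The generalized Watson element
`W_{m,n}(a, b, c) = ₃F₂(a, b, c; (a + b + 1 + m) / 2, 2 c + n; 1)`. -/
noncomputable def watsonW (F : ℂ → ℂ → ℂ → ℂ → ℂ → ℂ) (a b c : ℂ) (m n : ℤ) : ℂ :=
  F a b c ((a + b + 1 + m) / 2) (2 * c + n)

/-- The parameters of `W_{m,n}(a, b, c)` are regular. -/
def WatsonRegular (a b c : ℂ) (m n : ℤ) : Prop :=
  Regular a b c ((a + b + 1 + m) / 2) (2 * c + n)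

open Complex (Gamma sin)
open Real (pi)

/-!
The evaluations are identities between entire functions in disguise. The function
`Φ(a, b, c; e, f) = ₃F₂(a, b, c; e, f; 1) / (Γ(e) Γ(f) Γ(s))`, with `s = e + f - a - b - c`, extends
to an entire function of the five parameters (`Phi`, `analyticAt_Phi`): where the series converges
it is analytic, and a three-term relation in `f` (`regSum_recursion`) carries it to all parameters.
So `Γ(e) Γ(f) Γ(s) Φ` is the analytic continuation (`isHyp3F2One_Gamma_mul_Phi`), and by the identity
theorem every continuation has this form (`IsHyp3F2One.eq`). Identities for `Φ` may then be proved
where all series converge well, and need no hypotheses on the parameters.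

Gauss's theorem (`Phi_gauss`) follows from a first-order recurrence and the limit of both sides at
infinity. Applied to the rows and the columns of a double series it gives Thomae's transformation
(`Phi_thomae`), and this, used twice, Kummer's transformation (`Phi_kummer`), which already contains
the two relations with the Watson elements `W`. Whipple's theorem (`Phi_whipple`) is again a
first-order recurrence, now in steps of two, with the limit at infinity. Two contiguous relations
(`Phi_contiguous_num`, `Phi_contiguous_den`), together with Kummer's transformation, turn Whipple's
theorem into Watson's and into the contiguous cases of the theorems of Watson, Whipple and Dixon
that occur here. The given right sides are recovered with Legendre's duplication formula.

The remaining evaluations are elementary. With a top parameter `2` and a bottom parameter `4` the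
series is a truncated combination of two Gauss series (`Phi_two_four`), and Kummer's transformation
takes the case of a top parameter `2` and excess two to this one. If the excess is two and
`a b + a c + b c = (e - 1) (f - 1)`, the partial sums are hypergeometric terms
(`sum_regTerm_of_excess_two`), with limit `1 / (Γ(a + 1) Γ(b + 1) Γ(c + 1))` (`Phi_excess_two`);
the three families that depend on an integer `n ≥ 0` are of this kind, up to the reflection formula.
-/

section

open Filter Topology Set
open scoped BoundedContinuousFunction

/-! ### The reciprocal Gamma function and the growth of Pochhammer symbols -/

/-- The factor by which a normalized Pochhammer symbol changes in one step is `1 + O(h ^ 2)`, with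
`h = 1 / (k + 1)`, uniformly for `a` in a ball. -/
lemma norm_stepFactor_sub_one_le {R : ℝ} {a : ℂ} (ha : ‖a‖ ≤ R) {h : ℝ} (h0 : 0 ≤ h) (h1 : h ≤ 1) :
    ‖(1 + (a - 1) * h) * (1 + h : ℂ) ^ (1 - a) - 1‖ ≤
      ((R + 1) * (R + 2) * (2 : ℝ) ^ R) * h ^ 2 := by
  have hR : 0 ≤ R := (norm_nonneg a).trans ha
  set φ : ℝ → ℂ := fun x => (1 + (a - 1) * x) * (1 + x : ℂ) ^ (1 - a) with hφ
  set φ' : ℝ → ℂ := fun x => (a - 1) * (2 - a) * x * (1 + x : ℂ) ^ (-a) with hφ'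
  have hder : ∀ x ∈ Icc (0 : ℝ) h, HasDerivWithinAt φ (φ' x) (Icc 0 h) x := by
    intro x hx
    have hx1 : (1 + x : ℂ) ∈ Complex.slitPlane := by
      left
      simp only [Complex.add_re, Complex.one_re, Complex.ofReal_re]
      linarith [hx.1]
    have hne : (1 + x : ℂ) ≠ 0 := Complex.slitPlane_ne_zero hx1
    have e1 : HasDerivAt (fun z : ℂ => 1 + (a - 1) * z) (a - 1) (x : ℂ) := by
      simpa using ((hasDerivAt_id (x : ℂ)).const_mul (a - 1)).const_add 1
    have e2 : HasDerivAt (fun z : ℂ => (1 + z) ^ (1 - a))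
        ((1 - a) * (1 + x : ℂ) ^ (1 - a - 1) * 1) (x : ℂ) :=
      ((hasDerivAt_id (x : ℂ)).const_add 1).cpow_const hx1
    have e3 := (e1.mul e2).comp_ofReal
    refine HasDerivAt.hasDerivWithinAt ?_
    convert! e3 using 1
    have : (1 + x : ℂ) ^ (1 - a) = (1 + x) * (1 + x : ℂ) ^ (-a) := by
      rw [sub_eq_add_neg, Complex.cpow_add _ _ hne, Complex.cpow_one]
    rw [this, show 1 - a - 1 = -a by ring]
    simp only [φ']
    ring
  have hb : ∀ x ∈ Icc (0 : ℝ) h, ‖φ' x‖ ≤ ((R + 1) * (R + 2) * (2 : ℝ) ^ R) * h := by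
    intro x hx
    have k1 : ‖a - 1‖ ≤ R + 1 := (norm_sub_le _ _).trans (by simpa using ha)
    have k2 : ‖2 - a‖ ≤ R + 2 := (norm_sub_le _ _).trans (by simp; linarith)
    have k3 : ‖(1 + x : ℂ) ^ (-a)‖ ≤ (2 : ℝ) ^ R := by
      have : (1 + x : ℂ) = ((1 + x : ℝ) : ℂ) := by push_cast; ring
      rw [this, Complex.norm_cpow_eq_rpow_re_of_pos (by linarith [hx.1])]
      have hre : (-a).re ≤ R := (Complex.re_le_norm _).trans (by simpa using ha)
      calc (1 + x) ^ (-a).re ≤ (1 + x) ^ R :=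
            Real.rpow_le_rpow_of_exponent_le (by linarith [hx.1]) hre
        _ ≤ 2 ^ R := Real.rpow_le_rpow (by linarith [hx.1]) (by linarith [hx.2]) hR
    have k4 : ‖(x : ℂ)‖ ≤ h := by
      rw [Complex.norm_real, Real.norm_eq_abs, abs_of_nonneg hx.1]; exact hx.2
    simp only [φ', norm_mul]
    calc ‖a - 1‖ * ‖2 - a‖ * ‖(x : ℂ)‖ * ‖(1 + x : ℂ) ^ (-a)‖
        ≤ (R + 1) * (R + 2) * h * 2 ^ R := by gcongr
      _ = _ := by ring
  -- `φ` has derivative `φ'`, which is `O(x)`, so the mean value inequality gives `O(h ^ 2)`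
  have key := (convex_Icc (0 : ℝ) h).norm_image_sub_le_of_norm_hasDerivWithin_le hder hb
    (left_mem_Icc.2 h0) (right_mem_Icc.2 h0)
  have hφ0 : φ 0 = 1 := by simp [φ]
  rw [hφ0, Real.norm_eq_abs, sub_zero, abs_of_nonneg h0] at key
  calc _ ≤ _ := key
    _ = _ := by ring

/-- A discrete Grönwall inequality with a summable rate. -/
lemma le_mul_exp_of_le_one_add_mul {u : ℕ → ℝ} (hu : ∀ k, 0 ≤ u k) {C : ℝ} (hC : 0 ≤ C) (K : ℕ)
    (h : ∀ k, K ≤ k → u (k + 1) ≤ u k * (1 + C * (1 / ((k : ℝ) + 1)) ^ 2)) :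
    ∀ k, K ≤ k → u k ≤ u K * Real.exp (C * ∑' j : ℕ, (1 / ((j : ℝ) + 1)) ^ 2) := by
  have hs : Summable fun j : ℕ => (1 / ((j : ℝ) + 1)) ^ 2 := by
    have := (summable_nat_add_iff 1).2 (Real.summable_one_div_nat_pow (p := 2) |>.2 (by norm_num))
    simpa [div_pow] using this
  have main : ∀ k, K ≤ k →
      u k ≤ u K * Real.exp (C * ∑ j ∈ Finset.range k, (1 / ((j : ℝ) + 1)) ^ 2) := by
    intro k hk
    induction k, hk using Nat.le_induction with
    | base =>
      refine le_mul_of_one_le_right (hu K) (Real.one_le_exp ?_)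
      positivity
    | succ k hk ih =>
      rw [Finset.sum_range_succ, mul_add, Real.exp_add, ← mul_assoc]
      refine (h k hk).trans (mul_le_mul ih ?_ (by positivity) (by have := hu K; positivity))
      linarith [Real.add_one_le_exp (C * (1 / ((k : ℝ) + 1)) ^ 2)]
  intro k hk
  refine (main k hk).trans ?_
  have := hs.sum_le_tsum (Finset.range k) (fun _ _ => by positivity)
  gcongr
  exact hu K

/-- The Pochhammer symbol `(a)ₖ = a (a + 1) ⋯ (a + k - 1)`. -/
noncomputable def poch (a : ℂ) (k : ℕ) : ℂ := (ascPochhammer ℂ k).eval a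

lemma poch_zero (a : ℂ) : poch a 0 = 1 := by simp [poch]

lemma poch_succ (a : ℂ) (k : ℕ) : poch a (k + 1) = poch a k * (a + k) := by
  simp [poch, ascPochhammer_succ_eval]

lemma poch_succ_left (a : ℂ) (k : ℕ) : poch a (k + 1) = a * poch (a + 1) k := by
  induction k with
  | zero => simp [poch_zero, poch_succ]
  | succ k ih =>
    rw [poch_succ, ih, poch_succ]
    push_cast
    ring

/-- `1 / Γ`, an entire function. -/
noncomputable def rGamma (z : ℂ) : ℂ := (Gamma z)⁻¹

lemma rGamma_eq (z : ℂ) : rGamma z = z * rGamma (z + 1) :=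
  Complex.one_div_Gamma_eq_self_mul_one_div_Gamma_add_one z

@[fun_prop]
lemma differentiable_rGamma : Differentiable ℂ rGamma := Complex.differentiable_one_div_Gamma

/-- `(a)ₖ / k!` divided by its order of growth `(k + 1) ^ (a - 1)`. -/
noncomputable def pochNormalized (k : ℕ) (a : ℂ) : ℂ :=
  poch a k / k.factorial * ((k + 1 : ℕ) : ℂ) ^ (1 - a)

/-- `k! / Γ(e + k)` divided by its order of growth `(k + 1) ^ (1 - e)`. -/
noncomputable def rGammaNormalized (k : ℕ) (e : ℂ) : ℂ :=
  k.factorial * rGamma (e + k) * ((k + 1 : ℕ) : ℂ) ^ (e - 1)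

lemma natCast_succ_succ_cpow (k : ℕ) (z : ℂ) : ((k + 1 + 1 : ℕ) : ℂ) ^ z =
    ((k + 1 : ℕ) : ℂ) ^ z * (1 + ((1 / ((k : ℝ) + 1) : ℝ) : ℂ)) ^ z := by
  have h1 : ((k + 1 + 1 : ℕ) : ℂ) =
      (((k + 1 : ℕ) : ℝ) : ℂ) * ((1 + (1 / ((k : ℝ) + 1)) : ℝ) : ℂ) := by
    have : (k : ℂ) + 1 ≠ 0 := Nat.cast_add_one_ne_zero k
    push_cast
    field_simp
  rw [h1, Complex.mul_cpow_ofReal_nonneg (by positivity) (by positivity)]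
  push_cast
  rfl

lemma pochNormalized_succ (k : ℕ) (a : ℂ) : pochNormalized (k + 1) a = pochNormalized k a *
    ((1 + (a - 1) * ((1 / ((k : ℝ) + 1) : ℝ) : ℂ)) *
      (1 + ((1 / ((k : ℝ) + 1) : ℝ) : ℂ)) ^ (1 - a)) := by
  have h : (k : ℂ) + 1 ≠ 0 := Nat.cast_add_one_ne_zero k
  have hf : (k.factorial : ℂ) ≠ 0 := by exact_mod_cast k.factorial_ne_zero
  rw [pochNormalized, natCast_succ_succ_cpow, poch_succ, Nat.factorial_succ, pochNormalized]
  generalize (1 + ((1 / ((k : ℝ) + 1) : ℝ) : ℂ)) ^ (1 - a) = u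
  generalize ((k + 1 : ℕ) : ℂ) ^ (1 - a) = v
  push_cast
  field_simp
  ring

lemma rGammaNormalized_succ (k : ℕ) (e : ℂ) : rGammaNormalized k e = rGammaNormalized (k + 1) e *
    ((1 + (e - 1) * ((1 / ((k : ℝ) + 1) : ℝ) : ℂ)) *
      (1 + ((1 / ((k : ℝ) + 1) : ℝ) : ℂ)) ^ (1 - e)) := by
  have h : (k : ℂ) + 1 ≠ 0 := Nat.cast_add_one_ne_zero k
  have hu : (1 + ((1 / ((k : ℝ) + 1) : ℝ) : ℂ)) ≠ 0 := by
    have : (0 : ℝ) < 1 + 1 / ((k : ℝ) + 1) := by positivity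
    exact_mod_cast this.ne'
  rw [rGammaNormalized, rGammaNormalized, natCast_succ_succ_cpow, rGamma_eq (e + k),
    Nat.factorial_succ, show 1 - e = -(e - 1) by ring, Complex.cpow_neg,
    show e + k + 1 = e + (k + 1 : ℕ) by push_cast; ring]
  have hu' : (1 + ((1 / ((k : ℝ) + 1) : ℝ) : ℂ)) ^ (e - 1) ≠ 0 := by
    rw [Ne, Complex.cpow_eq_zero_iff]
    exact fun h => hu h.1
  generalize (1 + ((1 / ((k : ℝ) + 1) : ℝ) : ℂ)) ^ (e - 1) = u at hu' ⊢
  generalize ((k + 1 : ℕ) : ℂ) ^ (e - 1) = v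
  generalize rGamma (e + (k + 1 : ℕ)) = w
  push_cast
  field_simp
  ring

lemma exists_norm_pochNormalized_le (R : ℝ) :
    ∃ C, ∀ k, ∀ a : ℂ, ‖a‖ ≤ R → ‖pochNormalized k a‖ ≤ C := by
  rcases lt_or_ge R 0 with hR | hR
  · exact ⟨0, fun k a ha => absurd ha (not_le.2 (hR.trans_le (norm_nonneg a)))⟩
  set D : ℝ := (R + 1) * (R + 2) * (2 : ℝ) ^ R with hD
  refine ⟨1 * Real.exp (D * ∑' j : ℕ, (1 / ((j : ℝ) + 1)) ^ 2), fun k a ha => ?_⟩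
  have h0 : ‖pochNormalized 0 a‖ = 1 := by simp [pochNormalized, poch_zero]
  have hD0 : 0 ≤ D := by positivity
  have key := le_mul_exp_of_le_one_add_mul (u := fun k => ‖pochNormalized k a‖)
    (fun _ => norm_nonneg _) hD0 0 (fun j _ => ?_) k (Nat.zero_le k)
  · simpa only [h0] using key
  simp only [pochNormalized_succ, norm_mul (pochNormalized j a)]
  have hj : (1 / ((j : ℝ) + 1)) ≤ 1 := by
    rw [div_le_one (by positivity)]; linarith [(Nat.cast_nonneg j : (0 : ℝ) ≤ j)]
  have := norm_stepFactor_sub_one_le ha (h := 1 / ((j : ℝ) + 1)) (by positivity) hj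
  gcongr
  calc _ = ‖(1 + (a - 1) * ((1 / ((j : ℝ) + 1) : ℝ) : ℂ)) *
      (1 + ((1 / ((j : ℝ) + 1) : ℝ) : ℂ)) ^ (1 - a) - 1 + 1‖ := by rw [sub_add_cancel]
    _ ≤ _ := norm_add_le _ _
    _ ≤ _ := by rw [norm_one]; linarith

lemma differentiable_rGammaNormalized (k : ℕ) : Differentiable ℂ (rGammaNormalized k) := by
  have : ((k + 1 : ℕ) : ℂ) ≠ 0 := by exact_mod_cast k.succ_ne_zero
  refine Differentiable.mul (by fun_prop) (fun z => ?_)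
  exact ((differentiableAt_id).sub_const 1).const_cpow (Or.inl this)

lemma differentiable_pochNormalized (k : ℕ) : Differentiable ℂ (pochNormalized k) := by
  have : ((k + 1 : ℕ) : ℂ) ≠ 0 := by exact_mod_cast k.succ_ne_zero
  refine Differentiable.mul ?_ (fun z => ?_)
  · exact (Polynomial.differentiable _).div_const _
  · exact ((differentiableAt_const 1).sub differentiableAt_id).const_cpow (Or.inl this)

/-- Since `rGammaNormalized` may vanish, the step factor is only known to be invertible for large
`k`; from there on the bound propagates. -/
lemma exists_norm_rGammaNormalized_le (R : ℝ) :
    ∃ C, ∀ k, ∀ e : ℂ, ‖e‖ ≤ R → ‖rGammaNormalized k e‖ ≤ C := by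
  rcases lt_or_ge R 0 with hR | hR
  · exact ⟨0, fun k a ha => absurd ha (not_le.2 (hR.trans_le (norm_nonneg a)))⟩
  set D : ℝ := (R + 1) * (R + 2) * (2 : ℝ) ^ R with hD
  have hD0 : 0 ≤ D := by positivity
  obtain ⟨K, hK⟩ := exists_nat_gt (2 * D)
  -- the finitely many initial terms are bounded by compactness
  have hfin : ∀ k, ∃ C, ∀ e : ℂ, ‖e‖ ≤ R → ‖rGammaNormalized k e‖ ≤ C := by
    intro k
    obtain ⟨C, hC⟩ := (isCompact_closedBall (0 : ℂ) R).exists_bound_of_continuousOn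
      (differentiable_rGammaNormalized k).continuous.continuousOn
    exact ⟨C, fun e he => hC e (by simpa using he)⟩
  choose C hC using hfin
  set E := Real.exp (2 * D * ∑' j : ℕ, (1 / ((j : ℝ) + 1)) ^ 2)
  have hE : 1 ≤ E := by
    refine Real.one_le_exp (mul_nonneg (by positivity) (tsum_nonneg fun _ => by positivity))
  have hC0 : ∀ k, 0 ≤ C k := fun k => (norm_nonneg _).trans (hC k 0 (by simpa using hR))
  refine ⟨(∑ j ∈ Finset.range (K + 1), C j) * E, fun k e he => ?_⟩
  have hle : ∀ j ≤ K, C j ≤ ∑ j ∈ Finset.range (K + 1), C j := fun j hj =>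
    Finset.single_le_sum (f := C) (fun i _ => hC0 i) (Finset.mem_range.2 (by omega))
  rcases le_total k K with hk | hk
  · calc _ ≤ C k := hC k e he
      _ ≤ _ := hle k hk
      _ ≤ _ := le_mul_of_one_le_right (Finset.sum_nonneg fun i _ => hC0 i) hE
  have step : ∀ j, K ≤ j → ‖rGammaNormalized (j + 1) e‖ ≤
      ‖rGammaNormalized j e‖ * (1 + 2 * D * (1 / ((j : ℝ) + 1)) ^ 2) := by
    intro j hj
    have hj0 : (0 : ℝ) ≤ j := Nat.cast_nonneg j
    have hj1 : (1 / ((j : ℝ) + 1)) ≤ 1 := by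
      rw [div_le_one (by positivity)]; linarith
    have := norm_stepFactor_sub_one_le he (h := 1 / ((j : ℝ) + 1)) (by positivity) hj1
    rw [rGammaNormalized_succ j e]
    set w := (1 + (e - 1) * ((1 / ((j : ℝ) + 1) : ℝ) : ℂ)) *
      (1 + ((1 / ((j : ℝ) + 1) : ℝ) : ℂ)) ^ (1 - e)
    set x := D * (1 / ((j : ℝ) + 1)) ^ 2 with hx
    have hx0 : 0 ≤ x := by positivity
    have hx1 : x ≤ 1 / 2 := by
      have hKj : (K : ℝ) ≤ j := by exact_mod_cast hj
      have : D * (1 / ((j : ℝ) + 1)) ≤ 1 / 2 := by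
        rw [mul_one_div, div_le_iff₀ (by positivity)]; linarith
      calc x = D * (1 / ((j : ℝ) + 1)) * (1 / ((j : ℝ) + 1)) := by rw [hx]; ring
        _ ≤ 1 / 2 * 1 := by gcongr
        _ = _ := by ring
    have hw : 1 - x ≤ ‖w‖ := by
      have : (1 : ℝ) ≤ ‖w - 1‖ + ‖w‖ := by
        calc (1 : ℝ) = ‖w - (w - 1)‖ := by simp
          _ ≤ ‖w‖ + ‖w - 1‖ := norm_sub_le _ _
          _ = _ := add_comm _ _
      linarith
    rw [norm_mul, mul_assoc]
    refine le_mul_of_one_le_right (norm_nonneg _) ?_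
    have : 2 * D * (1 / ((j : ℝ) + 1)) ^ 2 = 2 * x := by rw [hx]; ring
    rw [this]
    nlinarith
  refine (le_mul_exp_of_le_one_add_mul (u := fun k => ‖rGammaNormalized k e‖)
    (fun _ => norm_nonneg _) (by positivity) K step k hk).trans ?_
  gcongr
  exact (hC K e he).trans (hle K le_rfl)

/-! ### Analyticity of the sum of the series -/

/-- The second-order Taylor remainder of a bounded holomorphic function, with a bound that depends
only on the bound of the function and the radius. -/
lemma norm_sub_sub_deriv_le {f : ℂ → ℂ} {z : ℂ} {r C : ℝ} (hr : 0 < r)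
    (hf : DifferentiableOn ℂ f (Metric.ball z r)) (hC : ∀ w ∈ Metric.ball z r, ‖f w‖ ≤ C) {w : ℂ}
    (hw : w ∈ Metric.ball z (r / 4)) :
    ‖f w - f z - (w - z) * deriv f z‖ ≤ C / (r / 4) / (r / 4) * ‖w - z‖ ^ 2 := by
  have hC0 : 0 ≤ C := (norm_nonneg _).trans (hC z (Metric.mem_ball_self hr))
  have hr4 : 0 < r / 4 := by positivity
  have hdiff : ∀ v ∈ Metric.ball z r, DifferentiableAt ℂ f v := fun v hv =>
    hf.differentiableAt (Metric.isOpen_ball.mem_nhds hv)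
  have hd' : DifferentiableOn ℂ (deriv f) (Metric.ball z r) := hf.deriv Metric.isOpen_ball
  have sub : ∀ {v : ℂ} {a b : ℝ}, v ∈ Metric.ball z a → a + b ≤ r →
      Metric.closedBall v b ⊆ Metric.ball z r := by
    intro v a b hv hab x hx
    rw [Metric.mem_ball] at hv ⊢
    rw [Metric.mem_closedBall] at hx
    linarith [dist_triangle x v z]
  have b1 : ∀ v ∈ Metric.ball z (r / 2), ‖deriv f v‖ ≤ C / (r / 4) := by
    intro v hv
    have hs := sub (b := r / 4) hv (by linarith)
    refine Complex.norm_deriv_le_of_forall_mem_sphere_norm_le hr4 ?_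
      (fun x hx => hC x (hs (Metric.sphere_subset_closedBall hx)))
    exact (hf.mono hs).diffContOnCl_ball subset_rfl
  have b2 : ∀ v ∈ Metric.ball z (r / 4), ‖deriv (deriv f) v‖ ≤ C / (r / 4) / (r / 4) := by
    intro v hv
    have hs : Metric.closedBall v (r / 4) ⊆ Metric.ball z (r / 2) := by
      intro x hx
      rw [Metric.mem_ball] at hv ⊢
      rw [Metric.mem_closedBall] at hx
      linarith [dist_triangle x v z]
    have hs' := hs.trans (Metric.ball_subset_ball (x := z) (by linarith : r / 2 ≤ r))
    refine Complex.norm_deriv_le_of_forall_mem_sphere_norm_le hr4 ?_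
      (fun x hx => b1 x (hs (Metric.sphere_subset_closedBall hx)))
    exact (hd'.mono hs').diffContOnCl_ball subset_rfl
  have b3 : ∀ v ∈ Metric.ball z (r / 4),
      ‖deriv f v - deriv f z‖ ≤ C / (r / 4) / (r / 4) * ‖v - z‖ := fun v hv =>
    (convex_ball z (r / 4)).norm_image_sub_le_of_norm_deriv_le
      (fun x hx => hd'.differentiableAt (Metric.isOpen_ball.mem_nhds
        (Metric.ball_subset_ball (by linarith) hx))) b2 (Metric.mem_ball_self hr4) hv
  have hseg : ∀ x ∈ segment ℝ z w, x ∈ Metric.ball z (r / 4) ∧ ‖x - z‖ ≤ ‖w - z‖ := fun x hx =>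
    ⟨(convex_ball z (r / 4)).segment_subset (Metric.mem_ball_self hr4) hw hx,
      norm_sub_le_of_mem_segment hx⟩
  have key := (convex_segment z w).norm_image_sub_le_of_norm_hasDerivWithin_le
    (f := fun v => f v - (v - z) * deriv f z) (f' := fun v => deriv f v - deriv f z)
    (C := C / (r / 4) / (r / 4) * ‖w - z‖) (𝕜 := ℂ) (fun x hx => ?_) (fun x hx => ?_)
    (left_mem_segment ℝ z w) (right_mem_segment ℝ z w)
  · calc _ = ‖f w - (w - z) * deriv f z - (f z - (z - z) * deriv f z)‖ := by
          congr 1; ring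
      _ ≤ _ := key
      _ = _ := by ring
  · have hx' := Metric.ball_subset_ball (by linarith : r / 4 ≤ r) (hseg x hx).1
    have := (hdiff x hx').hasDerivAt.sub
      (((hasDerivAt_id x).sub_const z).mul_const (deriv f z))
    rw [one_mul] at this
    exact this.hasDerivWithinAt
  · refine (b3 x (hseg x hx).1).trans ?_
    have := (hseg x hx).2
    gcongr

/-- A locally uniformly bounded sequence of holomorphic functions is a single holomorphic function
with values in the Banach algebra of bounded sequences. -/
lemma exists_differentiableOn_boundedContinuousFunction {U : Set ℂ} (g : ℕ → ℂ → ℂ)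
    (hg : ∀ k, DifferentiableOn ℂ (g k) U)
    (hb : ∀ z ∈ U, ∃ r > 0, ∃ C, Metric.ball z r ⊆ U ∧ ∀ w ∈ Metric.ball z r, ∀ k, ‖g k w‖ ≤ C) :
    ∃ G : ℂ → (ℕ →ᵇ ℂ), DifferentiableOn ℂ G U ∧ ∀ z ∈ U, ∀ k, G z k = g k z := by
  classical
  have hb' : ∀ z ∈ U, ∃ C, ∀ k, ‖g k z‖ ≤ C := fun z hz => by
    obtain ⟨r, hr, C, -, h⟩ := hb z hz
    exact ⟨C, h z (Metric.mem_ball_self hr)⟩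
  choose! B hB using hb'
  let G : ℂ → (ℕ →ᵇ ℂ) := fun z => if h : z ∈ U then
    BoundedContinuousFunction.ofNormedAddCommGroupDiscrete (fun k => g k z) (B z) (hB z h) else 0
  have hG : ∀ z ∈ U, ∀ k, G z k = g k z := fun z hz k => by simp [G, hz]
  refine ⟨G, fun z hz => ?_, hG⟩
  obtain ⟨r, hr, C, hU, hC⟩ := hb z hz
  have hz' : ∀ k, DifferentiableOn ℂ (g k) (Metric.ball z r) := fun k => (hg k).mono hU
  have hder : ∀ k, ‖deriv (g k) z‖ ≤ C / (r / 2) := fun k => by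
    have hs : Metric.closedBall z (r / 2) ⊆ Metric.ball z r :=
      Metric.closedBall_subset_ball (by linarith)
    exact Complex.norm_deriv_le_of_forall_mem_sphere_norm_le (by positivity)
      (((hz' k).mono hs).diffContOnCl_ball subset_rfl)
      (fun x hx => hC x (hs (Metric.sphere_subset_closedBall hx)) k)
  let D : ℕ →ᵇ ℂ := BoundedContinuousFunction.ofNormedAddCommGroupDiscrete
    (fun k => deriv (g k) z) _ hder
  have hO : (fun w => G w - G z - (w - z) • D) =O[𝓝 z] fun w => ‖w - z‖ ^ 2 := by
    refine Asymptotics.IsBigO.of_bound (C / (r / 4) / (r / 4)) ?_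
    filter_upwards [Metric.ball_mem_nhds z (by positivity : 0 < r / 4)] with w hw
    have hwU := hU (Metric.ball_subset_ball (by linarith : r / 4 ≤ r) hw)
    have hC0 : 0 ≤ C := (norm_nonneg _).trans (hC z (Metric.mem_ball_self hr) 0)
    refine (BoundedContinuousFunction.norm_le (by positivity)).2 fun k => ?_
    have := norm_sub_sub_deriv_le hr (hz' k) (fun v hv => hC v hv k) hw
    simpa [hG w hwU, hG z hz, D] using this
  have hH := (hO.hasFDerivAt (by norm_num : 1 < 2)).differentiableAt (𝕜 := ℂ)
  have : G = fun w => (G w - G z - (w - z) • D) + (G z + (w - z) • D) := by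
    funext w; abel
  rw [this]
  refine DifferentiableAt.differentiableWithinAt ?_
  exact hH.add ((differentiableAt_const _).add
    (((differentiableAt_id).sub_const z).smul_const D))

/-- The `k`-th term of the series, divided by `Γ(e) Γ(f)`; it is entire in the five parameters. -/
noncomputable def regTerm (a b c e f : ℂ) (k : ℕ) : ℂ :=
  poch a k * poch b k * poch c k * rGamma (e + k) * rGamma (f + k) / k.factorial

/-- The sum of the series, divided by `Γ(e) Γ(f)`. It is `0` by convention where the series
diverges, and is used only where the excess has positive real part. -/
noncomputable def regSum (a b c e f : ℂ) : ℂ := ∑' k, regTerm a b c e f k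

/-- The terms of the series decay like `k ^ (-1 - s)`, where `s` is the excess. -/
lemma regTerm_eq_normalized (a b c e f : ℂ) (k : ℕ) : regTerm a b c e f k =
    pochNormalized k a * pochNormalized k b * pochNormalized k c * rGammaNormalized k e *
      rGammaNormalized k f * ((k + 1 : ℕ) : ℂ) ^ (-1 - (e + f - a - b - c)) := by
  have hk : ((k + 1 : ℕ) : ℂ) ≠ 0 := by exact_mod_cast k.succ_ne_zero
  have hf : (k.factorial : ℂ) ≠ 0 := by exact_mod_cast k.factorial_ne_zero
  have : ((k + 1 : ℕ) : ℂ) ^ (1 - a) * ((k + 1 : ℕ) : ℂ) ^ (1 - b) * ((k + 1 : ℕ) : ℂ) ^ (1 - c) *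
      ((k + 1 : ℕ) : ℂ) ^ (e - 1) * ((k + 1 : ℕ) : ℂ) ^ (f - 1) *
      ((k + 1 : ℕ) : ℂ) ^ (-1 - (e + f - a - b - c)) = 1 := by
    simp only [← Complex.cpow_add _ _ hk]
    rw [show 1 - a + (1 - b) + (1 - c) + (e - 1) + (f - 1) + (-1 - (e + f - a - b - c)) = 0 by ring,
      Complex.cpow_zero]
  refine (mul_one _).symm.trans ((congrArg (regTerm a b c e f k * ·) this.symm).trans ?_)
  simp only [regTerm, pochNormalized, rGammaNormalized]
  field_simp

lemma exists_norm_regTerm_le (a b c e f : ℂ) : ∃ C, ∀ k : ℕ, ‖regTerm a b c e f k‖ ≤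
    C * ((k : ℝ) + 1) ^ (-1 - (e + f - a - b - c).re) := by
  obtain ⟨A, hA⟩ := exists_norm_pochNormalized_le ‖a‖
  obtain ⟨B, hB⟩ := exists_norm_pochNormalized_le ‖b‖
  obtain ⟨C, hC⟩ := exists_norm_pochNormalized_le ‖c‖
  obtain ⟨E, hE⟩ := exists_norm_rGammaNormalized_le ‖e‖
  obtain ⟨F, hF⟩ := exists_norm_rGammaNormalized_le ‖f‖
  refine ⟨A * B * C * E * F, fun k => ?_⟩
  rw [regTerm_eq_normalized]
  simp only [norm_mul]
  have h1 : ‖((k + 1 : ℕ) : ℂ) ^ (-1 - (e + f - a - b - c))‖ =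
      ((k : ℝ) + 1) ^ (-1 - (e + f - a - b - c).re) := by
    rw [Complex.norm_natCast_cpow_of_pos k.succ_pos]
    simp
  have hA' := hA k a le_rfl
  have hB' := hB k b le_rfl
  have hC' := hC k c le_rfl
  have hE' := hE k e le_rfl
  have hF' := hF k f le_rfl
  have := (norm_nonneg _).trans hA'
  have := (norm_nonneg _).trans hB'
  have := (norm_nonneg _).trans hC'
  have := (norm_nonneg _).trans hE'
  rw [h1]
  gcongr

lemma summable_add_one_rpow {x : ℝ} (hx : 0 < x) : Summable fun k : ℕ => ((k : ℝ) + 1) ^ (-1 -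
    x) := by
  have := (summable_nat_add_iff 1).2 (Real.summable_nat_rpow (p := -1 - x) |>.2 (by linarith))
  simpa using this

lemma summable_regTerm {a b c e f : ℂ} (h : 0 < (e + f - a - b - c).re) :
    Summable (regTerm a b c e f) := by
  obtain ⟨C, hC⟩ := exists_norm_regTerm_le a b c e f
  exact Summable.of_norm_bounded ((summable_add_one_rpow h).mul_left C) hC

/-- Summation of a bounded sequence against the weights `(k + 1) ^ (-1 - ε)`. -/
noncomputable def weightedSum {ε : ℝ} (hε : 0 < ε) : (ℕ →ᵇ ℂ) →L[ℂ] ℂ :=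
  LinearMap.mkContinuous
    { toFun := fun x => ∑' k : ℕ, (((k : ℝ) + 1) ^ (-1 - ε) : ℝ) * x k
      map_add' := fun x y => by
        have hs : ∀ x : ℕ →ᵇ ℂ, Summable fun k : ℕ => ((((k : ℝ) + 1) ^ (-1 - ε) : ℝ) : ℂ) * x k :=
          fun x => Summable.of_norm_bounded ((summable_add_one_rpow hε).mul_right ‖x‖) fun k => by
            rw [norm_mul, Complex.norm_real, Real.norm_of_nonneg (by positivity)]
            gcongr
            exact x.norm_coe_le_norm k
        rw [← (hs x).tsum_add (hs y)]
        simp [mul_add]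
      map_smul' := fun t x => by
        simp only [BoundedContinuousFunction.coe_smul, smul_eq_mul, RingHom.id_apply]
        rw [← tsum_mul_left]
        congr 1; funext k; ring }
    (∑' k : ℕ, ((k : ℝ) + 1) ^ (-1 - ε)) fun x => by
      have hb : ∀ k : ℕ, ‖((((k : ℝ) + 1) ^ (-1 - ε) : ℝ) : ℂ) * x k‖ ≤
          ((k : ℝ) + 1) ^ (-1 - ε) * ‖x‖ := fun k => by
        rw [norm_mul, Complex.norm_real, Real.norm_of_nonneg (by positivity)]
        gcongr
        exact x.norm_coe_le_norm k
      rw [← tsum_mul_right]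
      exact tsum_of_norm_bounded ((summable_add_one_rpow hε).mul_right ‖x‖).hasSum hb

lemma weightedSum_apply {ε : ℝ} (hε : 0 < ε) (x : ℕ →ᵇ ℂ) :
    weightedSum hε x = ∑' k : ℕ, (((k : ℝ) + 1) ^ (-1 - ε) : ℝ) * x k := rfl

/-- The case of a sequence of entire functions that is bounded on every ball. -/
lemma exists_differentiable_bounded {g : ℕ → ℂ → ℂ} (hg : ∀ k, Differentiable ℂ (g k))
    (hb : ∀ R : ℝ, ∃ C, ∀ k, ∀ z : ℂ, ‖z‖ ≤ R → ‖g k z‖ ≤ C) :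
    ∃ G : ℂ → (ℕ →ᵇ ℂ), Differentiable ℂ G ∧ ∀ z k, G z k = g k z := by
  obtain ⟨G, h1, h2⟩ := exists_differentiableOn_boundedContinuousFunction (U := univ) g
    (fun k => (hg k).differentiableOn) (fun z _ => by
      obtain ⟨C, hC⟩ := hb (‖z‖ + 1)
      refine ⟨1, one_pos, C, subset_univ _, fun w hw k => hC k w ?_⟩
      have : ‖w - z‖ < 1 := by simpa [dist_eq_norm] using hw
      linarith [norm_le_norm_add_norm_sub' w z])
  exact ⟨G, differentiableOn_univ.1 h1, fun z k => h2 z (mem_univ z) k⟩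

/-- The space of parameters `(a, b, c, e, f)`. -/
abbrev Params : Type := ℂ × ℂ × ℂ × ℂ × ℂ

/-- The parametric excess. -/
abbrev excess (p : Params) : ℂ := p.2.2.2.1 + p.2.2.2.2 - p.1 - p.2.1 - p.2.2.1

lemma analyticAt_params (p : Params) : AnalyticAt ℂ (fun q : Params => q.1) p ∧
    AnalyticAt ℂ (fun q : Params => q.2.1) p ∧ AnalyticAt ℂ (fun q : Params => q.2.2.1) p ∧
    AnalyticAt ℂ (fun q : Params => q.2.2.2.1) p ∧ AnalyticAt ℂ (fun q : Params => q.2.2.2.2) p :=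
  have h2 : AnalyticAt ℂ (fun q : Params => q.2) p := analyticAt_snd
  have h3 : AnalyticAt ℂ (fun q : Params => q.2.2) p := analyticAt_snd.fun_comp h2
  have h4 : AnalyticAt ℂ (fun q : Params => q.2.2.2) p := analyticAt_snd.fun_comp h3
  ⟨analyticAt_fst, analyticAt_fst.fun_comp h2, analyticAt_fst.fun_comp h3,
    analyticAt_fst.fun_comp h4, analyticAt_snd.fun_comp h4⟩

lemma analyticAt_excess (p : Params) : AnalyticAt ℂ excess p := by
  obtain ⟨ha, hb, hc, he, hf⟩ := analyticAt_params p
  exact (((he.add hf).sub ha).sub hb).sub hc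

/-- The sum is analytic jointly in the parameters: it is a continuous linear form applied to a
product of five functions of one parameter each, and one function of the excess, with values in the
Banach algebra of bounded sequences. -/
lemma analyticAt_regSum {p : Params} (hp : 0 < (excess p).re) :
    AnalyticAt ℂ (fun p : Params => regSum p.1 p.2.1 p.2.2.1 p.2.2.2.1 p.2.2.2.2) p := by
  obtain ⟨X, hX, hX'⟩ := exists_differentiable_bounded differentiable_pochNormalized
    exists_norm_pochNormalized_le
  obtain ⟨Y, hY, hY'⟩ := exists_differentiable_bounded differentiable_rGammaNormalized
    exists_norm_rGammaNormalized_le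
  set ε := (excess p).re / 2 with hε
  have hε0 : 0 < ε := by positivity
  obtain ⟨N, hN, hN'⟩ := exists_differentiableOn_boundedContinuousFunction
    (U := {z : ℂ | ε < z.re}) (fun k z => ((k + 1 : ℕ) : ℂ) ^ ((ε : ℂ) - z))
    (fun k => by
      have : ((k + 1 : ℕ) : ℂ) ≠ 0 := by exact_mod_cast k.succ_ne_zero
      exact fun z _ => (((differentiableAt_const _).sub differentiableAt_id).const_cpow
        (Or.inl this)).differentiableWithinAt)
    (fun z hz => by
      have ho : IsOpen {z : ℂ | ε < z.re} := isOpen_lt continuous_const Complex.continuous_re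
      obtain ⟨r, hr, h⟩ := Metric.isOpen_iff.1 ho z hz
      refine ⟨r, hr, 1, h, fun w hw k => ?_⟩
      have hw' : ε < w.re := h hw
      rw [Complex.norm_natCast_cpow_of_pos k.succ_pos]
      refine Real.rpow_le_one_of_one_le_of_nonpos (by simp) ?_
      simp; linarith)
  have hopen : IsOpen {z : ℂ | ε < z.re} := isOpen_lt continuous_const Complex.continuous_re
  have hex : Continuous (excess) := by unfold excess; fun_prop
  have hmem : excess p ∈ {z : ℂ | ε < z.re} := by
    change ε < _; linarith
  have hev : ∀ᶠ q in 𝓝 p, excess q ∈ {z : ℂ | ε < z.re} :=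
    hex.continuousAt.eventually (hopen.mem_nhds hmem)
  have key : (fun q : Params => regSum q.1 q.2.1 q.2.2.1 q.2.2.2.1 q.2.2.2.2) =ᶠ[𝓝 p] fun q =>
      weightedSum hε0 (X q.1 * X q.2.1 * X q.2.2.1 * Y q.2.2.2.1 * Y q.2.2.2.2 * N (excess q)) := by
    filter_upwards [hev] with q hq
    rw [weightedSum_apply, regSum]
    congr 1; funext k
    have hk : ((k + 1 : ℕ) : ℂ) ≠ 0 := by exact_mod_cast k.succ_ne_zero
    simp only [BoundedContinuousFunction.mul_apply, hX', hY', hN' _ hq, regTerm_eq_normalized]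
    have : ((k + 1 : ℕ) : ℂ) ^ (-1 - (q.2.2.2.1 + q.2.2.2.2 - q.1 - q.2.1 - q.2.2.1)) =
        ((((k : ℝ) + 1) ^ (-1 - ε) : ℝ) : ℂ) * ((k + 1 : ℕ) : ℂ) ^ ((ε : ℂ) - excess q) := by
      rw [Complex.ofReal_cpow (by positivity)]
      push_cast
      rw [← Complex.cpow_add _ _ (by exact_mod_cast hk)]
      congr 1
      simp only [excess]
      ring
    rw [this]
    ring
  refine AnalyticAt.congr ?_ key.symm
  have aX : ∀ {u : Params → ℂ}, AnalyticAt ℂ u p → AnalyticAt ℂ (fun q => X (u q)) p :=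
    fun hu => (hX.analyticAt _).comp hu
  have aY : ∀ {u : Params → ℂ}, AnalyticAt ℂ u p → AnalyticAt ℂ (fun q => Y (u q)) p :=
    fun hu => (hY.analyticAt _).comp hu
  have aN : AnalyticAt ℂ (fun q => N (excess q)) p :=
    (hN.analyticAt (hopen.mem_nhds hmem)).fun_comp (f := excess) (analyticAt_excess p)
  obtain ⟨ha, hb, hc, he, hf⟩ := analyticAt_params p
  refine (weightedSum hε0).analyticAt _ |>.comp ?_
  exact (((((aX ha).mul (aX hb)).mul (aX hc)).mul (aY he)).mul (aY hf)).mul aN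

/-! ### The regularized function and its continuation to all parameters -/

lemma rGamma_add_natCast (f : ℂ) (k : ℕ) : rGamma (f + k) = (f + k) * rGamma (f + 1 + k) := by
  rw [rGamma_eq]; congr 2; ring

lemma regTerm_shift_f (a b c e f : ℂ) (k : ℕ) :
    regTerm a b c e f k = (f + k) * regTerm a b c e (f + 1) k := by
  rw [regTerm, regTerm, rGamma_add_natCast f]; ring

lemma regTerm_swap_ef (a b c e f : ℂ) : regTerm a b c e f = regTerm a b c f e := by
  funext k; rw [regTerm, regTerm]; ring

lemma regTerm_shift_e (a b c e f : ℂ) (k : ℕ) :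
    regTerm a b c e f k = (e + k) * regTerm a b c (e + 1) f k := by
  rw [regTerm_swap_ef, regTerm_shift_f, regTerm_swap_ef]

lemma rGamma_add_natCast_succ (e : ℂ) (k : ℕ) : rGamma (e + (k + 1 : ℕ)) = rGamma (e + 1 + k) := by
  congr 1; push_cast; ring

/-- The term ratio, cleared of denominators. -/
lemma succ_mul_regTerm_succ (a b c e f : ℂ) (k : ℕ) :
    (k + 1) * regTerm a b c e f (k + 1) =
      (a + k) * (b + k) * (c + k) * regTerm a b c (e + 1) (f + 1) k := by
  have h : (k : ℂ) + 1 ≠ 0 := Nat.cast_add_one_ne_zero k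
  have hf : (k.factorial : ℂ) ≠ 0 := by exact_mod_cast k.factorial_ne_zero
  rw [regTerm, regTerm, rGamma_add_natCast_succ, rGamma_add_natCast_succ,
    poch_succ, poch_succ, poch_succ, Nat.factorial_succ, Nat.cast_mul]
  generalize rGamma (e + 1 + k) = u
  generalize rGamma (f + 1 + k) = v
  generalize (k.factorial : ℂ) = w at *
  generalize poch a k = A
  generalize poch b k = B
  generalize poch c k = C
  push_cast
  field_simp

lemma regTerm_succ (a b c e f : ℂ) (k : ℕ) :
    (k + 1) * (e + k) * (f + k) * regTerm a b c e f (k + 1) =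
      (a + k) * (b + k) * (c + k) * regTerm a b c e f k := by
  have := succ_mul_regTerm_succ a b c e f k
  rw [regTerm_shift_e a b c e f k, regTerm_shift_f a b c (e + 1) f k]
  linear_combination (e + k) * (f + k) * this

/-- The telescoping sum behind all contiguous relations: for a polynomial `r` the quantity
`k (e + k - 1) (f + k - 1) r(k) tₖ` has difference
`((a + k) (b + k) (c + k) r(k + 1) - k (e + k - 1) (f + k - 1) r(k)) tₖ`, and it tends to `0`
as soon as the excess is large compared with the degree of `r`. -/
lemma eq_zero_of_hasSum_telescope {a b c e f S : ℂ} {r : ℂ → ℂ} {d : ℕ}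
    (hr : ∃ C, ∀ k : ℕ, ‖r k‖ ≤ C * ((k : ℝ) + 1) ^ d)
    (hs : 2 + d < (e + f - a - b - c).re) (P : ℕ → ℂ)
    (hP : ∀ k : ℕ, P k =
      (a + k) * (b + k) * (c + k) * r (k + 1) - k * (e + k - 1) * (f + k - 1) * r k)
    (hS : HasSum (fun k => P k * regTerm a b c e f k) S) : S = 0 := by
  obtain ⟨C, hC⟩ := exists_norm_regTerm_le a b c e f
  obtain ⟨D, hD⟩ := hr
  set σ := (e + f - a - b - c).re with hσ
  have hC0 : 0 ≤ C := by simpa using (norm_nonneg _).trans (hC 0)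
  have hD0 : 0 ≤ D := by simpa using (norm_nonneg _).trans (hD 0)
  set G : ℕ → ℂ := fun k => k * (e + k - 1) * (f + k - 1) * r k * regTerm a b c e f k with hG
  have hdiff : ∀ k, P k * regTerm a b c e f k = G (k + 1) - G k := by
    intro k
    have := regTerm_succ a b c e f k
    simp only [hG, hP]
    push_cast
    linear_combination (-r (k + 1)) * this
  have hlin : ∀ (x : ℂ) (k : ℕ), ‖x + k - 1‖ ≤ (‖x‖ + 1) * ((k : ℝ) + 1) := by
    intro x k
    calc ‖x + k - 1‖ ≤ ‖x‖ + ‖(k : ℂ)‖ + ‖(1 : ℂ)‖ :=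
          (norm_sub_le _ _).trans (by gcongr; exact norm_add_le _ _)
      _ = ‖x‖ + k + 1 := by simp
      _ ≤ _ := by nlinarith [norm_nonneg x, (Nat.cast_nonneg k : (0 : ℝ) ≤ k)]
  have hGb : ∀ k : ℕ, ‖G k‖ ≤
      ((‖e‖ + 1) * (‖f‖ + 1) * D * C) * ((k : ℝ) + 1) ^ (-(σ - (2 + d))) := by
    intro k
    have hk : (0 : ℝ) < (k : ℝ) + 1 := by positivity
    have hpow : ((k : ℝ) + 1) ^ (-(σ - (2 + d))) =
        ((k : ℝ) + 1) ^ (3 + d) * ((k : ℝ) + 1) ^ (-1 - σ) := by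
      rw [← Real.rpow_natCast, ← Real.rpow_add hk]; congr 1; push_cast; ring
    have h1 : ‖(k : ℂ)‖ ≤ (k : ℝ) + 1 := by simp
    have h2 := hlin e k
    have h3 := hlin f k
    have h4 := hD k
    have h5 := hC k
    rw [hpow]
    simp only [hG, norm_mul]
    calc _ ≤ ((k : ℝ) + 1) * ((‖e‖ + 1) * ((k : ℝ) + 1)) * ((‖f‖ + 1) * ((k : ℝ) + 1)) *
          (D * ((k : ℝ) + 1) ^ d) * (C * ((k : ℝ) + 1) ^ (-1 - σ)) := by gcongr
      _ = _ := by rw [pow_add]; ring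
  have hG0 : Tendsto G atTop (𝓝 0) := by
    refine squeeze_zero_norm hGb ?_
    rw [← mul_zero ((‖e‖ + 1) * (‖f‖ + 1) * D * C)]
    refine Tendsto.const_mul _ ?_
    have := (tendsto_rpow_neg_atTop (by linarith : 0 < σ - (2 + d))).comp
      (tendsto_natCast_atTop_atTop (R := ℝ) |>.atTop_add (tendsto_const_nhds (x := (1 : ℝ))))
    exact this
  have hsumG : ∀ n, ∑ k ∈ Finset.range n, P k * regTerm a b c e f k = G n := by
    intro n
    rw [Finset.sum_congr rfl fun k _ => hdiff k, Finset.sum_range_sub]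
    simp [hG]
  refine tendsto_nhds_unique hS.tendsto_sum_nat ?_
  simpa only [hsumG] using hG0

/-- The coefficient of `Φ(f + 2)` in the three-term relation raising `f`. -/
noncomputable def recB (a b c f : ℂ) : ℂ := (a - f - 1) * (b - f - 1) * (c - f - 1)

/-- The coefficient of `Φ(f + 1)` in the three-term relation raising `f`. -/
noncomputable def recA (a b c e f : ℂ) : ℂ :=
  (a - f) * (b - f) * (c - f) + f * (e - f - 1) - recB a b c f

lemma hasSum_regTerm {a b c e f : ℂ} (h : 0 < (e + f - a - b - c).re) :
    HasSum (regTerm a b c e f) (regSum a b c e f) := (summable_regTerm h).hasSum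

/-- A three-term relation between `f`, `f + 1` and `f + 2`. Its left side carries the excess as a
factor, so that it continues the sum to the left, with poles at most at the poles of `Γ(s)`. -/
lemma regSum_recursion {a b c e f : ℂ} (h : 0 < (e + f - a - b - c).re) :
    (e + f - a - b - c) * regSum a b c e f =
      recA a b c e f * regSum a b c e (f + 1) + recB a b c f * regSum a b c e (f + 2) := by
  have h1 : 0 < (e + (f + 1) - a - b - c).re := by simp at h ⊢; linarith
  have h2 : 0 < (e + (f + 2) - a - b - c).re := by simp at h ⊢; linarith
  have key := ((hasSum_regTerm h).mul_left (-(e + f - a - b - c))).add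
    (((hasSum_regTerm h1).mul_left (recA a b c e f)).add
      ((hasSum_regTerm h2).mul_left (recB a b c f)))
  have hcoef : ∀ k : ℕ, ((a + k) * (b + k) * (c + k) - k * (e + k - 1) * (f + 2 + k - 1)) *
      regTerm a b c e (f + 2) k = -(e + f - a - b - c) * regTerm a b c e f k +
      (recA a b c e f * regTerm a b c e (f + 1) k + recB a b c f * regTerm a b c e (f + 2) k) := by
    intro k
    rw [regTerm_shift_f a b c e f, regTerm_shift_f a b c e (f + 1),
      show f + 1 + 1 = f + 2 by ring, recA, recB]
    ring
  have := eq_zero_of_hasSum_telescope (a := a) (b := b) (c := c) (e := e) (f := f + 2)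
    (r := fun _ => 1) (d := 0) ⟨1, fun k => by simp⟩ (by simp at h ⊢; linarith)
    (fun k => (a + k) * (b + k) * (c + k) - k * (e + k - 1) * (f + 2 + k - 1))
    (fun k => by ring) (by convert! key using 1; funext k; exact hcoef k)
  linear_combination -this

/-- Approximations to the regularized function `Φ`: the `n`-th one is the right function in the
half-space where the excess has real part greater than `-n`. -/
noncomputable def phiAux : ℕ → ℂ → ℂ → ℂ → ℂ → ℂ → ℂ
  | 0, a, b, c, e, f => regSum a b c e f * rGamma (e + f - a - b - c)
  | n + 1, a, b, c, e, f => recA a b c e f * phiAux n a b c e (f + 1) +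
      recB a b c f * (e + f - a - b - c + 1) * phiAux n a b c e (f + 2)

/-- Multiplied by `1 / Γ(s + 1)`, the three-term relation has no denominators. -/
lemma phiAux_succ_eq (n : ℕ) {a b c e f : ℂ} (h : -(n : ℝ) < (e + f - a - b - c).re) :
    phiAux (n + 1) a b c e f = phiAux n a b c e f := by
  induction n generalizing f with
  | zero =>
    have h0 : 0 < (e + f - a - b - c).re := by simpa using h
    have key := regSum_recursion h0
    simp only [phiAux]
    rw [rGamma_eq (e + f - a - b - c), rGamma_eq (e + (f + 1) - a - b - c),
      show e + (f + 1) - a - b - c = e + f - a - b - c + 1 by ring,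
      show e + (f + 2) - a - b - c = e + f - a - b - c + 1 + 1 by ring]
    have h2 := rGamma_eq (e + f - a - b - c + 1)
    linear_combination (-rGamma (e + f - a - b - c + 1)) * key +
      (-recB a b c f * regSum a b c e (f + 2) - recA a b c e f * regSum a b c e (f + 1)) * h2
  | succ n ih =>
    have h1 : -(n : ℝ) < (e + (f + 1) - a - b - c).re := by
      push_cast at h; simp at h ⊢; linarith
    have h2 : -(n : ℝ) < (e + (f + 2) - a - b - c).re := by
      push_cast at h; simp at h ⊢; linarith
    rw [phiAux, ih h1, ih h2, phiAux]

lemma phiAux_eq_of_le {m n : ℕ} (hmn : m ≤ n) {a b c e f : ℂ}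
    (h : -(m : ℝ) < (e + f - a - b - c).re) : phiAux n a b c e f = phiAux m a b c e f := by
  induction n, hmn using Nat.le_induction with
  | base => rfl
  | succ n hn ih =>
    rw [phiAux_succ_eq n, ih]
    have : (m : ℝ) ≤ n := by exact_mod_cast hn
    linarith

/-- The regularized hypergeometric function `Φ = ₃F₂(a, b, c; e, f; 1) / (Γ(e) Γ(f) Γ(s))`, where
`s` is the excess: an entire function of its five parameters. -/
noncomputable def Phi (a b c e f : ℂ) : ℂ := phiAux (⌊-(e + f - a - b - c).re⌋₊ + 1) a b c e f

lemma Phi_eq_phiAux {n : ℕ} {a b c e f : ℂ} (h : -(n : ℝ) < (e + f - a - b - c).re) :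
    Phi a b c e f = phiAux n a b c e f := by
  have h0 := Nat.lt_floor_add_one (-(e + f - a - b - c).re)
  have h1 : -((⌊-(e + f - a - b - c).re⌋₊ + 1 : ℕ) : ℝ) < (e + f - a - b - c).re := by
    push_cast; linarith
  rcases le_total n (⌊-(e + f - a - b - c).re⌋₊ + 1) with hn | hn
  · exact phiAux_eq_of_le hn h
  · exact (phiAux_eq_of_le hn h1).symm

lemma Phi_eq_regSum {a b c e f : ℂ} (h : 0 < (e + f - a - b - c).re) :
    Phi a b c e f = regSum a b c e f * rGamma (e + f - a - b - c) :=
  Phi_eq_phiAux (n := 0) (by simpa using h)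

/-- A function of five arguments as a function on the space of parameters. -/
noncomputable abbrev uncurry5 (F : ℂ → ℂ → ℂ → ℂ → ℂ → ℂ) (p : Params) : ℂ :=
  F p.1 p.2.1 p.2.2.1 p.2.2.2.1 p.2.2.2.2

lemma analyticAt_phiAux (n : ℕ) {p : Params} (hp : -(n : ℝ) < (excess p).re) :
    AnalyticAt ℂ (uncurry5 (phiAux n)) p := by
  induction n generalizing p with
  | zero =>
    exact (analyticAt_regSum (by simpa using hp)).mul
      ((differentiable_rGamma.analyticAt _).fun_comp (analyticAt_excess p))
  | succ n ih =>
    obtain ⟨ha, hb, hc, he, hf⟩ := analyticAt_params p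
    have shift : ∀ m : ℕ, 1 ≤ m → AnalyticAt ℂ
        (fun q : Params => phiAux n q.1 q.2.1 q.2.2.1 q.2.2.2.1 (q.2.2.2.2 + m)) p := by
      intro m hm
      have h1 : AnalyticAt ℂ (fun q : Params =>
          ((q.1, q.2.1, q.2.2.1, q.2.2.2.1, q.2.2.2.2 + (m : ℂ)) : Params)) p :=
        ha.prod (hb.prod (hc.prod (he.prod (hf.add analyticAt_const))))
      refine AnalyticAt.fun_comp (g := uncurry5 (phiAux n))
        (f := fun q : Params => ((q.1, q.2.1, q.2.2.1, q.2.2.2.1, q.2.2.2.2 + (m : ℂ)) : Params))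
        (ih (p := (p.1, p.2.1, p.2.2.1, p.2.2.2.1, p.2.2.2.2 + (m : ℂ))) ?_) h1
      have : (1 : ℝ) ≤ m := by exact_mod_cast hm
      simp [excess] at hp ⊢
      linarith
    have hB : AnalyticAt ℂ (fun q : Params => recB q.1 q.2.1 q.2.2.1 q.2.2.2.2) p :=
      (((ha.sub hf).sub analyticAt_const).mul ((hb.sub hf).sub analyticAt_const)).mul
        ((hc.sub hf).sub analyticAt_const)
    have hA : AnalyticAt ℂ
        (fun q : Params => recA q.1 q.2.1 q.2.2.1 q.2.2.2.1 q.2.2.2.2) p :=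
      ((((ha.sub hf).mul (hb.sub hf)).mul (hc.sub hf)).add
        (hf.mul ((he.sub hf).sub analyticAt_const))).sub hB
    have h1 := shift 1 le_rfl
    have h2 := shift 2 (by norm_num)
    push_cast at h1 h2
    exact (hA.mul h1).add ((hB.mul ((analyticAt_excess p).add analyticAt_const)).mul h2)

lemma analyticAt_Phi (p : Params) : AnalyticAt ℂ (uncurry5 Phi) p := by
  obtain ⟨n, hn⟩ := exists_nat_gt (-(excess p).re)
  have hn' : -(n : ℝ) < (excess p).re := by linarith
  refine (analyticAt_phiAux n hn').congr ?_
  have hc : Continuous fun q : Params => (excess q).re := by unfold excess; fun_prop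
  filter_upwards [hc.continuousAt.eventually (lt_mem_nhds hn')] with q hq
  exact (Phi_eq_phiAux hq).symm

@[fun_prop]
lemma Differentiable.phi {a b c e f : ℂ → ℂ} (ha : Differentiable ℂ a) (hb : Differentiable ℂ b)
    (hc : Differentiable ℂ c) (he : Differentiable ℂ e) (hf : Differentiable ℂ f) :
    Differentiable ℂ fun z => Phi (a z) (b z) (c z) (e z) (f z) := fun z =>
  (analyticAt_Phi (a z, b z, c z, e z, f z)).differentiableAt.comp
    (f := fun z => ((a z, b z, c z, e z, f z) : Params)) z
    (((ha z).prodMk ((hb z).prodMk ((hc z).prodMk ((he z).prodMk (hf z))))))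

/-- Two entire functions that agree in some right half-plane are equal. -/
lemma eq_of_eq_on_halfPlane {f g : ℂ → ℂ} (hf : Differentiable ℂ f) (hg : Differentiable ℂ g)
    (R : ℝ) (h : ∀ z : ℂ, R < z.re → f z = g z) (z : ℂ) : f z = g z := by
  have hfa : AnalyticOnNhd ℂ f univ := fun z _ => hf.analyticAt z
  have hga : AnalyticOnNhd ℂ g univ := fun z _ => hg.analyticAt z
  refine congrFun (hfa.eq_of_eventuallyEq hga (z₀ := ((R + 1 : ℝ) : ℂ)) ?_) z
  have ho : IsOpen {z : ℂ | R < z.re} := isOpen_lt continuous_const Complex.continuous_re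
  filter_upwards [ho.mem_nhds (show R < ((R + 1 : ℝ) : ℂ).re by simp)] with w hw using h w hw

lemma eq_of_eq_of_ne {f g : ℂ → ℂ} (hf : Continuous f) (hg : Continuous g) (z₀ : ℂ)
    (h : ∀ z, z ≠ z₀ → f z = g z) (z : ℂ) : f z = g z := by
  have : Dense ({z₀}ᶜ : Set ℂ) := dense_compl_singleton z₀
  exact congrFun (hf.ext_on this hg fun w hw => h w hw) z

/-! ### Symmetry, existence and uniqueness of the continuation -/

lemma Phi_swap_ef (a b c e f : ℂ) : Phi a b c e f = Phi a b c f e := by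
  have := eq_of_eq_on_halfPlane (f := fun z => Phi a b c (e + z) f)
    (g := fun z => Phi a b c f (e + z)) (by fun_prop) (by fun_prop) (-(e + f - a - b - c).re)
    (fun z hz => by
      have h1 : 0 < (e + z + f - a - b - c).re := by simp at hz ⊢; linarith
      have h2 : 0 < (f + (e + z) - a - b - c).re := by simp at hz ⊢; linarith
      rw [Phi_eq_regSum h1, Phi_eq_regSum h2, regSum, regSum, regTerm_swap_ef]
      congr 2; ring) 0
  simpa using this

lemma Phi_swap_ab (a b c e f : ℂ) : Phi a b c e f = Phi b a c e f := by
  have := eq_of_eq_on_halfPlane (f := fun z => Phi a b c (e + z) f)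
    (g := fun z => Phi b a c (e + z) f) (by fun_prop) (by fun_prop) (-(e + f - a - b - c).re)
    (fun z hz => by
      have h1 : 0 < (e + z + f - a - b - c).re := by simp at hz ⊢; linarith
      have h2 : 0 < (e + z + f - b - a - c).re := by simp at hz ⊢; linarith
      rw [Phi_eq_regSum h1, Phi_eq_regSum h2, regSum, regSum]
      congr 2
      · funext k; rw [regTerm, regTerm]; ring
      · ring) 0
  simpa using this

lemma Phi_swap_bc (a b c e f : ℂ) : Phi a b c e f = Phi a c b e f := by
  have := eq_of_eq_on_halfPlane (f := fun z => Phi a b c (e + z) f)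
    (g := fun z => Phi a c b (e + z) f) (by fun_prop) (by fun_prop) (-(e + f - a - b - c).re)
    (fun z hz => by
      have h1 : 0 < (e + z + f - a - b - c).re := by simp at hz ⊢; linarith
      have h2 : 0 < (e + z + f - a - c - b).re := by simp at hz ⊢; linarith
      rw [Phi_eq_regSum h1, Phi_eq_regSum h2, regSum, regSum]
      congr 2
      · funext k; rw [regTerm, regTerm]; ring
      · ring) 0
  simpa using this

lemma Phi_swap_ac (a b c e f : ℂ) : Phi a b c e f = Phi c b a e f := by
  rw [Phi_swap_ab, Phi_swap_bc, Phi_swap_ab]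

lemma NonPole.rGamma_ne_zero {z : ℂ} (hz : NonPole z) : rGamma z ≠ 0 :=
  inv_ne_zero (Complex.Gamma_ne_zero hz)

lemma NonPole.Gamma_ne_zero {z : ℂ} (hz : NonPole z) : Gamma z ≠ 0 := Complex.Gamma_ne_zero hz

lemma nonPole_of_re_pos {z : ℂ} (hz : 0 < z.re) : NonPole z := fun k hk => by
  rw [hk] at hz
  simp at hz
  linarith [(Nat.cast_nonneg k : (0 : ℝ) ≤ k)]

lemma NonPole.add_natCast {z : ℂ} (hz : NonPole z) (n : ℕ) : NonPole (z + n) := fun k hk =>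
  hz (n + k) (by push_cast; linear_combination hk)

lemma NonPole.ne_zero {z : ℂ} (hz : NonPole z) : z ≠ 0 := by simpa using hz 0

lemma poch_mul_rGamma (e : ℂ) (k : ℕ) : poch e k * rGamma (e + k) = rGamma e := by
  induction k with
  | zero => simp [poch_zero]
  | succ k ih =>
    rw [poch_succ, ← ih, rGamma_eq (e + k)]
    push_cast
    rw [add_assoc e]; ring

lemma NonPole.poch_ne_zero {e : ℂ} (he : NonPole e) (k : ℕ) : poch e k ≠ 0 := fun h =>
  he.rGamma_ne_zero (by rw [← poch_mul_rGamma e k, h, zero_mul])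

lemma hypTerm_eq (a b c e f : ℂ) (k : ℕ) : hypTerm a b c e f k =
    poch a k * poch b k * poch c k / (poch e k * poch f k * k.factorial) := rfl

lemma hypTerm_mul_rGamma {e f : ℂ} (a b c : ℂ) (he : NonPole e) (hf : NonPole f) (k : ℕ) :
    hypTerm a b c e f k * (rGamma e * rGamma f) = regTerm a b c e f k := by
  have h1 := he.poch_ne_zero k
  have h2 := hf.poch_ne_zero k
  have h3 : (k.factorial : ℂ) ≠ 0 := by exact_mod_cast k.factorial_ne_zero
  rw [hypTerm_eq, regTerm, ← poch_mul_rGamma e k, ← poch_mul_rGamma f k]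
  field_simp

lemma Gamma_mul_rGamma {z : ℂ} (hz : NonPole z) : Gamma z * rGamma z = 1 :=
  mul_inv_cancel₀ hz.Gamma_ne_zero

lemma hasSum_hypTerm {a b c e f : ℂ} (he : NonPole e) (hf : NonPole f)
    (hs : 0 < (e + f - a - b - c).re) :
    HasSum (hypTerm a b c e f) (Gamma e * Gamma f * regSum a b c e f) := by
  refine ((hasSum_regTerm hs).mul_left (Gamma e * Gamma f)).congr_fun fun k => ?_
  rw [← hypTerm_mul_rGamma a b c he hf]
  linear_combination (-hypTerm a b c e f k) * (Gamma f * rGamma f) * Gamma_mul_rGamma he -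
    hypTerm a b c e f k * Gamma_mul_rGamma hf

lemma regSum_eq_Gamma_mul_Phi {a b c e f : ℂ} (hs : 0 < (e + f - a - b - c).re) :
    regSum a b c e f = Gamma (e + f - a - b - c) * Phi a b c e f := by
  rw [Phi_eq_regSum hs, mul_left_comm, Gamma_mul_rGamma (nonPole_of_re_pos hs), mul_one]

lemma analyticAt_Gamma {z : ℂ} (hz : NonPole z) : AnalyticAt ℂ Gamma z := by
  have := (differentiable_rGamma.analyticAt z).inv hz.rGamma_ne_zero
  refine this.congr (Eventually.of_forall fun w => ?_)
  simp [rGamma]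

/-- The analytic continuation of `₃F₂(1)` exists: it is `Γ(e) Γ(f) Γ(s) Φ`. -/
lemma isHyp3F2One_Gamma_mul_Phi : IsHyp3F2One fun a b c e f =>
    Gamma e * Gamma f * Gamma (e + f - a - b - c) * Phi a b c e f where
  hasSum a b c e f he hf hs := by
    have := hasSum_hypTerm he hf hs
    rwa [regSum_eq_Gamma_mul_Phi hs, ← mul_assoc] at this
  analytic p hp := by
    obtain ⟨h1, h2, h3⟩ := hp
    obtain ⟨ha, hb, hc, he, hf⟩ := analyticAt_params p
    have hG : ∀ {u : Params → ℂ}, AnalyticAt ℂ u p → NonPole (u p) →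
        AnalyticAt ℂ (fun q => Gamma (u q)) p := fun hu h => (analyticAt_Gamma h).fun_comp hu
    exact (((hG he h1).mul (hG hf h2)).mul (hG (analyticAt_excess p) h3)).mul (analyticAt_Phi p)

lemma countable_not_nonPole (e : ℂ) : {z : ℂ | ¬ NonPole (e + z)}.Countable := by
  refine (countable_range fun k : ℕ => -(k : ℂ) - e).mono fun z hz => ?_
  simp only [NonPole, not_forall, not_not, mem_ofPred_eq] at hz
  obtain ⟨k, hk⟩ := hz
  exact ⟨k, by simp only; rw [← hk]; ring⟩

/-- Uniqueness of the continuation: along the line in the direction of `e` the regular parameters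
form a connected set, which reaches into the region of convergence. -/
lemma IsHyp3F2One.eq {F : ℂ → ℂ → ℂ → ℂ → ℂ → ℂ} (hF : IsHyp3F2One F) {a b c e f : ℂ}
    (h : Regular a b c e f) :
    F a b c e f = Gamma e * Gamma f * Gamma (e + f - a - b - c) * Phi a b c e f := by
  obtain ⟨he, hf, hs⟩ := h
  set s := e + f - a - b - c with hsdef
  have hse : ∀ z, e + z + f - a - b - c = s + z := fun z => by rw [hsdef]; ring
  set U : Set ℂ := ({z : ℂ | ¬ NonPole (e + z)} ∪ {z : ℂ | ¬ NonPole (s + z)})ᶜ with hU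
  have hUc : IsPreconnected U := by
    refine (Set.Countable.isConnected_compl_of_one_lt_rank ?_
      ((countable_not_nonPole e).union (countable_not_nonPole s))).isPreconnected
    simp
  have hUmem : ∀ z, z ∈ U ↔ NonPole (e + z) ∧ NonPole (s + z) := fun z => by
    simp [hU]
  have hpos : ∀ z : ℂ, |e.re| + |s.re| < z.re → 0 < (e + z).re ∧ 0 < (s + z).re := by
    intro z hz
    simp only [Complex.add_re]
    constructor <;> linarith [neg_abs_le e.re, neg_abs_le s.re, abs_nonneg e.re, abs_nonneg s.re]
  set z₀ : ℂ := ((|e.re| + |s.re| + 1 : ℝ) : ℂ) with hz₀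
  have hz₀' : |e.re| + |s.re| < z₀.re := by rw [hz₀, Complex.ofReal_re]; linarith
  have hz₀U : z₀ ∈ U := (hUmem _).2
    ⟨nonPole_of_re_pos (hpos z₀ hz₀').1, nonPole_of_re_pos (hpos z₀ hz₀').2⟩
  have hline : Differentiable ℂ fun z : ℂ => ((a, b, c, e + z, f) : Params) :=
    (differentiable_const _).prodMk ((differentiable_const _).prodMk
      ((differentiable_const _).prodMk ((differentiable_id.const_add e).prodMk
        (differentiable_const _))))
  have h1 : AnalyticOnNhd ℂ
      (fun z => F a b c (e + z) f * (rGamma (e + z) * rGamma f * rGamma (s + z))) U := by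
    intro z hz
    have hz' := (hUmem z).1 hz
    refine AnalyticAt.mul ?_ (Differentiable.analyticAt (by fun_prop) z)
    refine AnalyticAt.fun_comp (g := uncurry5 F)
      (f := fun z : ℂ => ((a, b, c, e + z, f) : Params)) (hF.analytic _ ?_) (hline.analyticAt z)
    refine ⟨hz'.1, hf, ?_⟩
    simpa only [hse] using hz'.2
  have h2 : AnalyticOnNhd ℂ (fun z => Phi a b c (e + z) f) U := fun z _ =>
    Differentiable.analyticAt (by fun_prop) z
  have hev : (fun z => F a b c (e + z) f * (rGamma (e + z) * rGamma f * rGamma (s + z)))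
      =ᶠ[𝓝 z₀] fun z => Phi a b c (e + z) f := by
    have ho : IsOpen {z : ℂ | |e.re| + |s.re| < z.re} :=
      isOpen_lt continuous_const Complex.continuous_re
    filter_upwards [ho.mem_nhds hz₀'] with z hz
    obtain ⟨p1, p2⟩ := hpos z hz
    have n1 := nonPole_of_re_pos p1
    have n2 := nonPole_of_re_pos p2
    rw [← hse] at p2
    have := (hF.hasSum a b c (e + z) f n1 hf p2).unique (hasSum_hypTerm n1 hf p2)
    rw [this, regSum_eq_Gamma_mul_Phi p2, hse]
    linear_combination Phi a b c (e + z) f * (Gamma f * rGamma f * Gamma (s + z) * rGamma (s + z) *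
      Gamma_mul_rGamma n1 + Gamma (s + z) * rGamma (s + z) * Gamma_mul_rGamma hf +
      Gamma_mul_rGamma n2)
  have key := h1.eqOn_of_preconnected_of_eventuallyEq h2 hUc hz₀U hev
    ((hUmem 0).2 ⟨by simpa using he, by simpa using hs⟩)
  simp only [add_zero] at key
  rw [← key]
  linear_combination (-F a b c e f) * (Gamma f * rGamma f * Gamma s * rGamma s *
      Gamma_mul_rGamma he + Gamma s * rGamma s * Gamma_mul_rGamma hf +
      Gamma_mul_rGamma hs)

/-! ### Gauss's theorem -/

lemma tendsto_inv_add_natCast (x : ℂ) : Tendsto (fun n : ℕ => (x + n)⁻¹) atTop (𝓝 0) := by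
  refine tendsto_inv₀_cobounded.comp (tendsto_norm_atTop_iff_cobounded.1 ?_)
  refine tendsto_atTop_mono (f := fun n : ℕ => (n : ℝ) - ‖x‖) (fun n => ?_)
    (tendsto_natCast_atTop_atTop.atTop_add tendsto_const_nhds)
  have := norm_sub_le (x + n) x
  simp only [add_sub_cancel_left, Complex.norm_natCast] at this
  linarith

lemma hypTerm_zero (a b c e f : ℂ) : hypTerm a b c e f 0 = 1 := by
  simp [hypTerm_eq, poch_zero]

lemma hypTerm_succ (a b c e f : ℂ) (k : ℕ) : hypTerm a b c e f (k + 1) = hypTerm a b c e f k *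
    ((a + k) * (b + k) / (k + 1) * ((c + k) * ((e + k)⁻¹ * (f + k)⁻¹))) := by
  simp only [hypTerm_eq, poch_succ, Nat.factorial_succ, Nat.cast_mul, Nat.cast_add, Nat.cast_one,
    div_eq_mul_inv, mul_inv]
  ring

lemma tendsto_hypTerm_add_natCast (a b c e f : ℂ) (k : ℕ) :
    Tendsto (fun n : ℕ => hypTerm a b (c + n) (e + n) (f + n) k) atTop
      (𝓝 (if k = 0 then 1 else 0)) := by
  induction k with
  | zero => simp [hypTerm_zero]
  | succ k ih =>
    have h1 : Tendsto (fun n : ℕ => ((c - e) * (e + k + n)⁻¹ + 1) * (f + k + n)⁻¹) atTop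
        (𝓝 (((c - e) * 0 + 1) * 0)) :=
      (((tendsto_inv_add_natCast _).const_mul _).add_const 1).mul (tendsto_inv_add_natCast _)
    have hne : ∀ᶠ n : ℕ in atTop, e + k + n ≠ 0 := by
      obtain ⟨N, hN⟩ := exists_nat_gt ‖e + k‖
      filter_upwards [eventually_ge_atTop N] with n hn h0
      have hn' : (N : ℝ) ≤ n := by exact_mod_cast hn
      have : ‖e + k‖ = n := by
        rw [show e + k = -(n : ℂ) by linear_combination h0]; simp
      linarith
    have h2 : Tendsto (fun n : ℕ => (c + n + k) * ((e + n + k)⁻¹ * (f + n + k)⁻¹)) atTop (𝓝 0) := by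
      rw [mul_zero] at h1
      refine h1.congr' ?_
      filter_upwards [hne] with n hn
      rw [show e + n + k = e + k + n by ring, show f + n + k = f + k + n by ring]
      field_simp
      ring
    have := ih.mul (h2.const_mul ((a + k) * (b + k) / (k + 1)))
    simpa [hypTerm_succ] using this

/-- When the last three parameters are shifted to infinity only the constant term of the series
survives: each term is dominated by its value at a fixed large shift, with absolute values of the
parameters in place of the parameters. -/
lemma tendsto_tsum_hypTerm_add_natCast (a b c e f : ℂ) :
    Tendsto (fun n : ℕ => ∑' k, hypTerm a b (c + n) (e + n) (f + n) k) atTop (𝓝 1) := by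
  obtain ⟨N, hN⟩ := exists_nat_gt (‖a‖ + ‖b‖ + ‖c‖ + ‖e‖ + ‖f‖)
  have na := norm_nonneg a
  have nb := norm_nonneg b
  have nc := norm_nonneg c
  have ne := norm_nonneg e
  have nf := norm_nonneg f
  set B : ℕ → ℂ := hypTerm ((‖a‖ : ℝ) : ℂ) ((‖b‖ : ℝ) : ℂ) ((‖c‖ + N : ℝ) : ℂ) ((N - ‖e‖ : ℝ) : ℂ)
    ((N - ‖f‖ : ℝ) : ℂ) with hB
  have hsum : Summable fun k => ‖B k‖ := by
    refine (hasSum_hypTerm (nonPole_of_re_pos ?_) (nonPole_of_re_pos ?_) ?_).summable.norm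
    · rw [Complex.ofReal_re]; linarith
    · rw [Complex.ofReal_re]; linarith
    · simp only [Complex.sub_re, Complex.add_re, Complex.ofReal_re]; linarith
  have hreal : ∀ (x : ℝ) (k : ℕ), 0 ≤ x → ‖(x : ℂ) + k‖ = x + k := by
    intro x k hx
    rw [show (x : ℂ) + k = ((x + k : ℝ) : ℂ) by push_cast; ring, Complex.norm_real,
      Real.norm_of_nonneg (by positivity)]
  have hbound : ∀ n ≥ N, ∀ k, ‖hypTerm a b (c + n) (e + n) (f + n) k‖ ≤ ‖B k‖ := by
    intro n hn k
    have hn' : (N : ℝ) ≤ n := by exact_mod_cast hn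
    induction k with
    | zero => simp [hB, hypTerm_zero]
    | succ k ih =>
      have hk : (0 : ℝ) ≤ k := Nat.cast_nonneg k
      rw [hB, hypTerm_succ, hypTerm_succ]
      simp only [norm_mul, norm_div, norm_inv]
      rw [hreal ‖a‖ k na, hreal ‖b‖ k nb, hreal _ k (by positivity),
        hreal (N - ‖e‖) k (by linarith),
        hreal (N - ‖f‖) k (by linarith)]
      have hc' : ‖c + n + k‖ ≤ ‖c‖ + n + k := by
        refine (norm_add_le _ _).trans ?_
        gcongr
        · exact (norm_add_le _ _).trans (by simp)
        · simp
      have low : ∀ x : ℂ, (n : ℝ) + k - ‖x‖ ≤ ‖x + n + k‖ := by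
        intro x
        have := norm_sub_le (x + n + k) x
        rw [show x + n + k - x = ((n + k : ℕ) : ℂ) by push_cast; ring, Complex.norm_natCast] at this
        push_cast at this
        linarith
      have ha' : ‖a + k‖ ≤ ‖a‖ + k := (norm_add_le _ _).trans (by simp)
      have hb' : ‖b + k‖ ≤ ‖b‖ + k := (norm_add_le _ _).trans (by simp)
      have p1 : 0 < (N : ℝ) - ‖e‖ + k := by linarith
      have p2 : 0 < (N : ℝ) - ‖f‖ + k := by linarith
      have key : ‖c + n + k‖ * (‖e + n + k‖⁻¹ * ‖f + n + k‖⁻¹) ≤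
          (‖c‖ + N + k) * (((N : ℝ) - ‖e‖ + k)⁻¹ * ((N : ℝ) - ‖f‖ + k)⁻¹) := by
        calc ‖c + n + k‖ * (‖e + n + k‖⁻¹ * ‖f + n + k‖⁻¹)
            ≤ (‖c‖ + n + k) * (((n : ℝ) + k - ‖e‖)⁻¹ * ((N : ℝ) - ‖f‖ + k)⁻¹) := by
              have q1 : 0 < (n : ℝ) + k - ‖e‖ := by linarith
              have q2 := low e
              have q3 : (N : ℝ) - ‖f‖ + k ≤ ‖f + n + k‖ := by linarith [low f]
              gcongr
          _ = (‖c‖ + n + k) * ((n : ℝ) + k - ‖e‖)⁻¹ * ((N : ℝ) - ‖f‖ + k)⁻¹ := by ring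
          _ ≤ (‖c‖ + N + k) * ((N : ℝ) - ‖e‖ + k)⁻¹ * ((N : ℝ) - ‖f‖ + k)⁻¹ := by
              refine mul_le_mul_of_nonneg_right ?_ (by positivity)
              rw [← div_eq_mul_inv, ← div_eq_mul_inv, div_le_div_iff₀ (by linarith) p1]
              nlinarith
          _ = _ := by ring
      gcongr
  have := tendsto_tsum_of_dominated_convergence hsum
    (fun k => tendsto_hypTerm_add_natCast a b c e f k)
    (eventually_atTop.2 ⟨N, hbound⟩)
  simpa using this

lemma poch_eq_prod (z : ℂ) (n : ℕ) : poch z n = ∏ j ∈ Finset.range n, (z + j) := by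
  induction n with
  | zero => simp [poch_zero]
  | succ n ih => rw [poch_succ, Finset.prod_range_succ, ih]

/-- The asymptotics `Γ(z + n + 1) ~ n! n ^ z`. -/
lemma tendsto_rGamma_add_natCast {z : ℂ} (hz : NonPole z) :
    Tendsto (fun n : ℕ => rGamma (z + (n + 1 : ℕ)) * ((n : ℂ) ^ z * n.factorial)) atTop (𝓝 1) := by
  have h := (Complex.GammaSeq_tendsto_Gamma z).const_mul (rGamma z)
  rw [mul_comm, Gamma_mul_rGamma hz] at h
  refine h.congr fun n => ?_
  rw [Complex.GammaSeq, ← poch_eq_prod, ← poch_mul_rGamma z (n + 1)]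
  have := hz.poch_ne_zero (n + 1)
  field_simp

lemma tendsto_Gamma_ratio {a b c d : ℂ} (ha : 0 < a.re) (hb : 0 < b.re) (hc : 0 < c.re)
    (hd : 0 < d.re) (h : a + b = c + d) :
    Tendsto (fun n : ℕ => Gamma (a + n) * Gamma (b + n) * rGamma (c + n) * rGamma (d + n))
      atTop (𝓝 1) := by
  rw [← tendsto_add_atTop_iff_nat 1]
  have key := ((tendsto_rGamma_add_natCast (nonPole_of_re_pos hc)).mul
    (tendsto_rGamma_add_natCast (nonPole_of_re_pos hd))).div
    ((tendsto_rGamma_add_natCast (nonPole_of_re_pos ha)).mul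
      (tendsto_rGamma_add_natCast (nonPole_of_re_pos hb))) (by simp)
  simp only [mul_one, div_one] at key
  refine key.congr' ?_
  filter_upwards [eventually_ge_atTop 1] with n hn
  have hn0 : (n : ℂ) ≠ 0 := by exact_mod_cast (by omega : n ≠ 0)
  have hpow : (n : ℂ) ^ a * (n : ℂ) ^ b = (n : ℂ) ^ c * (n : ℂ) ^ d := by
    rw [← Complex.cpow_add _ _ hn0, ← Complex.cpow_add _ _ hn0, h]
  have hf : (n.factorial : ℂ) ≠ 0 := by exact_mod_cast n.factorial_ne_zero
  have pa : (n : ℂ) ^ a ≠ 0 := by simp [Complex.cpow_eq_zero_iff, hn0]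
  have pb : (n : ℂ) ^ b ≠ 0 := by simp [Complex.cpow_eq_zero_iff, hn0]
  have ga := ((nonPole_of_re_pos ha).add_natCast (n + 1)).Gamma_ne_zero
  have gb := ((nonPole_of_re_pos hb).add_natCast (n + 1)).Gamma_ne_zero
  simp only [Pi.div_apply, rGamma]
  rw [show (Gamma (c + (n + 1 : ℕ)))⁻¹ * ((n : ℂ) ^ c * n.factorial) *
    ((Gamma (d + (n + 1 : ℕ)))⁻¹ * ((n : ℂ) ^ d * n.factorial)) =
    (Gamma (c + (n + 1 : ℕ)))⁻¹ * (Gamma (d + (n + 1 : ℕ)))⁻¹ * n.factorial ^ 2 *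
    ((n : ℂ) ^ c * (n : ℂ) ^ d) by ring, ← hpow]
  field_simp

/-- Two sequences that satisfy the same first-order recurrence and tend to `1` have the same initial
value, even if coefficients of the recurrence vanish. -/
lemma eq_of_recurrence_of_tendsto {H G ρ : ℕ → ℂ} (hH : ∀ n, H n = ρ n * H (n + 1))
    (hG : ∀ n, G n = ρ n * G (n + 1)) (hH1 : Tendsto H atTop (𝓝 1)) (hG1 : Tendsto G atTop (𝓝 1)) :
    H 0 = G 0 := by
  have key : ∀ n, H 0 * G n = G 0 * H n := by
    intro n
    have h1 : ∀ n, H 0 = (∏ j ∈ Finset.range n, ρ j) * H n := fun n => by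
      induction n with
      | zero => simp
      | succ n ih => rw [Finset.prod_range_succ, mul_assoc, ← hH, ← ih]
    have h2 : ∀ n, G 0 = (∏ j ∈ Finset.range n, ρ j) * G n := fun n => by
      induction n with
      | zero => simp
      | succ n ih => rw [Finset.prod_range_succ, mul_assoc, ← hG, ← ih]
    rw [h1 n, h2 n]; ring
  have l1 := hG1.const_mul (H 0)
  have l2 := hH1.const_mul (G 0)
  simp only [key] at l1
  simpa using tendsto_nhds_unique l1 l2

lemma regTerm_one_one (a b c : ℂ) (k : ℕ) :
    regTerm a b 1 c 1 k = poch a k * poch b k * rGamma (c + k) / k.factorial := by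
  have h1 : poch 1 k * rGamma (1 + k) = 1 := by
    rw [poch_mul_rGamma]; simp [rGamma]
  rw [regTerm]
  linear_combination poch a k * poch b k * rGamma (c + k) / k.factorial * h1

/-- Gauss's contiguous relation in `c`, by telescoping with the certificate `r(k) = 1 / k`. The
value `r(0) = 0` is harmless, as `r(k)` occurs there with the factor `k`. -/
lemma regSum_gauss_recursion {a b c : ℂ} (h : 1 < (c - a - b).re) :
    (c - a - b) * regSum a b 1 c 1 = (c - a) * (c - b) * regSum a b 1 (c + 1) 1 := by
  have h0 : 0 < (c + 1 - a - b - 1).re := by simp at h ⊢; linarith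
  have h1 : 0 < (c + 1 + 1 - a - b - 1).re := by simp at h ⊢; linarith
  have key := ((hasSum_regTerm h0).mul_left (-(c - a - b))).add
    ((hasSum_regTerm h1).mul_left ((c - a) * (c - b)))
  have := eq_zero_of_hasSum_telescope (a := a) (b := b) (c := 1) (e := c + 1) (f := 1)
    (r := fun k => k⁻¹) (d := 0) ⟨1, fun k => ?_⟩ (by simp at h ⊢; linarith)
    (fun k => -(c - a - b) * (c + k) + (c - a) * (c - b))
    (fun k => ?_) (by
      convert! key using 1
      funext k
      rw [regTerm_shift_e a b 1 c 1]
      ring)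
  · linear_combination -this
  · rcases Nat.eq_zero_or_pos k with rfl | hk
    · simp
    · have : (1 : ℝ) ≤ k := by exact_mod_cast hk
      simpa using inv_le_one_of_one_le₀ this
  · have hk : (k : ℂ) + 1 ≠ 0 := Nat.cast_add_one_ne_zero k
    rcases Nat.eq_zero_or_pos k with rfl | hk'
    · simp; ring
    · have : (k : ℂ) ≠ 0 := by exact_mod_cast hk'.ne'
      field_simp
      ring

/-- Gauss's summation theorem, in regularized form. -/
lemma Phi_gauss (a b c : ℂ) : Phi a b 1 c 1 = rGamma (c - a) * rGamma (c - b) := by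
  refine eq_of_eq_on_halfPlane (f := fun c => Phi a b 1 c 1)
    (g := fun c => rGamma (c - a) * rGamma (c - b)) (by fun_prop) (by fun_prop)
    (‖a‖ + ‖b‖ + 1) (fun c hc => ?_) c
  have ra := abs_le.1 (Complex.abs_re_le_norm a)
  have rb := abs_le.1 (Complex.abs_re_le_norm b)
  have na := norm_nonneg a
  have nb := norm_nonneg b
  have pos1 : 0 < c.re := by linarith
  have pos2 : 0 < (c - a - b).re := by simp; linarith
  have pos3 : 0 < (c - a).re := by simp; linarith
  have pos4 : 0 < (c - b).re := by simp; linarith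
  have key := eq_of_recurrence_of_tendsto
    (H := fun n => Gamma (c + n) * regSum a b 1 (c + n) 1)
    (G := fun n => Gamma (c + n) * Gamma (c - a - b + n) * rGamma (c - a + n) * rGamma (c - b + n))
    (ρ := fun n => (c - a + n) * (c - b + n) / ((c + n) * (c - a - b + n)))
    (fun n => ?_) (fun n => ?_) ?_ (tendsto_Gamma_ratio pos1 pos2 pos3 pos4 (by ring))
  · have hs : 0 < (c + 1 - a - b - 1).re := by simp; linarith
    simp only [Nat.cast_zero, add_zero] at key
    have g1 := Gamma_mul_rGamma (nonPole_of_re_pos pos1)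
    have g2 := Gamma_mul_rGamma (nonPole_of_re_pos pos2)
    show Phi a b 1 c 1 = rGamma (c - a) * rGamma (c - b)
    rw [Phi_eq_regSum hs, show c + 1 - a - b - 1 = c - a - b by ring]
    linear_combination rGamma c * rGamma (c - a - b) * key -
      (regSum a b 1 c 1 * rGamma (c - a - b) -
        Gamma (c - a - b) * rGamma (c - a - b) * rGamma (c - a) * rGamma (c - b)) * g1 +
      rGamma (c - a) * rGamma (c - b) * g2
  · have hn : (0 : ℝ) ≤ n := Nat.cast_nonneg n
    have hrec := regSum_gauss_recursion (a := a) (b := b) (c := c + n) (by simp; linarith)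
    have p1 : c + n ≠ 0 := ((nonPole_of_re_pos pos1).add_natCast n).ne_zero
    have p2 : c - a - b + n ≠ 0 := ((nonPole_of_re_pos pos2).add_natCast n).ne_zero
    rw [show c + ((n + 1 : ℕ) : ℂ) = c + n + 1 by push_cast; ring, Complex.Gamma_add_one _ p1]
    field_simp
    linear_combination Gamma (c + n) * hrec
  · have p1 : c + n ≠ 0 := ((nonPole_of_re_pos pos1).add_natCast n).ne_zero
    have p2 : c - a - b + n ≠ 0 := ((nonPole_of_re_pos pos2).add_natCast n).ne_zero
    rw [rGamma_eq (c - a + n), rGamma_eq (c - b + n)]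
    push_cast
    simp only [← add_assoc]
    rw [Complex.Gamma_add_one _ p1, Complex.Gamma_add_one _ p2]
    field_simp
  · refine (tendsto_tsum_hypTerm_add_natCast a b 1 c 1).congr fun n => ?_
    have hn : (0 : ℝ) ≤ n := Nat.cast_nonneg n
    have n1 : NonPole (c + n) := (nonPole_of_re_pos pos1).add_natCast n
    have n2 : NonPole (1 + n : ℂ) := (nonPole_of_re_pos (by simp)).add_natCast n
    have n3 : NonPole 1 := nonPole_of_re_pos (by simp)
    have := (hasSum_hypTerm (a := a) (b := b) (c := 1) n1 n3 (by simp; linarith)).tsum_eq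
    rw [Complex.Gamma_one, mul_one] at this
    rw [← this]
    congr 1; funext k
    have q2 := n2.poch_ne_zero k
    have q3 := n3.poch_ne_zero k
    rw [hypTerm_eq, hypTerm_eq]
    field_simp

/-- Gauss's theorem as a statement about series. -/
lemma tsum_gauss {a b c : ℂ} (h : 0 < (c - a - b).re) :
    ∑' k : ℕ, poch a k * poch b k * rGamma (c + k) / k.factorial =
      Gamma (c - a - b) * rGamma (c - a) * rGamma (c - b) := by
  have hs : c + 1 - a - b - 1 = c - a - b := by ring
  have := regSum_eq_Gamma_mul_Phi (a := a) (b := b) (c := 1) (e := c) (f := 1) (by rwa [hs])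
  rw [regSum, hs, Phi_gauss] at this
  simp only [regTerm_one_one] at this
  rw [this]; ring

/-! ### The transformations of Thomae and Kummer, and contiguous relations -/

/-- `(q)ₖ₊ₘ` dominates `(re q)ₖ (re q)ₘ`, which separates the variables in the double series. -/
lemma norm_poch_re_mul_le {q : ℂ} (hq : 0 < q.re) (k m : ℕ) :
    ‖poch (q.re : ℂ) k‖ * ‖poch (q.re : ℂ) m‖ ≤ ‖poch q (k + m)‖ := by
  have hstep : ∀ j l : ℕ, j ≤ l → ‖(q.re : ℂ) + j‖ ≤ ‖q + l‖ := by
    intro j l hjl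
    have h : (j : ℝ) ≤ l := by exact_mod_cast hjl
    rw [show (q.re : ℂ) + j = ((q.re + j : ℝ) : ℂ) by push_cast; ring, Complex.norm_real,
      Real.norm_of_nonneg (by positivity)]
    refine le_trans ?_ (Complex.re_le_norm _)
    simpa using h
  induction m with
  | zero =>
    simp only [poch_zero, norm_one, mul_one, add_zero]
    induction k with
    | zero => simp [poch_zero]
    | succ k ih =>
      rw [poch_succ, poch_succ, norm_mul, norm_mul]
      exact mul_le_mul ih (hstep k k le_rfl) (norm_nonneg _) (norm_nonneg _)
  | succ m ih =>
    rw [← add_assoc, poch_succ, poch_succ, norm_mul, norm_mul, ← mul_assoc]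
    refine mul_le_mul ih ?_ (norm_nonneg _) (norm_nonneg _)
    exact hstep m (k + m) (by omega)

lemma Gamma_add_natCast {z : ℂ} (hz : NonPole z) (k : ℕ) : Gamma (z + k) = Gamma z * poch z k := by
  have h1 := Gamma_mul_rGamma hz
  have h2 := Gamma_mul_rGamma (hz.add_natCast k)
  rw [← poch_mul_rGamma z k] at h1
  linear_combination (-Gamma (z + k)) * h1 + Gamma z * poch z k * h2

/-- The double series whose two iterated sums are the two sides of Thomae's transformation. -/
noncomputable def thomaeTerm (b c u v q : ℂ) (k m : ℕ) : ℂ :=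
  (poch b k * poch c k / k.factorial) * (poch u m * poch v m / m.factorial) *
    rGamma (q + ((k + m : ℕ) : ℂ))

lemma summable_thomaeTerm {b c u v q : ℂ} (h1 : ‖b‖ + ‖c‖ < q.re) (h2 : ‖u‖ + ‖v‖ < q.re) :
    Summable (Function.uncurry (thomaeTerm b c u v q)) := by
  have hq : 0 < q.re := by linarith [norm_nonneg b, norm_nonneg c]
  have hR : NonPole (q.re : ℂ) := nonPole_of_re_pos (by simpa using hq)
  have h1' : NonPole (1 : ℂ) := nonPole_of_re_pos (by simp)
  have S : ∀ x y : ℂ, ‖x‖ + ‖y‖ < q.re → Summable fun k => ‖hypTerm x y 1 q.re 1 k‖ := by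
    intro x y h
    refine (hasSum_hypTerm hR h1' ?_).summable.norm
    have := Complex.re_le_norm x
    have := Complex.re_le_norm y
    simp
    linarith
  refine Summable.of_norm_bounded (((S b c h1).mul_of_nonneg (S u v h2) (fun _ => norm_nonneg _)
    (fun _ => norm_nonneg _)).mul_left ‖rGamma q‖) fun p => ?_
  obtain ⟨k, m⟩ := p
  have e1 : ∀ x y : ℂ, ∀ j, hypTerm x y 1 q.re 1 j =
      poch x j * poch y j / j.factorial / poch (q.re : ℂ) j := fun x y j => by
    have := h1'.poch_ne_zero j
    rw [hypTerm_eq]; field_simp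
  have hq' : NonPole q := nonPole_of_re_pos hq
  have e2 : rGamma (q + ((k + m : ℕ) : ℂ)) = rGamma q / poch q (k + m) := by
    rw [← poch_mul_rGamma q (k + m)]
    have := hq'.poch_ne_zero (k + m)
    field_simp
  simp only [Function.uncurry, thomaeTerm, e1, e2]
  have p1 := norm_pos_iff.2 (hR.poch_ne_zero k)
  have p2 := norm_pos_iff.2 (hR.poch_ne_zero m)
  have key := norm_poch_re_mul_le hq k m
  simp only [norm_mul (_ * _) (_ / _), norm_mul (_ / _) (_ / _), norm_div _ (poch _ _)]
  calc _ ≤ ‖poch b k * poch c k / k.factorial‖ * ‖poch u m * poch v m / m.factorial‖ *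
        (‖rGamma q‖ / (‖poch (q.re : ℂ) k‖ * ‖poch (q.re : ℂ) m‖)) := by gcongr
    _ = _ := by field_simp

/-- Thomae's transformation: sum the double series in either order by Gauss's theorem. -/
lemma Phi_thomae (a b c e f : ℂ) : Phi a b c e f =
    Phi (e - a) (f - a) (e + f - a - b - c) (e + f - a - c) (e + f - a - b) := by
  set u := e - a with hu
  set v := f - a with hv
  -- fix `u = e - a` and `v = f - a` and continue from large `a`, where both iterated sums and the
  -- double series converge absolutely
  have main := eq_of_eq_on_halfPlane (f := fun a => Phi a b c (a + u) (a + v))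
    (g := fun a => Phi u v (a + u + v - b - c) (a + u + v - c) (a + u + v - b)) (by fun_prop)
    (by fun_prop) (2 * ‖u‖ + 2 * ‖v‖ + ‖b‖ + ‖c‖) (fun a ha => ?_) a
  · rw [show a + u = e by rw [hu]; ring, show a + v = f by rw [hv]; ring] at main
    rw [main, hv]
    congr 1 <;> ring
  clear_value u v
  have nu := norm_nonneg u
  have nv := norm_nonneg v
  have nb := norm_nonneg b
  have nc := norm_nonneg c
  have ru := abs_le.1 (Complex.abs_re_le_norm u)
  have rv := abs_le.1 (Complex.abs_re_le_norm v)
  have rb := abs_le.1 (Complex.abs_re_le_norm b)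
  have rc := abs_le.1 (Complex.abs_re_le_norm c)
  set q := a + u + v with hq
  have qre : q.re = a.re + u.re + v.re := by simp [hq]
  have hsum := summable_thomaeTerm (b := b) (c := c) (u := u) (v := v) (q := q)
    (by linarith) (by linarith)
  have pa : 0 < a.re := by linarith
  have ps : 0 < (q - b - c).re := by simp; linarith
  have na := nonPole_of_re_pos pa
  have ns := nonPole_of_re_pos ps
  have row : ∀ k, ∑' m, thomaeTerm b c u v q k m = Gamma a * regTerm a b c (a + u) (a + v) k := by
    intro k
    have hre : (q + k - u - v).re = a.re + k := by simp [qre]; ring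
    have g := tsum_gauss (a := u) (b := v) (c := q + k) (by rw [hre]; positivity)
    have : ∀ m, thomaeTerm b c u v q k m = (poch b k * poch c k / k.factorial) *
        (poch u m * poch v m * rGamma (q + k + m) / m.factorial) := fun m => by
      rw [thomaeTerm]; push_cast; rw [← add_assoc]; ring
    simp only [this]
    rw [tsum_mul_left, g, show q + k - u - v = a + k by rw [hq]; ring, Gamma_add_natCast na,
      regTerm,
      show q + k - u = a + v + k by rw [hq]; ring, show q + k - v = a + u + k by rw [hq]; ring]
    ring
  have col : ∀ m, ∑' k, thomaeTerm b c u v q k m =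
      Gamma (q - b - c) * regTerm u v (q - b - c) (q - c) (q - b) m := by
    intro m
    have hre : (q + m - b - c).re = (q - b - c).re + m := by simp; ring
    have g := tsum_gauss (a := b) (b := c) (c := q + m) (by rw [hre]; positivity)
    have : ∀ k, thomaeTerm b c u v q k m = (poch u m * poch v m / m.factorial) *
        (poch b k * poch c k * rGamma (q + m + k) / k.factorial) := fun k => by
      rw [thomaeTerm, show q + ((k + m : ℕ) : ℂ) = q + m + k by push_cast; ring]; ring
    simp only [this]
    rw [tsum_mul_left, g, show q + m - b - c = q - b - c + m by ring, Gamma_add_natCast ns, regTerm,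
      show q + m - b = q - b + m by ring, show q + m - c = q - c + m by ring]
    ring
  have key := hsum.tsum_comm
  simp only [row, col] at key
  rw [tsum_mul_left, tsum_mul_left] at key
  change Gamma (q - b - c) * regSum u v (q - b - c) (q - c) (q - b) =
    Gamma a * regSum a b c (a + u) (a + v) at key
  have ex1 : a + u + (a + v) - a - b - c = q - b - c := by rw [hq]; ring
  have ex2 : q - c + (q - b) - u - v - (q - b - c) = a := by rw [hq]; ring
  show Phi a b c (a + u) (a + v) = Phi u v (q - b - c) (q - c) (q - b)
  rw [Phi_eq_regSum (by rwa [ex1]), Phi_eq_regSum (by rwa [ex2]), ex1, ex2]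
  have g1 := Gamma_mul_rGamma na
  have g2 := Gamma_mul_rGamma ns
  linear_combination (-rGamma a * rGamma (q - b - c)) * key -
    (regSum a b c (a + u) (a + v) * rGamma (q - b - c)) * g1 +
    (regSum u v (q - b - c) (q - c) (q - b) * rGamma a) * g2

/-- Kummer's transformation: Thomae's transformation applied twice. -/
lemma Phi_kummer (a b c e f : ℂ) :
    Phi a b c e f = Phi (f - a) (f - b) c (e + f - a - b) f := by
  rw [Phi_swap_ac a b c e f, Phi_thomae c b a e f, Phi_thomae (e - c)]
  rw [show e + f - c - a + (e + f - c - b) - (e - c) - (f - c) - (e + f - c - b - a) = c by ring,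
    show e + f - c - a - (e - c) = f - a by ring, show e + f - c - b - (e - c) = f - b by ring,
    show e + f - c - a + (e + f - c - b) - (e - c) - (e + f - c - b - a) = f by ring,
    show e + f - c - a + (e + f - c - b) - (e - c) - (f - c) = e + f - a - b by ring, Phi_swap_ef]

/-- The contiguous relation between `a + 1` and `b + 1`. -/
lemma Phi_contiguous_num (a b c e f : ℂ) :
    a * Phi (a + 1) b c e f - b * Phi a (b + 1) c e f =
      (a - b) * (e + f - a - b - c - 1) * Phi a b c e f := by
  have := eq_of_eq_on_halfPlane
    (f := fun z => a * Phi (a + 1) b c (e + z) f - b * Phi a (b + 1) c (e + z) f)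
    (g := fun z => (a - b) * (e + z + f - a - b - c - 1) * Phi a b c (e + z) f)
    (by fun_prop) (by fun_prop) (-(e + f - a - b - c).re + 1) (fun z hz => ?_) 0
  · simpa using this
  generalize he' : e + z = e'
  have hs : 1 < (e' + f - a - b - c).re := by rw [← he']; simp at hz ⊢; linarith
  have h1 : 0 < (e' + f - (a + 1) - b - c).re := by simp at hs ⊢; linarith
  have h2 : 0 < (e' + f - a - (b + 1) - c).re := by simp at hs ⊢; linarith
  have h3 : 0 < (e' + f - a - b - c).re := by linarith
  have pshift : ∀ (x : ℂ) (k : ℕ), x * poch (x + 1) k = poch x k * (x + k) :=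
    fun x k => by rw [← poch_succ_left, poch_succ]
  have hsum : a * regSum (a + 1) b c e' f - b * regSum a (b + 1) c e' f =
      (a - b) * regSum a b c e' f := by
    refine (((hasSum_regTerm h1).mul_left a).sub ((hasSum_regTerm h2).mul_left b)).unique
      (((hasSum_regTerm h3).mul_left (a - b)).congr_fun fun k => ?_)
    simp only [regTerm]
    linear_combination (poch b k * poch c k * rGamma (e' + k) * rGamma (f + k) / k.factorial) *
      pshift a k - (poch a k * poch c k * rGamma (e' + k) * rGamma (f + k) / k.factorial) *
      pshift b k
  rw [Phi_eq_regSum h1, Phi_eq_regSum h2, Phi_eq_regSum h3,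
    show e' + f - (a + 1) - b - c = e' + f - a - b - c - 1 by ring,
    show e' + f - a - (b + 1) - c = e' + f - a - b - c - 1 by ring,
    rGamma_eq (e' + f - a - b - c - 1), sub_add_cancel]
  linear_combination (e' + f - a - b - c - 1) * rGamma (e' + f - a - b - c) * hsum

/-- The contiguous relation between `e - 1` and `f - 1`. -/
lemma Phi_contiguous_den (a b c e f : ℂ) :
    Phi a b c (e - 1) f - Phi a b c e (f - 1) =
      (e - f) * (e + f - a - b - c - 1) * Phi a b c e f := by
  have := eq_of_eq_on_halfPlane
    (f := fun z => Phi a b c (e + z - 1) (f + z) - Phi a b c (e + z) (f + z - 1))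
    (g := fun z => (e - f) * (e + z + (f + z) - a - b - c - 1) * Phi a b c (e + z) (f + z))
    (by fun_prop) (by fun_prop) (|(e + f - a - b - c).re| + 1) (fun z hz => ?_) 0
  · simpa using this
  have hef : e - f = e + z - (f + z) := by ring
  simp only [hef]
  have hs : 1 < (e + z + (f + z) - a - b - c).re := by
    have l1 := neg_abs_le (e + f - a - b - c).re
    have l2 := abs_nonneg (e + f - a - b - c).re
    simp only [Complex.sub_re, Complex.add_re] at hz l1 l2 ⊢
    linarith
  generalize e + z = e' at *
  generalize f + z = f' at *
  have h1 : 0 < (e' - 1 + f' - a - b - c).re := by simp at hs ⊢; linarith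
  have h2 : 0 < (e' + (f' - 1) - a - b - c).re := by simp at hs ⊢; linarith
  have h3 : 0 < (e' + f' - a - b - c).re := by linarith
  have hsum : regSum a b c (e' - 1) f' - regSum a b c e' (f' - 1) =
      (e' - f') * regSum a b c e' f' := by
    refine ((hasSum_regTerm h1).sub (hasSum_regTerm h2)).unique
      (((hasSum_regTerm h3).mul_left (e' - f')).congr_fun fun k => ?_)
    rw [regTerm_shift_e a b c (e' - 1), regTerm_shift_f a b c e' (f' - 1), sub_add_cancel,
      sub_add_cancel]
    ring
  rw [Phi_eq_regSum h1, Phi_eq_regSum h2, Phi_eq_regSum h3,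
    show e' - 1 + f' - a - b - c = e' + f' - a - b - c - 1 by ring,
    show e' + (f' - 1) - a - b - c = e' + f' - a - b - c - 1 by ring,
    rGamma_eq (e' + f' - a - b - c - 1), sub_add_cancel]
  linear_combination (e' + f' - a - b - c - 1) * rGamma (e' + f' - a - b - c) * hsum

/-! ### Whipple's theorem -/

/-- A first-order recursion in the direction `(c, e, f) → (c + 2, e + 2, f + 2)`. It telescopes with
a certificate of degree two in `k`, with the coefficients `r0`, `r1`, `r2`. -/
lemma regSum_whipple_recursion {a c e f : ℂ} (hef : e + f = 1 + 2 * c) (hc : 0 < c.re) :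
    regSum a (1 - a) c e f =
      ((a + e) * (1 - a + e) * (a + f) * (1 - a + f)) *
        regSum a (1 - a) (c + 2) (e + 2) (f + 2) := by
  have ex0 : e + f - a - (1 - a) - c = c := by linear_combination hef
  have ex2 : e + 2 + (f + 2) - a - (1 - a) - (c + 2) = c + 2 := by linear_combination hef
  have exu : e + 2 + (f + 2) - a - (1 - a) - c = c + 4 := by linear_combination hef
  have hf : f = 1 + 2 * c - e := by linear_combination hef
  have h0 : 0 < (e + f - a - (1 - a) - c).re := by rwa [ex0]
  have h2 : 0 < (e + 2 + (f + 2) - a - (1 - a) - (c + 2)).re := by rw [ex2]; simp; linarith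
  have c0 : c ≠ 0 := (nonPole_of_re_pos hc).ne_zero
  have c1 : c + 1 ≠ 0 := by simpa using ((nonPole_of_re_pos hc).add_natCast 1).ne_zero
  set X := (a + e) * (1 - a + e) * (a + f) * (1 - a + f) with hX
  have key := ((hasSum_regTerm h0).mul_left (c * (c + 1))).sub
    ((hasSum_regTerm h2).mul_left (c * (c + 1) * X))
  set r2 : ℂ := -(c + 1) with hr2
  set r1 : ℂ := -4 * c * (c + 1) - (1 + a * (1 - a) + c - e * f) with hr1
  set r0 : ℂ := (c + 1) * (-(1 + 2 * c) * (2 + 2 * c) + 2 * (e * f) - a * (1 - a)) - r1 -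
      r2 with hr0
  have pshift : ∀ k : ℕ, c * (c + 1) * poch (c + 2) k = poch c k * ((c + k) * (c + 1 + k)) := by
    intro k
    induction k with
    | zero => simp [poch_zero]
    | succ k ih =>
      rw [poch_succ, poch_succ, ← mul_assoc (c * (c + 1)), ih]; push_cast; ring
  have hcoef : ∀ k : ℕ, c * (c + 1) * regTerm a (1 - a) c e f k -
      c * (c + 1) * X * regTerm a (1 - a) (c + 2) (e + 2) (f + 2) k =
      (c * (c + 1) * ((e + k) * (e + 1 + k) * ((f + k) * (f + 1 + k))) -
        X * ((c + k) * (c + 1 + k))) * regTerm a (1 - a) c (e + 2) (f + 2) k := by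
    intro k
    have e1 : regTerm a (1 - a) c e f k = (e + k) * (e + 1 + k) * ((f + k) * (f + 1 + k)) *
        regTerm a (1 - a) c (e + 2) (f + 2) k := by
      rw [regTerm_shift_e a (1 - a) c e f, regTerm_shift_e a (1 - a) c (e + 1) f,
        regTerm_shift_f a (1 - a) c (e + 1 + 1) f, regTerm_shift_f a (1 - a) c (e + 1 + 1) (f + 1),
        show e + 1 + 1 = e + 2 by ring, show f + 1 + 1 = f + 2 by ring]
      ring
    have e2 : c * (c + 1) * regTerm a (1 - a) (c + 2) (e + 2) (f + 2) k =
        (c + k) * (c + 1 + k) * regTerm a (1 - a) c (e + 2) (f + 2) k := by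
      rw [regTerm, regTerm]
      linear_combination (poch a k * poch (1 - a) k * rGamma (e + 2 + k) * rGamma (f + 2 + k) /
        k.factorial) * pshift k
    linear_combination c * (c + 1) * e1 - X * e2
  have := eq_zero_of_hasSum_telescope (a := a) (b := 1 - a) (c := c) (e := e + 2) (f := f + 2)
    (r := fun k => r0 + r1 * k + r2 * k ^ 2) (d := 2)
    ⟨‖r0‖ + ‖r1‖ + ‖r2‖, fun k => ?_⟩ (by rw [exu]; simp; linarith)
    (fun k => c * (c + 1) * ((e + k) * (e + 1 + k) * ((f + k) * (f + 1 + k))) -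
        X * ((c + k) * (c + 1 + k)))
    (fun k => ?_) (by convert! key using 1; funext k; exact (hcoef k).symm)
  · have hne : c * (c + 1) ≠ 0 := mul_ne_zero c0 c1
    refine mul_left_cancel₀ hne ?_
    linear_combination this
  · have hk : (0 : ℝ) ≤ k := Nat.cast_nonneg k
    calc ‖r0 + r1 * (k : ℂ) + r2 * (k : ℂ) ^ 2‖ ≤ ‖r0‖ + ‖r1‖ * k + ‖r2‖ * (k : ℝ) ^ 2 := by
          refine (norm_add_le _ _).trans (add_le_add ((norm_add_le _ _).trans ?_) ?_) <;> simp
      _ ≤ ‖r0‖ * ((k : ℝ) + 1) ^ 2 + ‖r1‖ * ((k : ℝ) + 1) ^ 2 + ‖r2‖ * ((k : ℝ) + 1) ^ 2 := by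
          have l0 : 1 ≤ ((k : ℝ) + 1) ^ 2 := by nlinarith
          have l1 : (k : ℝ) ≤ ((k : ℝ) + 1) ^ 2 := by nlinarith
          have l2 : (k : ℝ) ^ 2 ≤ ((k : ℝ) + 1) ^ 2 := by nlinarith
          gcongr
          exact le_mul_of_one_le_right (norm_nonneg _) l0
      _ = _ := by ring
  · simp only [hX, hr0, hr1, hr2, hf]
    ring

lemma two_cpow_add (x y : ℂ) : (2 : ℂ) ^ (x + y) = 2 ^ x * 2 ^ y :=
  Complex.cpow_add _ _ two_ne_zero

lemma sqrt_pi_mul_self : (Real.sqrt Real.pi : ℂ) * (Real.sqrt Real.pi : ℂ) = Real.pi := by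
  rw [← Complex.ofReal_mul, Real.mul_self_sqrt Real.pi_pos.le]

/-- The product of reciprocal Gamma values in Whipple's theorem. -/
noncomputable def whippleProd (a e f : ℂ) : ℂ :=
  rGamma ((a + e) / 2) * rGamma ((1 - a + e) / 2) *
    (rGamma ((a + f) / 2) * rGamma ((1 - a + f) / 2))

@[fun_prop]
lemma Differentiable.whippleProd {a e f : ℂ → ℂ} (ha : Differentiable ℂ a)
    (he : Differentiable ℂ e) (hf : Differentiable ℂ f) :
    Differentiable ℂ fun z => whippleProd (a z) (e z) (f z) := by
  unfold _root_.whippleProd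
  fun_prop

lemma differentiable_two_cpow {u : ℂ → ℂ} (hu : Differentiable ℂ u) :
    Differentiable ℂ fun z => (2 : ℂ) ^ u z := fun z =>
  (hu z).const_cpow (Or.inl two_ne_zero)

/-- Whipple's theorem, in regularized form. Both sides satisfy the recursion of
`regSum_whipple_recursion`, and both tend to `1`, suitably normalized, as `c`, `e`, `f` go to
infinity along it. -/
lemma Phi_whipple {a c e f : ℂ} (hef : e + f = 1 + 2 * c) : Phi a (1 - a) c e f =
    Real.pi * 2 ^ (1 - 2 * c) * rGamma c * whippleProd a e f := by
  have main := eq_of_eq_on_halfPlane (f := fun z => Phi a (1 - a) (c + z) (e + z) (f + z))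
    (g := fun z => Real.pi * 2 ^ (1 - 2 * (c + z)) * rGamma (c + z) *
      whippleProd a (e + z) (f + z)) (by fun_prop) ?_
    (‖a‖ + ‖c‖ + ‖e‖ + ‖f‖ + 1) (fun z hz => ?_) 0
  · simpa using main
  · have := differentiable_two_cpow (u := fun z : ℂ => 1 - 2 * (c + z)) (by fun_prop)
    fun_prop
  have hef' : e + z + (f + z) = 1 + 2 * (c + z) := by linear_combination hef
  have ra := abs_le.1 (Complex.abs_re_le_norm a)
  have rc := abs_le.1 (Complex.abs_re_le_norm c)
  have re := abs_le.1 (Complex.abs_re_le_norm e)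
  have rf := abs_le.1 (Complex.abs_re_le_norm f)
  have := norm_nonneg a
  have := norm_nonneg c
  have := norm_nonneg e
  have := norm_nonneg f
  have hc : 0 < (c + z).re := by simp; linarith
  have he : ‖a‖ < (e + z).re := by simp; linarith
  have hf : ‖a‖ < (f + z).re := by simp; linarith
  clear hef hz re rc rf
  generalize c + z = c at *
  generalize e + z = e at *
  generalize f + z = f at *
  have hhalf : ∀ x : ℂ, (x / 2).re = x.re / 2 := fun x => by
    rw [show (2 : ℂ) = ((2 : ℝ) : ℂ) by norm_num, Complex.div_ofReal_re]
  have pos : ∀ x : ℂ, ‖a‖ < x.re → 0 < (x / 2).re ∧ 0 < (x / 2 + 1 / 2).re ∧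
      0 < ((a + x) / 2).re ∧ 0 < ((1 - a + x) / 2).re := by
    intro x hx
    simp only [Complex.add_re, hhalf, Complex.sub_re, Complex.one_re]
    refine ⟨?_, ?_, ?_, ?_⟩ <;> linarith
  obtain ⟨e1, e2, e3, e4⟩ := pos e he
  obtain ⟨f1, f2, f3, f4⟩ := pos f hf
  have pe : 0 < e.re := by linarith
  have pf : 0 < f.re := by linarith
  have ne := nonPole_of_re_pos pe
  have nf := nonPole_of_re_pos pf
  have np : ∀ {x : ℂ}, 0 < x.re → ∀ n : ℕ, x + n ≠ 0 := fun hx n =>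
    ((nonPole_of_re_pos hx).add_natCast n).ne_zero
  -- by duplication, the normalizing factors `Γ(e + 2 n)` and `Γ(f + 2 n)` are, up to powers of `2`,
  -- `Γ(e / 2 + n) Γ(e / 2 + 1 / 2 + n)` and `Γ(f / 2 + n) Γ(f / 2 + 1 / 2 + n)`
  have key := eq_of_recurrence_of_tendsto
    (H := fun n => Gamma (e + (2 * n : ℕ)) * Gamma (f + (2 * n : ℕ)) *
      regSum a (1 - a) (c + (2 * n : ℕ)) (e + (2 * n : ℕ)) (f + (2 * n : ℕ)))
    (G := fun n => (Gamma (e / 2 + n) * Gamma (e / 2 + 1 / 2 + n) * rGamma ((a + e) / 2 + n) *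
      rGamma ((1 - a + e) / 2 + n)) * (Gamma (f / 2 + n) * Gamma (f / 2 + 1 / 2 + n) *
      rGamma ((a + f) / 2 + n) * rGamma ((1 - a + f) / 2 + n)))
    (ρ := fun n => (((a + e) / 2 + n) * ((1 - a + e) / 2 + n)) *
      (((a + f) / 2 + n) * ((1 - a + f) / 2 + n)) / (((e / 2 + n) * (e / 2 + 1 / 2 + n)) *
      ((f / 2 + n) * (f / 2 + 1 / 2 + n))))
    (fun n => ?_) (fun n => ?_) ?_ ?_
  · have ex : e + f - a - (1 - a) - c = c := by linear_combination hef'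
    simp only [Nat.cast_zero, mul_zero, add_zero, Complex.Gamma_mul_Gamma_add_half] at key
    rw [Phi_eq_regSum (by rwa [ex]), ex]
    have g1 := Gamma_mul_rGamma ne
    have g2 := Gamma_mul_rGamma nf
    have pw : (2 : ℂ) ^ (1 - 2 * c) = 2 ^ (1 - 2 * (e / 2)) * 2 ^ (1 - 2 * (f / 2)) := by
      rw [← two_cpow_add]; congr 1; linear_combination hef'
    rw [show 2 * (e / 2) = e by ring, show 2 * (f / 2) = f by ring] at key pw
    rw [pw, ← sqrt_pi_mul_self, whippleProd]
    generalize rGamma ((a + e) / 2) = u1 at *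
    generalize rGamma ((1 - a + e) / 2) = u2 at *
    generalize rGamma ((a + f) / 2) = u3 at *
    generalize rGamma ((1 - a + f) / 2) = u4 at *
    have : Gamma e * Gamma f ≠ 0 := mul_ne_zero ne.Gamma_ne_zero nf.Gamma_ne_zero
    refine mul_left_cancel₀ this ?_
    linear_combination rGamma c * key
  · have hn : (0 : ℝ) ≤ n := Nat.cast_nonneg n
    have hrec := regSum_whipple_recursion (a := a) (c := c + (2 * n : ℕ)) (e := e + (2 * n : ℕ))
      (f := f + (2 * n : ℕ)) (by push_cast; linear_combination hef') (by
        rw [Complex.add_re, Complex.natCast_re]; positivity)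
    have s2 : ∀ x : ℂ, x + (2 * (n + 1) : ℕ) = x + (2 * n : ℕ) + 2 := fun x => by push_cast; ring
    have G2 : ∀ {x : ℂ}, 0 < x.re → Gamma (x + (2 * n : ℕ) + 2) =
        (x + (2 * n : ℕ) + 1) * ((x + (2 * n : ℕ)) * Gamma (x + (2 * n : ℕ))) := by
      intro x hx
      have h1 := np hx (2 * n)
      have h2 : x + (2 * n : ℕ) + 1 ≠ 0 := by
        have := np hx (2 * n + 1)
        rw [Nat.cast_add, ← add_assoc] at this
        simpa using this
      rw [show x + (2 * n : ℕ) + 2 = x + (2 * n : ℕ) + 1 + 1 by ring, Complex.Gamma_add_one _ h2,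
        Complex.Gamma_add_one _ h1]
    have q1 := np e1 n
    have q2 := np e2 n
    have q3 := np f1 n
    have q4 := np f2 n
    simp only [s2]
    rw [G2 pe, G2 pf, hrec]
    generalize Gamma (e + (2 * n : ℕ)) = x1
    generalize Gamma (f + (2 * n : ℕ)) = x2
    generalize regSum _ _ _ _ _ = x3
    rw [div_mul_eq_mul_div, eq_div_iff (by positivity)]
    push_cast
    ring
  · have q1 := np e1 n
    have q2 := np e2 n
    have q3 := np f1 n
    have q4 := np f2 n
    rw [rGamma_eq ((a + e) / 2 + n), rGamma_eq ((1 - a + e) / 2 + n), rGamma_eq ((a + f) / 2 + n),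
      rGamma_eq ((1 - a + f) / 2 + n)]
    simp only [Nat.cast_add, Nat.cast_one, ← add_assoc]
    rw [Complex.Gamma_add_one _ q1, Complex.Gamma_add_one _ q2, Complex.Gamma_add_one _ q3,
      Complex.Gamma_add_one _ q4]
    rw [div_mul_eq_mul_div, eq_div_iff (by positivity)]
    ring
  · have htwo : Tendsto (fun n : ℕ => 2 * n) atTop atTop :=
      tendsto_id.const_mul_atTop' (by norm_num)
    refine ((tendsto_tsum_hypTerm_add_natCast a (1 - a) c e f).comp htwo).congr fun n => ?_
    have hn : (0 : ℝ) ≤ n := Nat.cast_nonneg n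
    refine (hasSum_hypTerm (ne.add_natCast (2 * n)) (nf.add_natCast (2 * n)) ?_).tsum_eq
    rw [show e + (2 * n : ℕ) + (f + (2 * n : ℕ)) - a - (1 - a) - (c + (2 * n : ℕ)) = c + (2 * n : ℕ)
      by push_cast; linear_combination hef', Complex.add_re, Complex.natCast_re]
    positivity
  · have t1 := tendsto_Gamma_ratio e1 e2 e3 e4 (by ring)
    have t2 := tendsto_Gamma_ratio f1 f2 f3 f4 (by ring)
    simpa using t1.mul t2

/-! ### Contiguous forms of the theorems of Whipple, Watson and Dixon -/

/-- Whipple's theorem with the sum of the bottom parameters raised by one. The contiguous relation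
in the bottom parameters comes with the excess `b` as a factor, which is cancelled by continuity. -/
lemma Phi_whipple_den_succ {a b e f : ℂ} (hef : e + f = 2 + 2 * b) :
    (e - f) * Phi a (1 - a) b e f = Real.pi * 2 ^ (1 - 2 * b) * rGamma (b + 1) *
      (whippleProd a (e - 1) f - whippleProd a e (f - 1)) := by
  have hf : f = 2 + 2 * b - e := by linear_combination hef
  rw [hf]
  have hpow := differentiable_two_cpow (u := fun b : ℂ => 1 - 2 * b) (by fun_prop)
  refine eq_of_eq_of_ne
    (f := fun b => (e - (2 + 2 * b - e)) * Phi a (1 - a) b e (2 + 2 * b - e))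
    (g := fun b => Real.pi * 2 ^ (1 - 2 * b) * rGamma (b + 1) *
      (whippleProd a (e - 1) (2 + 2 * b - e) - whippleProd a e (2 + 2 * b - e - 1)))
    (Differentiable.continuous (𝕜 := ℂ) (by fun_prop))
    (Differentiable.continuous (𝕜 := ℂ) (by fun_prop)) 0 (fun b hb => ?_) b
  have key := Phi_contiguous_den a (1 - a) b e (2 + 2 * b - e)
  rw [Phi_whipple (by ring), Phi_whipple (by ring), rGamma_eq b,
    show e + (2 + 2 * b - e) - a - (1 - a) - b - 1 = b by ring] at key
  refine mul_left_cancel₀ hb ?_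
  linear_combination -key

/-- Whipple's theorem with the sum of the first two top parameters lowered by one. The contiguous
relation in the top parameters comes with the factors `b` and `a`, which are cancelled by
continuity. -/
lemma Phi_whipple_num_pred {a b e f : ℂ} (hef : e + f = 1 + 2 * a) :
    2 * Phi b (-b) a e f = Real.pi * 2 ^ (1 - 2 * a) * rGamma (a + 1) *
      (whippleProd (-b) e f + whippleProd b e f) := by
  have h1 : ∀ a e f : ℂ, e + f = 1 + 2 * a → 2 * a * Phi b (-b) a e f =
      Real.pi * 2 ^ (1 - 2 * a) * rGamma a * (whippleProd (-b) e f + whippleProd b e f) := by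
    intro a e f hef
    refine eq_of_eq_of_ne (f := fun b => 2 * a * Phi b (-b) a e f)
      (g := fun b => Real.pi * 2 ^ (1 - 2 * a) * rGamma a *
        (whippleProd (-b) e f + whippleProd b e f))
      (Differentiable.continuous (𝕜 := ℂ) (by fun_prop))
      (Differentiable.continuous (𝕜 := ℂ) (by fun_prop)) 0 (fun b hb => ?_) b
    have key := Phi_contiguous_num b (-b) a e f
    rw [Phi_swap_ab (b + 1), show b + 1 = 1 - -b by ring, show -b + 1 = 1 - b by ring,
      Phi_whipple hef, Phi_whipple hef,
      show e + f - b - -b - a - 1 = a by linear_combination hef] at key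
    refine mul_left_cancel₀ hb ?_
    linear_combination -key
  have hf : f = 1 + 2 * a - e := by linear_combination hef
  rw [hf]
  have hpow := differentiable_two_cpow (u := fun a : ℂ => 1 - 2 * a) (by fun_prop)
  refine eq_of_eq_of_ne (f := fun a => 2 * Phi b (-b) a e (1 + 2 * a - e))
    (g := fun a => Real.pi * 2 ^ (1 - 2 * a) * rGamma (a + 1) *
      (whippleProd (-b) e (1 + 2 * a - e) + whippleProd b e (1 + 2 * a - e)))
    (Differentiable.continuous (𝕜 := ℂ) (by fun_prop))
    (Differentiable.continuous (𝕜 := ℂ) (by fun_prop)) 0 (fun a ha => ?_) a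
  have key := h1 a e (1 + 2 * a - e) (by ring)
  rw [rGamma_eq a] at key
  refine mul_left_cancel₀ ha ?_
  linear_combination key

/-- Watson's theorem, in regularized form: Kummer's transformation of Whipple's. -/
lemma Phi_watson (a b c : ℂ) : Phi a b c (2 * c) ((a + b + 1) / 2) =
    Real.pi * 2 ^ (1 - 2 * c) * rGamma c * (rGamma (c + 1 / 2 - a / 2) *
      rGamma (c + 1 / 2 - b / 2) * (rGamma ((a + 1) / 2) * rGamma ((b + 1) / 2))) := by
  rw [Phi_kummer, show (a + b + 1) / 2 - b = 1 - ((a + b + 1) / 2 - a) by ring,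
    Phi_whipple (by ring), whippleProd]
  rw [show ((a + b + 1) / 2 - a + (2 * c + (a + b + 1) / 2 - a - b)) / 2 = c + 1 / 2 - a / 2 by
      ring,
    show (1 - ((a + b + 1) / 2 - a) + (2 * c + (a + b + 1) / 2 - a - b)) / 2 = c + 1 / 2 - b / 2
      by ring,
    show ((a + b + 1) / 2 - a + (a + b + 1) / 2) / 2 = (b + 1) / 2 by ring,
    show (1 - ((a + b + 1) / 2 - a) + (a + b + 1) / 2) / 2 = (a + 1) / 2 by ring]
  ring

lemma mul_rGamma_half_add_one (a : ℂ) : a * rGamma (a / 2 + 1) = 2 * rGamma (a / 2) := by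
  rw [rGamma_eq (a / 2)]; ring

/-- Watson's theorem with the second bottom parameter raised by `1 / 2`. -/
lemma Phi_watson_succ (a b c : ℂ) :
    (a - b) * (c - a / 2 - b / 2) * Phi a b c (2 * c) (1 + b / 2 + a / 2) =
      2 * Real.pi * 2 ^ (1 - 2 * c) * rGamma c *
        (rGamma (c - a / 2) * rGamma (1 / 2 - b / 2 + c) * rGamma (b / 2 + 1 / 2) * rGamma (a / 2) -
          rGamma (c - b / 2) * rGamma (1 / 2 - a / 2 + c) * rGamma (a / 2 + 1 / 2) *
            rGamma (b / 2)) := by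
  have key := Phi_contiguous_num a b c (2 * c) (1 + b / 2 + a / 2)
  have h1 := Phi_watson (a + 1) b c
  have h2 := Phi_watson a (b + 1) c
  rw [show (a + 1 + b + 1) / 2 = 1 + b / 2 + a / 2 by ring,
    show c + 1 / 2 - (a + 1) / 2 = c - a / 2 by ring, show (a + 1 + 1) / 2 = a / 2 + 1 by ring,
    show c + 1 / 2 - b / 2 = 1 / 2 - b / 2 + c by ring,
    show (b + 1) / 2 = b / 2 + 1 / 2 by ring] at h1
  rw [show (a + (b + 1) + 1) / 2 = 1 + b / 2 + a / 2 by ring,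
    show c + 1 / 2 - (b + 1) / 2 = c - b / 2 by ring, show (b + 1 + 1) / 2 = b / 2 + 1 by ring,
    show c + 1 / 2 - a / 2 = 1 / 2 - a / 2 + c by ring,
    show (a + 1) / 2 = a / 2 + 1 / 2 by ring] at h2
  rw [h1, h2, show 2 * c + (1 + b / 2 + a / 2) - a - b - c - 1 = c - a / 2 - b / 2 by ring] at key
  have ga := mul_rGamma_half_add_one a
  have gb := mul_rGamma_half_add_one b
  linear_combination -key + Real.pi * 2 ^ (1 - 2 * c) * rGamma c *
    (rGamma (c - a / 2) * rGamma (1 / 2 - b / 2 + c) * rGamma (b / 2 + 1 / 2) * ga -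
      rGamma (c - b / 2) * rGamma (1 / 2 - a / 2 + c) * rGamma (a / 2 + 1 / 2) * gb)

/-- Watson's theorem with `2 c` raised and the other bottom parameter lowered. -/
lemma Phi_watson_pred_succ (a b c : ℂ) : 2 * Phi a b c (1 + 2 * b) (c / 2 + a / 2) =
    Real.pi * 2 ^ (1 - 2 * b) * rGamma (b + 1) *
      (rGamma (c / 2) * rGamma (a / 2 + 1 / 2) *
          (rGamma (-a / 2 + b + 1 / 2) * rGamma (1 + b - c / 2)) +
        rGamma (a / 2) * rGamma (c / 2 + 1 / 2) *
          (rGamma (1 / 2 + b - c / 2) * rGamma (-a / 2 + 1 + b))) := by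
  have key := Phi_whipple_num_pred (a := b) (b := (c - a) / 2) (e := c / 2 + a / 2)
    (f := 1 + 2 * b - (c / 2 + a / 2)) (by ring)
  rw [Phi_swap_bc, Phi_kummer, show c / 2 + a / 2 - a = (c - a) / 2 by ring,
    show c / 2 + a / 2 - c = -((c - a) / 2) by ring,
    show 1 + 2 * b + (c / 2 + a / 2) - a - c = 1 + 2 * b - (c / 2 + a / 2) by ring, Phi_swap_ef,
      key]
  rw [whippleProd, whippleProd]
  rw [show (-((c - a) / 2) + (c / 2 + a / 2)) / 2 = a / 2 by ring,
    show (1 - -((c - a) / 2) + (c / 2 + a / 2)) / 2 = c / 2 + 1 / 2 by ring,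
    show (-((c - a) / 2) + (1 + 2 * b - (c / 2 + a / 2))) / 2 = 1 / 2 + b - c / 2 by ring,
    show (1 - -((c - a) / 2) + (1 + 2 * b - (c / 2 + a / 2))) / 2 = -a / 2 + 1 + b by ring,
    show ((c - a) / 2 + (c / 2 + a / 2)) / 2 = c / 2 by ring,
    show (1 - (c - a) / 2 + (c / 2 + a / 2)) / 2 = a / 2 + 1 / 2 by ring,
    show ((c - a) / 2 + (1 + 2 * b - (c / 2 + a / 2))) / 2 = -a / 2 + b + 1 / 2 by ring,
    show (1 - (c - a) / 2 + (1 + 2 * b - (c / 2 + a / 2))) / 2 = 1 + b - c / 2 by ring]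
  ring

/-- Watson's theorem with `2 c` lowered by one. -/
lemma Phi_watson_den_pred (a b c : ℂ) : 2 * Phi a b c (2 * c - 1) (a / 2 + b / 2 + 1 / 2) =
    Real.pi * 2 ^ (3 - 2 * c) * rGamma c *
      (rGamma (b / 2 + 1 / 2) * rGamma (c - 1 / 2 - a / 2) *
          (rGamma (c - 1 / 2 - b / 2) * rGamma (a / 2 + 1 / 2)) +
        rGamma (a / 2) * rGamma (b / 2) * (rGamma (c - a / 2) * rGamma (c - b / 2))) := by
  have key := Phi_watson_pred_succ a (c - 1) (2 * c - 1 - b)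
  rw [Phi_swap_ab, Phi_swap_bc, Phi_swap_ef, Phi_kummer b c a,
    show a / 2 + b / 2 + 1 / 2 + (2 * c - 1) - b - c = (2 * c - 1 - b) / 2 + a / 2 by ring,
    Phi_swap_ac, show 2 * c - 1 - c = c - 1 by ring, Phi_swap_ef]
  rw [show 1 + 2 * (c - 1) = 2 * c - 1 by ring] at key
  rw [key, show 1 - 2 * (c - 1) = 3 - 2 * c by ring, show c - 1 + 1 = c by ring,
    show (2 * c - 1 - b) / 2 = c - 1 / 2 - b / 2 by ring,
    show -a / 2 + (c - 1) + 1 / 2 = c - 1 / 2 - a / 2 by ring,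
    show 1 + (c - 1) - (c - 1 / 2 - b / 2) = b / 2 + 1 / 2 by ring,
    show c - 1 / 2 - b / 2 + 1 / 2 = c - b / 2 by ring,
    show 1 / 2 + (c - 1) - (c - 1 / 2 - b / 2) = b / 2 by ring,
    show -a / 2 + 1 + (c - 1) = c - a / 2 by ring]
  ring

/-- Whipple's theorem with the sum of the bottom parameters lowered by one. -/
lemma Phi_whipple_den_pred (a b c : ℂ) : 2 * Phi a b (-b + 1) c (2 * a - c) =
    Real.pi * 2 ^ (3 - 2 * a) * rGamma a *
      (rGamma (a + b / 2 - c / 2) * rGamma (b / 2 + c / 2 - 1 / 2) *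
          (rGamma (-b / 2 + c / 2) * rGamma (-b / 2 + a - c / 2 + 1 / 2)) +
        rGamma (a - b / 2 - c / 2) * rGamma (a + b / 2 - c / 2 - 1 / 2) *
          (rGamma (b / 2 + c / 2) * rGamma (-b / 2 + c / 2 + 1 / 2))) := by
  have key := Phi_watson_den_pred (2 * a - c - b) (2 * a - c - (-b + 1)) a
  rw [Phi_swap_ab, Phi_swap_bc, Phi_kummer,
    show c + (2 * a - c) - b - (-b + 1) = 2 * a - 1 by ring]
  rw [show (2 * a - c - b) / 2 + (2 * a - c - (-b + 1)) / 2 + 1 / 2 = 2 * a - c by ring] at key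
  rw [key, show (2 * a - c - (-b + 1)) / 2 + 1 / 2 = a + b / 2 - c / 2 by ring,
    show a - 1 / 2 - (2 * a - c - b) / 2 = b / 2 + c / 2 - 1 / 2 by ring,
    show a - 1 / 2 - (2 * a - c - (-b + 1)) / 2 = -b / 2 + c / 2 by ring,
    show (2 * a - c - b) / 2 + 1 / 2 = -b / 2 + a - c / 2 + 1 / 2 by ring,
    show (2 * a - c - b) / 2 = a - b / 2 - c / 2 by ring,
    show (2 * a - c - (-b + 1)) / 2 = a + b / 2 - c / 2 - 1 / 2 by ring,
    show a - (a - b / 2 - c / 2) = b / 2 + c / 2 by ring,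
    show a - (a + b / 2 - c / 2 - 1 / 2) = -b / 2 + c / 2 + 1 / 2 by ring]

/-- Whipple's theorem with the sums of the first two top and of the bottom parameters both raised
by one. -/
lemma Phi_whipple_succ (a b c : ℂ) :
    (-b + 1) * (-c + a + 1) * Phi a b (-b + 2) c (2 * a + 2 - c) =
      Real.pi * 2 ^ (1 - 2 * a) * rGamma a *
        (rGamma (a + b / 2 - c / 2) * rGamma (-b / 2 + c / 2) *
          (rGamma (b / 2 + c / 2 - 1 / 2) * rGamma (3 / 2 + a - b / 2 - c / 2)) -
        rGamma (b / 2 - 1 + c / 2) * rGamma (a - c / 2 + 1 - b / 2) *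
          (rGamma (-b / 2 + c / 2 + 1 / 2) * rGamma (a - c / 2 + 1 / 2 + b / 2))) := by
  have key := Phi_watson_succ (2 * a + 2 - c - b) (2 * a + 2 - c - (-b + 2)) a
  rw [Phi_swap_ab, Phi_swap_bc, Phi_kummer,
    show c + (2 * a + 2 - c) - b - (-b + 2) = 2 * a by ring]
  rw [show 1 + (2 * a + 2 - c - (-b + 2)) / 2 + (2 * a + 2 - c - b) / 2 = 2 * a + 2 - c by ring,
    show a - (2 * a + 2 - c - b) / 2 = b / 2 - 1 + c / 2 by ring,
    show a - (2 * a + 2 - c - (-b + 2)) / 2 = -b / 2 + c / 2 by ring,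
    show 1 / 2 - (2 * a + 2 - c - (-b + 2)) / 2 + a = -b / 2 + c / 2 + 1 / 2 by ring,
    show 1 / 2 - (2 * a + 2 - c - b) / 2 + a = b / 2 + c / 2 - 1 / 2 by ring,
    show (2 * a + 2 - c - (-b + 2)) / 2 + 1 / 2 = a - c / 2 + 1 / 2 + b / 2 by ring,
    show (2 * a + 2 - c - (-b + 2)) / 2 = a + b / 2 - c / 2 by ring,
    show (2 * a + 2 - c - b) / 2 + 1 / 2 = 3 / 2 + a - b / 2 - c / 2 by ring,
    show (2 * a + 2 - c - b) / 2 = a - c / 2 + 1 - b / 2 by ring] at key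
  linear_combination (-1 / 2) * key

/-- Watson's theorem with `2 c` lowered and the other bottom parameter raised. -/
lemma Phi_watson_succ_pred (a b c : ℂ) :
    (c - b) * Phi a b c (1 + c / 2 + b / 2) (2 * a - 1) =
      Real.pi * 2 ^ (3 - 2 * a) * rGamma a *
        (rGamma (-b / 2 + a - 1 / 2) * rGamma (c / 2) *
          (rGamma (-c / 2 + a) * rGamma (b / 2 + 1 / 2)) -
        rGamma (a - b / 2) * rGamma (c / 2 + 1 / 2) *
          (rGamma (-c / 2 + a - 1 / 2) * rGamma (b / 2))) := by
  have key := Phi_whipple_den_succ (a := a - (b + c) / 2) (b := a - 1) (e := a + (c - b) / 2)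
    (f := a - (c - b) / 2) (by ring)
  rw [Phi_kummer a b c, show 1 + c / 2 + b / 2 + (2 * a - 1) - a - b = a + (c - b) / 2 by ring,
    show 2 * a - 1 - a = a - 1 by ring, Phi_swap_ac, Phi_swap_ef,
    Phi_kummer c (2 * a - 1 - b) (a - 1),
    show a + (c - b) / 2 - c = a - (b + c) / 2 by ring,
    show a + (c - b) / 2 - (2 * a - 1 - b) = 1 - (a - (b + c) / 2) by ring,
    show 2 * a - 1 + (a + (c - b) / 2) - c - (2 * a - 1 - b) = a - (c - b) / 2 by ring, Phi_swap_ef]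
  rw [whippleProd, whippleProd] at key
  rw [show a + (c - b) / 2 - (a - (c - b) / 2) = c - b by ring,
    show 1 - 2 * (a - 1) = 3 - 2 * a by ring, sub_add_cancel,
    show (a - (b + c) / 2 + (a + (c - b) / 2 - 1)) / 2 = -b / 2 + a - 1 / 2 by ring,
    show (1 - (a - (b + c) / 2) + (a + (c - b) / 2 - 1)) / 2 = c / 2 by ring,
    show (a - (b + c) / 2 + (a - (c - b) / 2)) / 2 = -c / 2 + a by ring,
    show (1 - (a - (b + c) / 2) + (a - (c - b) / 2)) / 2 = b / 2 + 1 / 2 by ring,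
    show (a - (b + c) / 2 + (a + (c - b) / 2)) / 2 = a - b / 2 by ring,
    show (1 - (a - (b + c) / 2) + (a + (c - b) / 2)) / 2 = c / 2 + 1 / 2 by ring,
    show (a - (b + c) / 2 + (a - (c - b) / 2 - 1)) / 2 = -c / 2 + a - 1 / 2 by ring,
    show (1 - (a - (b + c) / 2) + (a - (c - b) / 2 - 1)) / 2 = b / 2 by ring] at key
  exact key

/-- Dixon's theorem with the first bottom parameter raised by one. -/
lemma Phi_dixon_succ (a b c : ℂ) :
    (2 * (a - 1)) * Phi a b c (b + 2 - a) (1 + b - c) =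
      Real.pi * 2 ^ (2 * a + 2 * c - 2 * b - 1) * rGamma (-c - a + b + 2) *
        (rGamma (b / 2) * rGamma (1 / 2 + b / 2 - c) *
          (rGamma (b / 2 + 3 / 2 - a) * rGamma (b / 2 - c - a + 2)) -
        rGamma (b / 2 + 1 / 2) * rGamma (b / 2 - c + 1) *
          (rGamma (-a + 1 + b / 2) * rGamma (b / 2 - c - a + 3 / 2))) := by
  have key := Phi_whipple_den_succ (a := c) (b := 1 + b - c - a) (e := 1 + b - c)
    (f := 3 + b - 2 * a - c) (by ring)
  rw [Phi_kummer a b c, show b + 2 - a + (1 + b - c) - a - b = 3 + b - 2 * a - c by ring,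
    show 1 + b - c - b = 1 - c by ring, Phi_swap_ac, Phi_swap_ab, Phi_swap_ef, Phi_swap_ab]
  rw [whippleProd, whippleProd] at key
  rw [show 1 + b - c - (3 + b - 2 * a - c) = 2 * (a - 1) by ring,
    show 1 - 2 * (1 + b - c - a) = 2 * a + 2 * c - 2 * b - 1 by ring,
    show 1 + b - c - a + 1 = -c - a + b + 2 by ring,
    show (c + (1 + b - c - 1)) / 2 = b / 2 by ring,
    show (1 - c + (1 + b - c - 1)) / 2 = 1 / 2 + b / 2 - c by ring,
    show (c + (3 + b - 2 * a - c)) / 2 = b / 2 + 3 / 2 - a by ring,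
    show (1 - c + (3 + b - 2 * a - c)) / 2 = b / 2 - c - a + 2 by ring,
    show (c + (1 + b - c)) / 2 = b / 2 + 1 / 2 by ring,
    show (1 - c + (1 + b - c)) / 2 = b / 2 - c + 1 by ring,
    show (c + (3 + b - 2 * a - c - 1)) / 2 = -a + 1 + b / 2 by ring,
    show (1 - c + (3 + b - 2 * a - c - 1)) / 2 = b / 2 - c - a + 3 / 2 by ring] at key
  exact key

/-! ### Top parameter two, and telescoping series of excess two -/

lemma hasSum_gauss {a b c : ℂ} (h : 0 < (c - a - b).re) :
    HasSum (fun k : ℕ => poch a k * poch b k * rGamma (c + k) / k.factorial)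
      (Gamma (c - a - b) * rGamma (c - a) * rGamma (c - b)) := by
  rw [← tsum_gauss h]
  have hs : c + 1 - a - b - 1 = c - a - b := by ring
  have := summable_regTerm (a := a) (b := b) (c := 1) (e := c) (f := 1) (by rwa [hs])
  rw [funext (regTerm_one_one a b c)] at this
  exact this.hasSum

lemma poch_two (k : ℕ) : poch 2 k = (k + 1).factorial := by
  induction k with
  | zero => simp [poch_zero]
  | succ k ih =>
    rw [poch_succ, ih, Nat.factorial_succ (k + 1)]
    push_cast
    ring

/-- The sum of the Gauss series weighted by `k`. -/
lemma hasSum_mul_gauss {a b c : ℂ} (h : 1 < (c - a - b).re) :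
    HasSum (fun k : ℕ => (k : ℂ) * (poch a k * poch b k * rGamma (c + k) / k.factorial))
      (a * b * Gamma (c - a - b - 1) * rGamma (c - a) * rGamma (c - b)) := by
  have h1 := (hasSum_gauss (a := a + 1) (b := b + 1) (c := c + 1)
    (by simp at h ⊢; linarith)).mul_left (a * b)
  rw [← hasSum_nat_add_iff' 1]
  simp only [Finset.range_one, Finset.sum_singleton, Nat.cast_zero, zero_mul, sub_zero]
  rw [show c + 1 - (a + 1) - (b + 1) = c - a - b - 1 by ring,
    show c + 1 - (a + 1) = c - a by ring, show c + 1 - (b + 1) = c - b by ring] at h1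
  rw [show a * b * Gamma (c - a - b - 1) * rGamma (c - a) * rGamma (c - b) =
    a * b * (Gamma (c - a - b - 1) * rGamma (c - a) * rGamma (c - b)) by ring]
  refine (congrArg (HasSum · _) (funext fun k => ?_)).mpr h1
  have hk : (k : ℂ) + 1 ≠ 0 := Nat.cast_add_one_ne_zero k
  have hf : (k.factorial : ℂ) ≠ 0 := by exact_mod_cast k.factorial_ne_zero
  rw [poch_succ_left, poch_succ_left, Nat.factorial_succ,
    show c + ((k + 1 : ℕ) : ℂ) = c + 1 + k by push_cast; ring]
  push_cast
  field_simp

/-- With top parameter `2` and bottom parameter `4` the series is, after a shift by three of the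
summation index, a combination of two Gauss series with their first terms removed. -/
lemma Phi_two_four (a b c : ℂ) :
    (a - 1) * (a - 2) * (a - 3) * ((b - 1) * (b - 2) * (b - 3)) * Phi a 2 b c 4 =
      rGamma (c - a) * rGamma (c - b) * ((a - 3) * (b - 3) - 2 * (c + 2 - a - b)) +
        rGamma (c + 2 - a - b) * (2 * rGamma (c - 3) + (a - 3) * (b - 3) * rGamma (c - 2)) := by
  refine eq_of_eq_on_halfPlane
    (f := fun c => (a - 1) * (a - 2) * (a - 3) * ((b - 1) * (b - 2) * (b - 3)) * Phi a 2 b c 4)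
    (g := fun c => rGamma (c - a) * rGamma (c - b) * ((a - 3) * (b - 3) - 2 * (c + 2 - a - b)) +
      rGamma (c + 2 - a - b) * (2 * rGamma (c - 3) + (a - 3) * (b - 3) * rGamma (c - 2)))
    (by fun_prop) (by fun_prop) ((a + b - 2).re) (fun c hc => ?_) c
  have hpos : 0 < (c + 2 - a - b).re := by simp at hc ⊢; linarith
  have h1 : c - 3 - (a - 3) - (b - 3) = c + 2 - a - b + 1 := by ring
  have G0 := hasSum_gauss (a := a - 3) (b := b - 3) (c := c - 3)
    (by rw [h1]; simp at hpos ⊢; linarith)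
  have G1 := hasSum_mul_gauss (a := a - 3) (b := b - 3) (c := c - 3)
    (by rw [h1]; simp at hpos ⊢; linarith)
  have hG := G1.sub (G0.mul_left 2)
  rw [← hasSum_nat_add_iff' 3] at hG
  have hex : c + 4 - a - 2 - b = c + 2 - a - b := by ring
  have hF := (hasSum_regTerm (a := a) (b := 2) (c := b) (e := c) (f := 4)
    (by rwa [hex])).mul_left ((a - 1) * (a - 2) * (a - 3) * ((b - 1) * (b - 2) * (b - 3)))
  have hshift : ∀ (z : ℂ) (k : ℕ), poch (z - 3) (k + 3) = (z - 1) * (z - 2) * (z - 3) *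
      poch z k := by
    intro z k
    rw [poch_succ_left, poch_succ_left, poch_succ_left, show z - 3 + 1 + 1 + 1 = z by ring]
    ring
  have hr : ∀ k : ℕ, rGamma (4 + k) = ((k + 3).factorial : ℂ)⁻¹ := by
    intro k
    rw [rGamma, ← Complex.Gamma_nat_eq_factorial]
    push_cast
    ring_nf
  have hcongr : ∀ k : ℕ, (a - 1) * (a - 2) * (a - 3) * ((b - 1) * (b - 2) * (b - 3)) *
      regTerm a 2 b c 4 k = ((k + 3 : ℕ) : ℂ) * (poch (a - 3) (k + 3) * poch (b - 3) (k + 3) *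
        rGamma (c - 3 + (k + 3 : ℕ)) / (k + 3).factorial) -
      2 * (poch (a - 3) (k + 3) * poch (b - 3) (k + 3) *
        rGamma (c - 3 + (k + 3 : ℕ)) / (k + 3).factorial) := by
    intro k
    have hf : (k.factorial : ℂ) ≠ 0 := by exact_mod_cast k.factorial_ne_zero
    rw [regTerm, hshift, hshift, hr, poch_two, Nat.factorial_succ k,
      show c - 3 + ((k + 3 : ℕ) : ℂ) = c + k by push_cast; ring]
    push_cast
    field_simp
    ring
  simp only [hcongr] at hF
  have key := hF.unique hG
  simp only [Finset.sum_range_succ, Finset.sum_range_zero, poch_succ, poch_zero] at key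
  rw [h1, add_sub_cancel_right, show c - 3 - (a - 3) = c - a by ring,
    show c - 3 - (b - 3) = c - b by ring,
    Complex.Gamma_add_one _ (nonPole_of_re_pos hpos).ne_zero] at key
  show _ * Phi a 2 b c 4 = _
  rw [Phi_eq_regSum (by rwa [hex]), hex]
  have g := Gamma_mul_rGamma (nonPole_of_re_pos hpos)
  norm_num at key
  rw [show c - 3 + 1 = c - 2 by ring] at key
  linear_combination rGamma (c + 2 - a - b) * key +
    rGamma (c - a) * rGamma (c - b) * ((a - 3) * (b - 3) - 2 * (c + 2 - a - b)) * g

/-- The reflection formula for `1 / Γ`. -/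
lemma rGamma_mul_rGamma_one_sub (z : ℂ) :
    rGamma z * rGamma (1 - z) = sin (Real.pi * z) / Real.pi := by
  rw [rGamma, rGamma, ← mul_inv, Complex.Gamma_mul_Gamma_one_sub, inv_div]

/-- The reflection formula in the form in which it stays meaningful at the poles of `Γ(1 + b)`. -/
lemma sin_pi_mul_mul_Gamma_neg {b : ℂ} (hb : NonPole (-b)) :
    sin (Real.pi * b) * Gamma (-b) = -Real.pi * rGamma (1 + b) := by
  have h := rGamma_mul_rGamma_one_sub (-b)
  rw [mul_neg, Complex.sin_neg, sub_neg_eq_add, eq_div_iff (by exact_mod_cast Real.pi_ne_zero)] at h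
  linear_combination Gamma (-b) * h - Real.pi * rGamma (1 + b) * Gamma_mul_rGamma hb

lemma sin_add_natCast_mul_pi (z : ℂ) (n : ℕ) : sin (z + n * Real.pi) = (-1) ^ n * sin z :=
  Complex.sin_antiperiodic.add_nat_mul_eq n

/-- Gauss's product for `1 / Γ`, at the poles of `Γ` as well. -/
lemma tendsto_poch_div (z : ℂ) :
    Tendsto (fun n : ℕ => poch z (n + 1) / ((n : ℂ) ^ z * n.factorial)) atTop (𝓝 (rGamma z)) := by
  by_cases hz : NonPole z
  · refine ((Complex.GammaSeq_tendsto_Gamma z).inv₀ hz.Gamma_ne_zero).congr fun n => ?_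
    rw [Complex.GammaSeq, ← poch_eq_prod, inv_div]
  · simp only [NonPole, not_forall, not_not] at hz
    obtain ⟨k, rfl⟩ := hz
    rw [rGamma, Complex.Gamma_neg_nat_eq_zero, inv_zero]
    refine tendsto_const_nhds.congr' ?_
    filter_upwards [eventually_ge_atTop k] with n hn
    rw [poch_eq_prod, Finset.prod_eq_zero (Finset.mem_range.2 (by omega : k < n + 1)) (by simp),
      zero_div]

lemma Gamma_two : Gamma 2 = 1 := by
  rw [show (2 : ℂ) = ((1 : ℕ) : ℂ) + 1 by norm_num, Complex.Gamma_nat_eq_factorial]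
  simp

/-- If the excess is two and `a b + a c + b c = (e - 1) (f - 1)`, then the partial sums of the
series are again hypergeometric terms. -/
lemma sum_regTerm_of_excess_two {a b c e f : ℂ} (hs : e + f - a - b - c = 2)
    (h : a * b + a * c + b * c = (e - 1) * (f - 1)) (n : ℕ) :
    ∑ k ∈ Finset.range (n + 1), regTerm a b c e f k = regTerm (a + 1) (b + 1) (c + 1) e f n := by
  induction n with
  | zero => simp [regTerm, poch_zero]
  | succ n ih =>
    have hn : (n : ℂ) + 1 ≠ 0 := Nat.cast_add_one_ne_zero n
    have hf : (n.factorial : ℂ) ≠ 0 := by exact_mod_cast n.factorial_ne_zero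
    rw [Finset.sum_range_succ, ih]
    simp only [regTerm]
    rw [rGamma_eq (e + n), rGamma_eq (f + n), poch_succ_left, poch_succ_left, poch_succ_left,
      poch_succ, poch_succ, poch_succ, Nat.factorial_succ,
      show e + ((n + 1 : ℕ) : ℂ) = e + n + 1 by push_cast; ring,
      show f + ((n + 1 : ℕ) : ℂ) = f + n + 1 by push_cast; ring]
    have he : e = 2 + a + b + c - f := by linear_combination hs
    have key : (e + n) * (f + n) * (n + 1) + a * b * c = (a + 1 + n) * (b + 1 + n) *
      (c + 1 + n) := by
      linear_combination ((n : ℂ) + 1) * ((n : ℂ) + 1) * hs - ((n : ℂ) + 1) * h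
    push_cast
    field_simp
    linear_combination poch (a + 1) n * poch (b + 1) n * poch (c + 1) n * rGamma (e + n + 1) *
      rGamma (f + n + 1) * key

/-- The limit of the partial sums, which are the terms of the series for `a + 1`, `b + 1`, `c + 1`,
of excess `-1`, and so converge to a finite value. -/
lemma Phi_excess_two {a b c e f : ℂ} (he : NonPole e) (hf : NonPole f)
    (hs : e + f - a - b - c = 2) (h : a * b + a * c + b * c = (e - 1) * (f - 1)) :
    Phi a b c e f = rGamma (a + 1) * rGamma (b + 1) * rGamma (c + 1) := by
  have hpos : 0 < (e + f - a - b - c).re := by rw [hs]; simp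
  have hr2 : rGamma 2 = 1 := by rw [rGamma, Gamma_two, inv_one]
  rw [Phi_eq_regSum hpos, hs, hr2, mul_one]
  have h1 := (hasSum_regTerm hpos).tendsto_sum_nat.comp (tendsto_add_atTop_nat 2)
  refine tendsto_nhds_unique h1 ?_
  have hone : Tendsto (fun n : ℕ => (n : ℂ) / (n + 1)) atTop (𝓝 1) :=
    tendsto_natCast_div_add_atTop (1 : ℂ)
  have h2 := ((((tendsto_poch_div (a + 1)).mul (tendsto_poch_div (b + 1))).mul
    (tendsto_poch_div (c + 1))).mul ((tendsto_rGamma_add_natCast he).mul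
      (tendsto_rGamma_add_natCast hf))).mul hone
  simp only [mul_one] at h2
  refine h2.congr' ?_
  filter_upwards [eventually_ge_atTop 1] with n hn
  have hn0 : (n : ℂ) ≠ 0 := by exact_mod_cast (by omega : n ≠ 0)
  have hn1 : (n : ℂ) + 1 ≠ 0 := Nat.cast_add_one_ne_zero n
  have hnf : (n.factorial : ℂ) ≠ 0 := by exact_mod_cast n.factorial_ne_zero
  have hp : ∀ z : ℂ, (n : ℂ) ^ z ≠ 0 := fun z => by simp [Complex.cpow_eq_zero_iff, hn0]
  -- the powers of `n` and the factorials cancel since the excess of the right side is `-1`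
  have hpow : (n : ℂ) ^ e * (n : ℂ) ^ f * n = (n : ℂ) ^ (a + 1) * (n : ℂ) ^ (b + 1) *
      (n : ℂ) ^ (c + 1) := by
    rw [← Complex.cpow_add _ _ hn0, ← Complex.cpow_add _ _ hn0, ← Complex.cpow_add _ _ hn0]
    nth_rewrite 2 [← Complex.cpow_one (n : ℂ)]
    rw [← Complex.cpow_add _ _ hn0]
    congr 1
    linear_combination hs
  have hcomp := sum_regTerm_of_excess_two hs h (n + 1)
  simp only [Function.comp]
  rw [hcomp, regTerm, Nat.factorial_succ]
  have pa := hp (a + 1)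
  have pb := hp (b + 1)
  have pc := hp (c + 1)
  push_cast
  field_simp
  linear_combination poch (a + 1) (n + 1) * poch (b + 1) (n + 1) * poch (c + 1) (n + 1) *
    rGamma (e + (n + 1)) * rGamma (f + (n + 1)) * hpow

end

section

variable {F : ℂ → ℂ → ℂ → ℂ → ℂ → ℂ}

/-! ### Evaluations with top parameter two or excess two -/

lemma Gamma_four : Gamma 4 = 6 := by
  rw [show (4 : ℂ) = ((3 : ℕ) : ℂ) + 1 by norm_num, Complex.Gamma_nat_eq_factorial]
  norm_num [Nat.factorial]

lemma Gamma_mul_rGamma_pred {c : ℂ} (hc : NonPole c) :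
    Gamma c * rGamma (c - 2) = (c - 1) * (c - 2) ∧
      Gamma c * rGamma (c - 3) = (c - 1) * (c - 2) * (c - 3) := by
  have g := Gamma_mul_rGamma hc
  have h1 := rGamma_eq (c - 1)
  have h2 := rGamma_eq (c - 2)
  have h3 := rGamma_eq (c - 3)
  rw [sub_add_cancel] at h1
  rw [show c - 2 + 1 = c - 1 by ring, h1] at h2
  rw [show c - 3 + 1 = c - 2 by ring, h2] at h3
  rw [h2, h3]
  exact ⟨by linear_combination (c - 2) * (c - 1) * g,
    by linear_combination (c - 3) * (c - 2) * (c - 1) * g⟩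

lemma IsHyp3F2One.two_four (hF : IsHyp3F2One F) {a b c : ℂ} (h : Regular a 2 b c 4)
    (hD : (a - 3) * (b - 1) * (-2 + a) * (a - 1) * (b - 3) * (b - 2) ≠ 0) :
    F a 2 b c 4 =
        -6 * ((2 * c - 5 + b - a * b + a) * Gamma c * Gamma (-b + 2 + c - a) /
          ((a - 3) * (b - 1) * (-2 + a) * (a - 1) * (b - 3) * (b - 2) *
            Gamma (c - a) * Gamma (c - b))) +
        6 * (c - 2) * (c - 1) * (a * b - 3 * b - 3 * a + 3 + 2 * c) /
          ((a - 3) * (b - 1) * (-2 + a) * (a - 1) * (b - 3) * (b - 2)) := by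
  obtain ⟨g2, g3⟩ := Gamma_mul_rGamma_pred h.1
  have gs := Gamma_mul_rGamma h.2.2
  have key := Phi_two_four a b c
  rw [hF.eq h, Gamma_four]
  rw [show c + 4 - a - 2 - b = c + 2 - a - b by ring] at gs ⊢
  rw [show -b + 2 + c - a = c + 2 - a - b by ring]
  rw [show (a - 1) * (a - 2) * (a - 3) * ((b - 1) * (b - 2) * (b - 3)) =
    (a - 3) * (b - 1) * (-2 + a) * (a - 1) * (b - 3) * (b - 2) by ring] at key
  generalize (a - 3) * (b - 1) * (-2 + a) * (a - 1) * (b - 3) * (b - 2) = D at *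
  rw [div_eq_mul_inv, mul_inv, mul_inv, div_eq_mul_inv]
  change _ = -6 * (_ * (D⁻¹ * rGamma (c - a) * rGamma (c - b))) + _
  linear_combination D⁻¹ * (6 * Gamma c * Gamma (c + 2 - a - b) * key +
    6 * Gamma c * (2 * rGamma (c - 3) + (a - 3) * (b - 3) * rGamma (c - 2)) * gs +
    6 * (2 * g3 + (a - 3) * (b - 3) * g2)) -
    6 * Gamma c * Gamma (c + 2 - a - b) * Phi a 2 b c 4 * inv_mul_cancel₀ hD

/-- Kummer's transformation takes the parameters `a, b, 2; c, f` with excess two to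
`f - a, f - b, 2; 4, f`. -/
lemma IsHyp3F2One.two_excess_two (hF : IsHyp3F2One F) {a b c : ℂ}
    (h : Regular a 2 b c (4 + a - c + b))
    (hD : (-a - 2 + c) * (c - 3 - b) * (c - 2 - b) * (c - 1 - b) * (-a - 3 + c) *
      (-a + c - 1) ≠ 0) :
      F a 2 b c (4 + a - c + b) =
        (-a - 2 + c - b) * (-a - 3 + c - b) * (c - 2) * (c - 1) *
            (3 - 4 * c - c * a + c ^ 2 + 3 * a + a * b + 3 * b - b * c) /
          ((-a - 2 + c) * (c - 3 - b) * (c - 2 - b) * (c - 1 - b) * (-a - 3 + c) *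
            (-a + c - 1)) +
        (a + 5 - c * a + c ^ 2 - 4 * c + a * b - b * c + b) *
            Gamma (4 + a - c + b) * Gamma c /
          ((-a - 2 + c) * (c - 3 - b) * (c - 2 - b) * (c - 1 - b) * (-a - 3 + c) *
            (-a + c - 1) * Gamma b * Gamma a) := by
  obtain ⟨g2, -⟩ := Gamma_mul_rGamma_pred h.1
  obtain ⟨f2, f3⟩ := Gamma_mul_rGamma_pred h.2.1
  obtain ⟨f, hf⟩ : ∃ f, f = 4 + a - c + b := ⟨_, rfl⟩
  rw [← hf] at h f2 f3 ⊢
  have key := Phi_two_four (f - a) (f - b) f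
  rw [hF.eq h, show c + f - a - 2 - b = 2 by linear_combination hf, Gamma_two, mul_one,
    Phi_swap_bc, Phi_kummer, show c + f - a - b = 4 by linear_combination hf, Phi_swap_ef,
    Phi_swap_bc]
  rw [show f - (f - a) = a by ring, show f - (f - b) = b by ring,
    show f + 2 - (f - a) - (f - b) = c - 2 by linear_combination -hf,
    show (f - a - 1) * (f - a - 2) * (f - a - 3) * ((f - b - 1) * (f - b - 2) * (f - b - 3)) =
      (-a - 2 + c) * (c - 3 - b) * (c - 2 - b) * (c - 1 - b) * (-a - 3 + c) * (-a + c - 1) by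
      rw [hf]; ring] at key
  generalize (-a - 2 + c) * (c - 3 - b) * (c - 2 - b) * (c - 1 - b) * (-a - 3 + c) *
    (-a + c - 1) = D at *
  rw [div_eq_mul_inv _ (D * _ * _), mul_inv, mul_inv, div_eq_mul_inv]
  change _ = _ + _ * (D⁻¹ * rGamma b * rGamma a)
  have hX : 2 * ((f - 1) * (f - 2) * (f - 3)) + (f - a - 3) * (f - b - 3) * ((f - 1) * (f - 2)) =
      (-a - 2 + c - b) * (-a - 3 + c - b) *
        (3 - 4 * c - c * a + c ^ 2 + 3 * a + a * b + 3 * b - b * c) := by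
    rw [hf]; ring
  have hY : (f - a - 3) * (f - b - 3) - 2 * (c - 2) =
      a + 5 - c * a + c ^ 2 - 4 * c + a * b - b * c + b := by
    rw [hf]; ring
  linear_combination D⁻¹ * (Gamma c * Gamma f * key +
    Gamma f * (2 * rGamma (f - 3) + (f - a - 3) * (f - b - 3) * rGamma (f - 2)) * g2 +
    (c - 1) * (c - 2) * (2 * f3 + (f - a - 3) * (f - b - 3) * f2) +
    (c - 1) * (c - 2) * hX + Gamma c * Gamma f * rGamma a * rGamma b * hY) -
    Gamma c * Gamma f * Phi (f - a) 2 (f - b) f 4 * inv_mul_cancel₀ hD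

lemma IsHyp3F2One.excess_two (hF : IsHyp3F2One F) {a b c e f : ℂ} (h : Regular a b c e f)
    (hs : e + f - a - b - c = 2) (hq : a * b + a * c + b * c = (e - 1) * (f - 1)) :
    F a b c e f = Gamma e * Gamma f * (rGamma (a + 1) * rGamma (b + 1) * rGamma (c + 1)) := by
  rw [hF.eq h, hs, Gamma_two, Phi_excess_two h.1 h.2.1 hs hq, mul_one]

lemma sin_pi_mul_neg_sub (a : ℂ) (n : ℕ) :
    sin (pi * (-a - n)) = -(-1) ^ n * sin (pi * a) := by
  rw [show (pi : ℂ) * (-a - n) = -(pi * a + n * pi) by ring, Complex.sin_neg,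
    sin_add_natCast_mul_pi]
  ring

/-- The quotient of sines as a quotient of Gamma functions; `ε` is the sign `(-1) ^ m`, for an
integer `m` of either sign. -/
lemma sin_mul_Gamma_div {a b m : ℂ} {ε : ℂ} (hε : ε * ε = 1)
    (hsin : sin (pi * (-a - m)) = -ε * sin (pi * a)) (hb : NonPole (-b))
    (hm : NonPole (1 + a + m)) :
    ε * sin (pi * b) * Gamma (-b) * rGamma (-a - m) = sin (pi * a) * Gamma (1 + a + m) *
      rGamma (b + 1) := by
  have h1 := sin_pi_mul_mul_Gamma_neg hb
  have h2 := rGamma_mul_rGamma_one_sub (-a - m)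
  have hπ : (pi : ℂ) ≠ 0 := by exact_mod_cast Real.pi_ne_zero
  rw [hsin, show 1 - (-a - m) = 1 + a + m by ring, eq_div_iff hπ] at h2
  rw [show b + 1 = 1 + b by ring]
  have g := Gamma_mul_rGamma hm
  linear_combination ε * rGamma (-a - m) * h1 - ε * rGamma (1 + b) * Gamma (1 + a + m) * h2 +
    ε * rGamma (1 + b) * rGamma (-a - m) * pi * g + sin (pi * a) * Gamma (1 + a + m) *
      rGamma (1 + b) * hε

/-- With `q = a n / (b - n)` the parameters are `a, b, n - q; 1 + b - q, 1 + a + n`, and the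
condition on the products is `q (b - n) = a n`. -/
lemma IsHyp3F2One.excess_two_add (hF : IsHyp3F2One F) {a b : ℂ} {n : ℕ} (hbn : b - n ≠ 0)
    (h : Regular a b (-(n * (n - b + a) / (b - n))) (1 + b - a * n / (b - n)) (1 + a + n))
    (hb : NonPole (-b)) (ha : sin (pi * a) ≠ 0) :
    F a b (-(n * (n - b + a) / (b - n))) (1 + b - a * n / (b - n)) (1 + a + n) =
        (-1) ^ n * sin (pi * b) * Gamma (1 + b + a * n / (-b + n)) * Gamma (-b) /
          (sin (pi * a) * Gamma (1 + a) * Gamma (-a - n) *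
            Gamma (n + 1 + a * n / (-b + n))) := by
  have hq : a * n / (-b + n) = -(a * n / (b - n)) := by
    rw [show -b + n = -(b - n) by ring, div_neg]
  have key := sin_mul_Gamma_div (ε := (-1) ^ n) (by rw [← mul_pow]; simp) (sin_pi_mul_neg_sub a n)
    hb h.2.1
  have hc : -(n * (n - b + a) / (b - n)) = n - a * n / (b - n) := by field_simp; ring
  rw [hc] at h ⊢
  have hquad : a * n / (b - n) * (b - n) = a * n := div_mul_cancel₀ _ hbn
  rw [hq]
  generalize a * n / (b - n) = q at *
  rw [hF.excess_two h (by ring) (by linear_combination -hquad), ← sub_eq_add_neg, ← sub_eq_add_neg,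
    show 1 + a = a + 1 by ring, show (n : ℂ) + 1 - q = n - q + 1 by ring]
  rw [show a + 1 + n = 1 + a + n by ring, div_eq_mul_inv, mul_inv, mul_inv, mul_inv]
  change _ = _ * ((sin (pi * a))⁻¹ * rGamma (a + 1) * rGamma (-a - n) * rGamma (n - q + 1))
  linear_combination (sin (pi * a))⁻¹ * Gamma (1 + b - q) * rGamma (a + 1) * rGamma (n - q + 1) *
      -key -
    Gamma (1 + b - q) * rGamma (a + 1) * rGamma (n - q + 1) * Gamma (1 + a + n) *
      rGamma (b + 1) * inv_mul_cancel₀ ha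

/-- With `q = a n / (b + n)` the parameters are `a, b, q - n; 1 + b + q, 1 + a - n`, and the
condition on the products is `q (b + n) = a n`. -/
lemma IsHyp3F2One.excess_two_sub (hF : IsHyp3F2One F) {a b : ℂ} {n : ℕ} (hbn : b + n ≠ 0)
    (h : Regular a b (-n + a * n / (b + n)) (1 + b + a * n / (b + n)) (a - n + 1))
    (hb : NonPole (-b)) (ha : sin (pi * a) ≠ 0) :
    F a b (-n + a * n / (b + n)) (1 + b + a * n / (b + n)) (a - n + 1) =
        (-1) ^ n * sin (pi * b) * Gamma (1 + b + a * n / (b + n)) * Gamma (-b) /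
          (sin (pi * a) * Gamma (1 + a) * Gamma (1 - n + a * n / (b + n)) * Gamma (n - a)) := by
  have hsin : sin (pi * (-a - -(n : ℂ))) = -(-1) ^ n * sin (pi * a) := by
    rw [show (pi : ℂ) * (-a - -n) = -(pi * a) + n * pi by ring, sin_add_natCast_mul_pi,
      Complex.sin_neg]
    ring
  have key := sin_mul_Gamma_div (ε := (-1) ^ n) (by rw [← mul_pow]; simp) hsin
    hb (by rw [show 1 + a + -(n : ℂ) = a - n + 1 by ring]; exact h.2.1)
  have hquad : a * n / (b + n) * (b + n) = a * n := div_mul_cancel₀ _ hbn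
  generalize a * n / (b + n) = q at *
  rw [hF.excess_two h (by ring) (by linear_combination hquad)]
  rw [show -a - -(n : ℂ) = n - a by ring, show 1 + a + -(n : ℂ) = a - n + 1 by ring] at key
  rw [show 1 + a = a + 1 by ring, show 1 - (n : ℂ) + q = -n + q + 1 by ring,
    div_eq_mul_inv, mul_inv, mul_inv, mul_inv]
  change _ = _ * ((sin (pi * a))⁻¹ * rGamma (a + 1) * rGamma (-n + q + 1) * rGamma (n - a))
  linear_combination (sin (pi * a))⁻¹ * Gamma (1 + b + q) * rGamma (a + 1) * rGamma (-n + q + 1) *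
      -key -
    Gamma (1 + b + q) * rGamma (a + 1) * rGamma (-n + q + 1) * Gamma (a - n + 1) *
      rGamma (b + 1) * inv_mul_cancel₀ ha

/-- Half-integers are not poles of `Γ`. -/
lemma nonPole_of_two_mul_eq {z : ℂ} (m : ℤ) (h : 2 * z = 2 * m + 1) : NonPole z := by
  intro k hk
  rw [hk] at h
  have : (2 * -(k : ℤ) : ℤ) = 2 * m + 1 := by exact_mod_cast h
  omega

/-- The excess is two and the condition on the products holds identically; the rest is the
reflection formula at `3 n - a - 1 / 2`, `3 n - 1 / 2`, `n - a + 1 / 2` and `n + 1 / 2`. -/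
lemma IsHyp3F2One.excess_two_half (hF : IsHyp3F2One F) {a : ℂ} {n : ℕ}
    (h : Regular (3 * n - 3 / 2) (n - a - 1 / 2) (2 * a) (2 * a + 1 / 2 + n) (3 * n - a - 1 / 2))
    (ha : NonPole (a - n + 1 / 2)) :
      F (3 * n - 3 / 2) (n - a - 1 / 2) (2 * a) (2 * a + 1 / 2 + n) (3 * n - a - 1 / 2) =
        (2 * a / 3 + 1 / 3) * Gamma (-3 * n + 5 / 2) * Gamma (a - n + 1 / 2) *
            Gamma (2 * a + 1 / 2 + n) /
          (Gamma (1 / 2 + n) * Gamma (3 / 2 + a - 3 * n) * Gamma (2 * a + 2) *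
            Gamma (3 / 2 - n)) := by
  have hπ : (pi : ℂ) ≠ 0 := by exact_mod_cast Real.pi_ne_zero
  have hn : (1 / 2 - n : ℂ) ≠ 0 :=
    (nonPole_of_two_mul_eq (z := 1 / 2 - n) (-n) (by push_cast; ring)).ne_zero
  have hn3 : NonPole (3 / 2 - 3 * n : ℂ) :=
    nonPole_of_two_mul_eq (-3 * n + 1) (by push_cast; ring)
  have n1 := rGamma_mul_rGamma_one_sub (3 * n - a - 1 / 2)
  have n2 := rGamma_mul_rGamma_one_sub (3 * n - 3 / 2 + 1)
  have n3 := rGamma_mul_rGamma_one_sub (n - a - 1 / 2 + 1)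
  have n4 := rGamma_mul_rGamma_one_sub (1 / 2 + n)
  have g0 := Gamma_mul_rGamma h.2.1
  have g1 := Gamma_mul_rGamma hn3
  have g2 := Gamma_mul_rGamma ha
  rw [hF.excess_two h (by ring) (by ring), rGamma_eq (2 * a + 1),
    show 2 * a + 1 + 1 = 2 * a + 2 by ring,
    show (-3 * n + 5 / 2 : ℂ) = 3 / 2 - 3 * n + 1 by ring, Complex.Gamma_add_one _ hn3.ne_zero]
  have g4 := rGamma_eq (1 / 2 - n)
  rw [show (1 / 2 - n + 1 : ℂ) = 3 / 2 - n by ring] at g4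
  rw [show (1 - (3 * n - a - 1 / 2) : ℂ) = 3 / 2 + a - 3 * n by ring] at n1
  rw [show (1 - (3 * n - 3 / 2 + 1) : ℂ) = 3 / 2 - 3 * n by ring] at n2
  rw [show (1 - (n - a - 1 / 2 + 1) : ℂ) = a - n + 1 / 2 by ring] at n3
  rw [show (1 - (1 / 2 + n) : ℂ) = 1 / 2 - n by ring, g4] at n4
  have s1 : sin (pi * (3 * n - a - 1 / 2)) = -(-1) ^ n * Complex.cos (pi * a) := by
    rw [show (pi : ℂ) * (3 * n - a - 1 / 2) = -(pi * a + pi / 2) + (3 * n : ℕ) * pi by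
      push_cast; ring,
      sin_add_natCast_mul_pi, Complex.sin_neg, Complex.sin_add_pi_div_two, pow_mul]
    norm_num
  have s2 : sin (pi * (3 * n - 3 / 2 + 1)) = -(-1) ^ n := by
    rw [show (pi : ℂ) * (3 * n - 3 / 2 + 1) = -(pi / 2) + (3 * n : ℕ) * pi by push_cast; ring,
      sin_add_natCast_mul_pi, Complex.sin_neg, Complex.sin_pi_div_two, pow_mul]
    norm_num
  have s3 : sin (pi * (n - a - 1 / 2 + 1)) = (-1) ^ n * Complex.cos (pi * a) := by
    rw [show (pi : ℂ) * (n - a - 1 / 2 + 1) = pi / 2 - pi * a + n * pi by ring,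
      sin_add_natCast_mul_pi, Complex.sin_pi_div_two_sub]
  have s4 : sin (pi * (1 / 2 + n)) = (-1) ^ n := by
    rw [show (pi : ℂ) * (1 / 2 + n) = pi / 2 + n * pi by ring,
      sin_add_natCast_mul_pi, Complex.sin_pi_div_two, mul_one]
  rw [s1] at n1
  rw [s2] at n2
  rw [s3] at n3
  rw [s4] at n4
  have r1 : rGamma (3 / 2 + a - 3 * n) = Gamma (3 * n - a - 1 / 2) * (-(-1) ^ n *
      Complex.cos (pi * a) / pi) := by
    linear_combination Gamma (3 * n - a - 1 / 2) * n1 - rGamma (3 / 2 + a - 3 * n) * g0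
  have r2 : rGamma (3 * n - 3 / 2 + 1) = Gamma (3 / 2 - 3 * n) * (-(-1) ^ n / pi) := by
    linear_combination Gamma (3 / 2 - 3 * n) * n2 - rGamma (3 * n - 3 / 2 + 1) * g1
  have r3 : rGamma (n - a - 1 / 2 + 1) = Gamma (a - n + 1 / 2) * ((-1) ^ n * Complex.cos (pi *
      a) / pi) := by
    linear_combination Gamma (a - n + 1 / 2) * n3 - rGamma (n - a - 1 / 2 + 1) * g2
  have r4 : rGamma (1 / 2 + n) * rGamma (3 / 2 - n) = (-1) ^ n / (pi * (1 / 2 - n)) := by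
    rw [eq_div_iff (mul_ne_zero hπ hn)]
    rw [eq_div_iff hπ] at n4
    linear_combination n4
  refine Eq.trans ?_ (div_eq_mul_inv _ _).symm
  rw [mul_inv, mul_inv, mul_inv]
  change _ = _ * (rGamma (1 / 2 + n) * rGamma (3 / 2 + a - 3 * n) * rGamma (2 * a + 2) *
      rGamma (3 / 2 - n))
  rw [show rGamma (1 / 2 + n) * rGamma (3 / 2 + a - 3 * n) * rGamma (2 * a + 2) * rGamma (3 / 2 -
      n) =
    rGamma (1 / 2 + n) * rGamma (3 / 2 - n) * (rGamma (3 / 2 + a - 3 * n) * rGamma (2 * a +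
      2)) by ring,
    r1, r2, r3, r4]
  have h3 : (3 / 2 - 3 * n : ℂ) = 3 * (1 / 2 - n) := by ring
  rw [h3]
  generalize (1 / 2 - n : ℂ) = u at *
  field_simp

/-! ### Evaluations by Kummer's transformation and the duplication formula -/

/-- Legendre's duplication formula for `1 / Γ`. -/
lemma rGamma_of_eq_two_mul {y : ℂ} (x : ℂ) (hy : y = 2 * x) :
    rGamma y = rGamma x * rGamma (x + 1 / 2) * (Real.sqrt pi : ℂ) * 2 ^ (1 - y) := by
  have hπ : (Real.sqrt pi : ℂ) ≠ 0 := by exact_mod_cast (Real.sqrt_pos.2 Real.pi_pos).ne'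
  have h2 : (2 : ℂ) ^ (1 - 2 * x) ≠ 0 := by simp [Complex.cpow_eq_zero_iff]
  have h : rGamma x * rGamma (x + 1 / 2) = (Gamma (2 * x) * 2 ^ (1 - 2 * x) *
      (Real.sqrt pi : ℂ))⁻¹ := by
    rw [← Complex.Gamma_mul_Gamma_add_half, mul_inv]
    rfl
  rw [hy, h, rGamma, mul_inv, mul_inv]
  field_simp

lemma two_cpow_mul_two_cpow {x y z : ℂ} (h : x + y = z) : (2 : ℂ) ^ x * 2 ^ y = 2 ^ z := by
  rw [← two_cpow_add, h]

lemma two_mul_two_cpow {x z : ℂ} (h : x + 1 = z) : 2 * (2 : ℂ) ^ x = 2 ^ z := by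
  rw [← h, two_cpow_add, Complex.cpow_one, mul_comm]

lemma inv_two_cpow_mul_two_cpow {x y z : ℂ} (h : y = x + z) : ((2 : ℂ) ^ x)⁻¹ * 2 ^ y = 2 ^ z := by
  rw [h, two_cpow_add, inv_mul_cancel_left₀]
  simp [Complex.cpow_eq_zero_iff]

lemma NonPole.of_eq_two_mul {x y : ℂ} (hy : NonPole y) (h : y = 2 * x) : NonPole x ∧ NonPole (x +
    1 / 2) := by
  constructor <;> intro k hk
  · exact hy (2 * k) (by rw [h, hk]; push_cast; ring)
  · exact hy (2 * k + 1) (by rw [h, eq_sub_of_add_eq hk]; push_cast; ring)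

/-- The form of the duplication formula needed when `2 c - 1` is a bottom parameter. -/
lemma Gamma_sub_half_eq {c : ℂ} (hc : NonPole (2 * c - 1)) : 2 * (Real.sqrt pi : ℂ) *
    Gamma (c - 1 / 2) =
    Gamma (2 * c - 1) * (pi * 2 ^ (3 - 2 * c) * rGamma c) := by
  have d := rGamma_of_eq_two_mul (y := 2 * c - 1) (c - 1 / 2) (by ring)
  rw [sub_add_cancel] at d
  have g1 := Gamma_mul_rGamma hc
  have g2 := Gamma_mul_rGamma (hc.of_eq_two_mul (x := c - 1 / 2) (by ring)).1
  rw [← two_mul_two_cpow (x := 1 - (2 * c - 1)) (z := 3 - 2 * c) (by ring), ← sqrt_pi_mul_self]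
  linear_combination 2 * (Real.sqrt pi : ℂ) * (Gamma (c - 1 / 2) * Gamma (2 * c - 1) * d -
    Gamma (c - 1 / 2) * g1 + Gamma (2 * c - 1) * rGamma c * (Real.sqrt pi : ℂ) * 2 ^ (1 -
      (2 * c - 1)) * g2)

/-- Kummer's transformation, with `c` as the distinguished top parameter. -/
lemma IsHyp3F2One.watson_kummer (hF : IsHyp3F2One F) {a b c : ℂ} {m n : ℤ}
    (h : Regular a b c (c / 2 + b / 2 + n / 2 + 1 / 2 + m / 2) (-n + 2 * a))
    (hW : WatsonRegular c (-b + 2 * a - n) (a - n) m n) :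
    F a b c (c / 2 + b / 2 + n / 2 + 1 / 2 + m / 2) (-n + 2 * a) =
        watsonW F c (-b + 2 * a - n) (a - n) m n *
          Gamma (-c / 2 - b / 2 + a - n / 2 + 1 / 2 + m / 2) *
          Gamma (c / 2 + b / 2 + n / 2 + 1 / 2 + m / 2) /
        (Gamma (-c / 2 + b / 2 + n / 2 + 1 / 2 + m / 2) *
          Gamma (c / 2 - b / 2 + a - n / 2 + 1 / 2 + m / 2)) := by
  have key := Phi_kummer a b c (c / 2 + b / 2 + n / 2 + 1 / 2 + m / 2) (-n + 2 * a)
  rw [hF.eq h, watsonW, hF.eq hW]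
  unfold WatsonRegular at hW
  rw [show (c + (-b + 2 * a - n) + 1 + m) / 2 = c / 2 - b / 2 + a - n / 2 + 1 / 2 + m / 2 by ring,
    show 2 * (a - (n : ℂ)) + n = -n + 2 * a by ring] at hW ⊢
  have g1 := hW.1.Gamma_ne_zero
  have g2 := hW.2.2.Gamma_ne_zero
  rw [show c / 2 - b / 2 + a - n / 2 + 1 / 2 + m / 2 + (-n + 2 * a) - c - (-b + 2 * a - n) - (a -
      n) =
    -c / 2 + b / 2 + n / 2 + 1 / 2 + m / 2 by ring] at g2 ⊢
  rw [key, Phi_swap_ac, Phi_swap_ab c, show c / 2 + b / 2 + n / 2 + 1 / 2 + m / 2 + (-n + 2 *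
      a) - a - b =
      c / 2 - b / 2 + a - n / 2 + 1 / 2 + m / 2 by ring,
    show -(n : ℂ) + 2 * a - b = -b + 2 * a - n by ring, show -(n : ℂ) + 2 * a - a = a - n by ring,
    show c / 2 - b / 2 + a - n / 2 + 1 / 2 + m / 2 - c =
      -c / 2 - b / 2 + a - n / 2 + 1 / 2 + m / 2 by ring, Phi_swap_ab c]
  rw [eq_div_iff (mul_ne_zero g2 g1)]
  ring

/-- Kummer's transformation, with `b` as the distinguished top parameter. -/
lemma IsHyp3F2One.whipple_kummer (hF : IsHyp3F2One F) {a b c : ℂ} {m n : ℤ}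
    (h : Regular a (-a + m + 1) b c (-c + n + 2 * b + 1 + m))
    (hW : WatsonRegular (a - c + n + 2 * b) (-c - a + n + 1 + m + 2 * b) b m n) :
    F a (-a + m + 1) b c (-c + n + 2 * b + 1 + m) =
        watsonW F (a - c + n + 2 * b) (-c - a + n + 1 + m + 2 * b) b m n *
          Gamma (b + n) * Gamma c /
        (Gamma (c - b) * Gamma (2 * b + n)) := by
  have key := Phi_kummer a (-a + m + 1) b c (-c + n + 2 * b + 1 + m)
  rw [hF.eq h, watsonW, hF.eq hW]
  unfold WatsonRegular at hW
  rw [show (a - c + n + 2 * b + (-c - a + n + 1 + m + 2 * b) + 1 + m) / 2 = -c + n + 2 * b + 1 + m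
    by ring] at hW ⊢
  have g1 := hW.2.1.Gamma_ne_zero
  have g2 := hW.2.2.Gamma_ne_zero
  rw [show -c + n + 2 * b + 1 + m + (2 * b + n) - (a - c + n + 2 * b) -
    (-c - a + n + 1 + m + 2 * b) - b = c - b by ring] at g2 ⊢
  rw [key, Phi_swap_ab, Phi_swap_ef,
    show -c + n + 2 * b + 1 + m - (-a + m + 1) = a - c + n + 2 * b by ring,
    show -c + n + 2 * b + 1 + m - a = -c - a + n + 1 + m + 2 * b by ring,
    show c + (-c + n + 2 * b + 1 + m) - a - (-a + m + 1) = 2 * b + n by ring,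
    show 2 * b + (n : ℂ) - b = b + n by ring]
  field_simp

/-- `Γ(c + b - 2)` and `Γ(2 + 2 a - b - c)` are split by the duplication formula. One factor of each
cancels against the numerator of the first summand, the other against that of the second. -/
lemma IsHyp3F2One.whipple_succ (hF : IsHyp3F2One F) {a b c : ℂ}
    (h : Regular a b (-b + 2) c (2 * a + 2 - c))
    (h1 : NonPole (a - c / 2 + 1 - b / 2)) (h2 : NonPole (b / 2 - 1 + c / 2))
    (h3 : NonPole (3 / 2 + a - b / 2 - c / 2)) (h4 : NonPole (b / 2 + c / 2 - 1 / 2))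
    (hb : -b + 1 ≠ 0) (hc : -c + a + 1 ≠ 0) :
    F a b (-b + 2) c (2 * a + 2 - c) =
        (1 / 2 * (Gamma (a - c / 2 + 1 - b / 2) * Gamma (b / 2 - 1 + c / 2) /
              (Gamma (a + b / 2 - c / 2) * Gamma (-b / 2 + c / 2))) -
          1 / 2 * (Gamma (3 / 2 + a - b / 2 - c / 2) * Gamma (b / 2 + c / 2 - 1 / 2) /
              (Gamma (a - c / 2 + 1 / 2 + b / 2) * Gamma (-b / 2 + c / 2 + 1 / 2)))) *
          Gamma (2 * a + 2 - c) * Gamma c /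
        ((-b + 1) * (-c + a + 1) * Gamma (c + b - 2) * Gamma (2 + 2 * a - b - c)) := by
  have key := Phi_whipple_succ a b c
  have hs := h.2.2
  rw [hF.eq h]
  rw [show c + (2 * a + 2 - c) - a - b - (-b + 2) = a by ring] at hs ⊢
  have d1 := rGamma_of_eq_two_mul (y := c + b - 2) (b / 2 - 1 + c / 2) (by ring)
  have d2 := rGamma_of_eq_two_mul (y := 2 + 2 * a - b - c) (a - c / 2 + 1 - b / 2) (by ring)
  rw [show b / 2 - 1 + c / 2 + 1 / 2 = b / 2 + c / 2 - 1 / 2 by ring] at d1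
  rw [show a - c / 2 + 1 - b / 2 + 1 / 2 = 3 / 2 + a - b / 2 - c / 2 by ring] at d2
  have p1 := two_cpow_mul_two_cpow (x := 1 - (c + b - 2)) (y := 1 - (2 + 2 * a - b - c))
    (z := 2 - 2 * a) (by ring)
  rw [← two_mul_two_cpow (x := 1 - 2 * a) (z := 2 - 2 * a) (by ring)] at p1
  have d : rGamma (c + b - 2) * rGamma (2 + 2 * a - b - c) =
      rGamma (b / 2 - 1 + c / 2) * rGamma (b / 2 + c / 2 - 1 / 2) *
        (rGamma (a - c / 2 + 1 - b / 2) * rGamma (3 / 2 + a - b / 2 - c / 2)) *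
        (pi * (2 * 2 ^ (1 - 2 * a))) := by
    rw [d1, d2, ← p1, ← sqrt_pi_mul_self]
    ring
  have gs := Gamma_mul_rGamma hs
  have g1 := Gamma_mul_rGamma h1
  have g2 := Gamma_mul_rGamma h2
  have g3 := Gamma_mul_rGamma h3
  have g4 := Gamma_mul_rGamma h4
  have e1 : Gamma (a - c / 2 + 1 - b / 2) * Gamma (b / 2 - 1 + c / 2) *
      (rGamma (c + b - 2) * rGamma (2 + 2 * a - b - c)) =
      rGamma (b / 2 + c / 2 - 1 / 2) * rGamma (3 / 2 + a - b / 2 - c / 2) *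
        (pi * (2 * 2 ^ (1 - 2 * a))) := by
    rw [d]
    linear_combination rGamma (b / 2 + c / 2 - 1 / 2) * rGamma (3 / 2 + a - b / 2 - c / 2) *
      (pi * (2 * 2 ^ (1 - 2 * a))) * (Gamma (b / 2 - 1 + c / 2) * rGamma (b / 2 - 1 + c / 2) *
        g1 + g2)
  have e2 : Gamma (3 / 2 + a - b / 2 - c / 2) * Gamma (b / 2 + c / 2 - 1 / 2) *
      (rGamma (c + b - 2) * rGamma (2 + 2 * a - b - c)) =
      rGamma (b / 2 - 1 + c / 2) * rGamma (a - c / 2 + 1 - b / 2) *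
        (pi * (2 * 2 ^ (1 - 2 * a))) := by
    rw [d]
    linear_combination rGamma (b / 2 - 1 + c / 2) * rGamma (a - c / 2 + 1 - b / 2) *
      (pi * (2 * 2 ^ (1 - 2 * a))) *
      (Gamma (b / 2 + c / 2 - 1 / 2) * rGamma (b / 2 + c / 2 - 1 / 2) * g3 + g4)
  have hk : (-b + 1) * (-c + a + 1) ≠ 0 := mul_ne_zero hb hc
  generalize (-b + 1) * (-c + a + 1) = k at *
  simp only [rGamma] at key gs e1 e2
  linear_combination Gamma c * Gamma (2 * a + 2 - c) * k⁻¹ * (Gamma a * key +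
      Real.pi * 2 ^ (1 - 2 * a) * (
        ((Gamma (a + b / 2 - c / 2))⁻¹ * (Gamma (-b / 2 + c / 2))⁻¹ *
          ((Gamma (b / 2 + c / 2 - 1 / 2))⁻¹ * (Gamma (3 / 2 + a - b / 2 - c / 2))⁻¹) -
        (Gamma (b / 2 - 1 + c / 2))⁻¹ * (Gamma (a - c / 2 + 1 - b / 2))⁻¹ *
          ((Gamma (-b / 2 + c / 2 + 1 / 2))⁻¹ * (Gamma (a - c / 2 + 1 / 2 + b / 2))⁻¹))) * gs -
      1 / 2 * (Gamma (a + b / 2 - c / 2))⁻¹ * (Gamma (-b / 2 + c / 2))⁻¹ * e1 +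
      1 / 2 * (Gamma (-b / 2 + c / 2 + 1 / 2))⁻¹ * (Gamma (a - c / 2 + 1 / 2 + b / 2))⁻¹ * e2) -
    Gamma c * Gamma (2 * a + 2 - c) * Gamma a * Phi a b (-b + 2) c (2 * a + 2 - c) *
      inv_mul_cancel₀ hk

lemma IsHyp3F2One.watson_den_pred (hF : IsHyp3F2One F) {a b c : ℂ}
    (h : Regular a b c (2 * c - 1) (a / 2 + b / 2 + 1 / 2)) :
    F a b c (2 * c - 1) (a / 2 + b / 2 + 1 / 2) =
        (Real.sqrt pi : ℂ) * Gamma (c - 1 / 2) * Gamma (a / 2 + b / 2 + 1 / 2) *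
          Gamma (c - a / 2 - b / 2 - 1 / 2) *
          (1 / (Gamma (b / 2 + 1 / 2) * Gamma (c - 1 / 2 - a / 2) *
              Gamma (c - 1 / 2 - b / 2) * Gamma (a / 2 + 1 / 2)) +
            1 / (Gamma (a / 2) * Gamma (b / 2) * Gamma (c - a / 2) * Gamma (c - b / 2))) := by
  have key := Phi_watson_den_pred a b c
  rw [hF.eq h, show 2 * c - 1 + (a / 2 + b / 2 + 1 / 2) - a - b - c = c - a / 2 - b / 2 -
      1 / 2 by ring]
  have e : 2 * (Real.sqrt pi : ℂ) * Gamma (c - 1 / 2) = Gamma (2 * c - 1) * (pi * 2 ^ (3 - 2 *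
      c) * rGamma c) :=
    Gamma_sub_half_eq h.1
  simp only [rGamma] at key e
  linear_combination 1 / 2 * Gamma (2 * c - 1) * Gamma (a / 2 + b / 2 + 1 / 2) *
      Gamma (c - a / 2 - b / 2 - 1 / 2) * key - 1 / 2 * Gamma (a / 2 + b / 2 + 1 / 2) *
      Gamma (c - a / 2 - b / 2 - 1 / 2) * (1 / (Gamma (b / 2 + 1 / 2) * Gamma (c - 1 / 2 - a / 2) *
              Gamma (c - 1 / 2 - b / 2) * Gamma (a / 2 + 1 / 2)) +
            1 / (Gamma (a / 2) * Gamma (b / 2) * Gamma (c - a / 2) * Gamma (c - b / 2))) * e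

/-- Duplication splits `Γ(a)` into two factors, each of which cancels against the numerator of one
of the summands. -/
lemma IsHyp3F2One.watson_pred_succ (hF : IsHyp3F2One F) {a b c : ℂ}
    (h : Regular a b c (1 + 2 * b) (c / 2 + a / 2)) (h1 : NonPole (a / 2))
    (h2 : NonPole (a / 2 + 1 / 2)) :
    F a b c (1 + 2 * b) (c / 2 + a / 2) =
      (Gamma (a / 2) /
            (Gamma (1 + b - c / 2) * Gamma (-a / 2 + b + 1 / 2) * Gamma (c / 2)) +
          Gamma (a / 2 + 1 / 2) /
            (Gamma (1 / 2 + b - c / 2) * Gamma (-a / 2 + 1 + b) * Gamma (c / 2 + 1 / 2))) *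
          (Real.sqrt pi : ℂ) * Gamma (c / 2 + a / 2) * Gamma (1 + 2 * b) *
          Gamma (-c / 2 - a / 2 + 1 + b) /
        ((2 : ℂ) ^ (-a + 1 + 2 * b) * Gamma (b + 1) * Gamma a) := by
  have key := Phi_watson_pred_succ a b c
  rw [hF.eq h, show 1 + 2 * b + (c / 2 + a / 2) - a - b - c = -c / 2 - a / 2 + 1 + b by ring]
  have d := rGamma_of_eq_two_mul (y := a) (a / 2) (by ring)
  have g1 := Gamma_mul_rGamma h1
  have g2 := Gamma_mul_rGamma h2
  have p := inv_two_cpow_mul_two_cpow (x := -a + 1 + 2 * b) (y := 1 - a) (z := -2 * b) (by ring)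
  have p' := two_mul_two_cpow (x := -2 * b) (z := 1 - 2 * b) (by ring)
  have e1 : (Real.sqrt pi : ℂ) * ((2 : ℂ) ^ (-a + 1 + 2 * b))⁻¹ * (Gamma (a / 2) * rGamma a) =
      rGamma (a / 2 + 1 / 2) * (pi * 2 ^ (1 - 2 * b) / 2) := by
    rw [d, ← p', ← p, ← sqrt_pi_mul_self]
    linear_combination rGamma (a / 2 + 1 / 2) * (Real.sqrt pi : ℂ) * (Real.sqrt pi : ℂ) *
      ((2 : ℂ) ^ (-a + 1 + 2 * b))⁻¹ * 2 ^ (1 - a) * g1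
  have e2 : (Real.sqrt pi : ℂ) * ((2 : ℂ) ^ (-a + 1 + 2 * b))⁻¹ * (Gamma (a / 2 + 1 / 2) *
      rGamma a) =
      rGamma (a / 2) * (pi * 2 ^ (1 - 2 * b) / 2) := by
    rw [d, ← p', ← p, ← sqrt_pi_mul_self]
    linear_combination rGamma (a / 2) * (Real.sqrt pi : ℂ) * (Real.sqrt pi : ℂ) *
      ((2 : ℂ) ^ (-a + 1 + 2 * b))⁻¹ * 2 ^ (1 - a) * g2
  simp only [rGamma] at key e1 e2
  linear_combination Gamma (1 + 2 * b) * Gamma (c / 2 + a / 2) * Gamma (-c / 2 - a / 2 + 1 + b) *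
    (1 / 2 * key - (Gamma (b + 1))⁻¹ * (Gamma (c / 2))⁻¹ * (Gamma (-a / 2 + b + 1 / 2))⁻¹ *
        (Gamma (1 + b - c / 2))⁻¹ * e1 -
      (Gamma (b + 1))⁻¹ * (Gamma (c / 2 + 1 / 2))⁻¹ * (Gamma (1 / 2 + b - c / 2))⁻¹ *
        (Gamma (-a / 2 + 1 + b))⁻¹ * e2)

/-- Duplication splits `Γ(c + b - 1)`, whose factors cancel against the numerators. -/
lemma IsHyp3F2One.whipple_den_pred (hF : IsHyp3F2One F) {a b c : ℂ}
    (h : Regular a b (-b + 1) c (2 * a - c)) (h1 : NonPole (b / 2 + c / 2 - 1 / 2))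
    (h2 : NonPole (b / 2 + c / 2)) :
    F a b (-b + 1) c (2 * a - c) =
      ((Real.sqrt pi : ℂ) * Gamma (a - 1) * Gamma c * Gamma (b / 2 + c / 2 - 1 / 2) /
            ((2 : ℂ) ^ (2 * a - b - c) * Gamma a * Gamma (-b / 2 + c / 2 + 1 / 2) *
              Gamma (a - b / 2 - c / 2) * Gamma (a + b / 2 - c / 2 - 1 / 2) *
              Gamma (c + b - 1)) +
          (Real.sqrt pi : ℂ) * Gamma (b / 2 + c / 2) * Gamma (a - 1) * Gamma c /
            ((2 : ℂ) ^ (2 * a - b - c) * Gamma a * Gamma (-b / 2 + c / 2) *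
              Gamma (-b / 2 + a - c / 2 + 1 / 2) * Gamma (a + b / 2 - c / 2) *
              Gamma (c + b - 1))) * Gamma (2 * a - c) := by
  have key := Phi_whipple_den_pred a b c
  rw [hF.eq h, show c + (2 * a - c) - a - b - (-b + 1) = a - 1 by ring]
  have d := rGamma_of_eq_two_mul (y := c + b - 1) (b / 2 + c / 2 - 1 / 2) (by ring)
  rw [sub_add_cancel] at d
  have g1 := Gamma_mul_rGamma h1
  have g2 := Gamma_mul_rGamma h2
  have p := inv_two_cpow_mul_two_cpow (x := 2 * a - b - c) (y := 1 - (c + b - 1)) (z := 2 - 2 * a)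
    (by ring)
  have p' := two_mul_two_cpow (x := 2 - 2 * a) (z := 3 - 2 * a) (by ring)
  have e1 : (Real.sqrt pi : ℂ) * ((2 : ℂ) ^ (2 * a - b - c))⁻¹ *
      (Gamma (b / 2 + c / 2 - 1 / 2) * rGamma (c + b - 1)) =
      rGamma (b / 2 + c / 2) * (pi * 2 ^ (3 - 2 * a) / 2) := by
    rw [d, ← p', ← p, ← sqrt_pi_mul_self]
    linear_combination rGamma (b / 2 + c / 2) * (Real.sqrt pi : ℂ) * (Real.sqrt pi : ℂ) *
      ((2 : ℂ) ^ (2 * a - b - c))⁻¹ * 2 ^ (1 - (c + b - 1)) * g1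
  have e2 : (Real.sqrt pi : ℂ) * ((2 : ℂ) ^ (2 * a - b - c))⁻¹ *
      (Gamma (b / 2 + c / 2) * rGamma (c + b - 1)) =
      rGamma (b / 2 + c / 2 - 1 / 2) * (pi * 2 ^ (3 - 2 * a) / 2) := by
    rw [d, ← p', ← p, ← sqrt_pi_mul_self]
    linear_combination rGamma (b / 2 + c / 2 - 1 / 2) * (Real.sqrt pi : ℂ) * (Real.sqrt pi : ℂ) *
      ((2 : ℂ) ^ (2 * a - b - c))⁻¹ * 2 ^ (1 - (c + b - 1)) * g2
  simp only [rGamma] at key e1 e2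
  linear_combination Gamma c * Gamma (2 * a - c) * Gamma (a - 1) * (1 / 2 * key -
    (Gamma a)⁻¹ * (Gamma (a - b / 2 - c / 2))⁻¹ * (Gamma (a + b / 2 - c / 2 - 1 / 2))⁻¹ *
      (Gamma (-b / 2 + c / 2 + 1 / 2))⁻¹ * e1 -
    (Gamma a)⁻¹ * (Gamma (a + b / 2 - c / 2))⁻¹ * (Gamma (-b / 2 + c / 2))⁻¹ *
      (Gamma (-b / 2 + a - c / 2 + 1 / 2))⁻¹ * e2)

/-- Duplication splits `Γ(c + b)`, whose factors cancel against the numerators. -/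
lemma IsHyp3F2One.whipple_num_pred (hF : IsHyp3F2One F) {a b c : ℂ}
    (h : Regular a b (-b) c (2 * a - c + 1)) (h1 : NonPole (b / 2 + c / 2))
    (h2 : NonPole (c / 2 + b / 2 + 1 / 2)) :
    F a b (-b) c (2 * a - c + 1) =
        (Real.sqrt pi : ℂ) * Gamma (2 * a - c + 1) * Gamma c * Gamma (b / 2 + c / 2) /
          ((2 : ℂ) ^ (2 * a - c + 1 - b) * Gamma (a - c / 2 + 1 + b / 2) *
            Gamma (-b / 2 + a - c / 2 + 1 / 2) * Gamma (-b / 2 + c / 2) * Gamma (c + b)) +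
        (Real.sqrt pi : ℂ) * Gamma (2 * a - c + 1) * Gamma (c / 2 + b / 2 + 1 / 2) * Gamma c /
          ((2 : ℂ) ^ (2 * a - c + 1 - b) * Gamma (a - c / 2 + 1 / 2 + b / 2) *
            Gamma (a - c / 2 + 1 - b / 2) * Gamma (-b / 2 + c / 2 + 1 / 2) *
            Gamma (c + b)) := by
  have key := Phi_whipple_num_pred (a := a) (b := b) (e := c) (f := 2 * a - c + 1) (by ring)
  have hs := h.2.2
  rw [hF.eq h]
  rw [show c + (2 * a - c + 1) - a - b - -b = a + 1 by ring] at hs ⊢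
  have gs := Gamma_mul_rGamma hs
  rw [Phi_swap_bc, Phi_swap_ab] at key
  rw [whippleProd, whippleProd] at key
  rw [show (-b + c) / 2 = -b / 2 + c / 2 by ring,
    show (1 - -b + c) / 2 = c / 2 + b / 2 + 1 / 2 by ring,
    show (-b + (2 * a - c + 1)) / 2 = -b / 2 + a - c / 2 + 1 / 2 by ring,
    show (1 - -b + (2 * a - c + 1)) / 2 = a - c / 2 + 1 + b / 2 by ring,
    show (b + c) / 2 = b / 2 + c / 2 by ring,
    show (1 - b + c) / 2 = -b / 2 + c / 2 + 1 / 2 by ring,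
    show (b + (2 * a - c + 1)) / 2 = a - c / 2 + 1 / 2 + b / 2 by ring,
    show (1 - b + (2 * a - c + 1)) / 2 = a - c / 2 + 1 - b / 2 by ring] at key
  have d := rGamma_of_eq_two_mul (y := c + b) (b / 2 + c / 2) (by ring)
  rw [show b / 2 + c / 2 + 1 / 2 = c / 2 + b / 2 + 1 / 2 by ring] at d
  have g1 := Gamma_mul_rGamma h1
  have g2 := Gamma_mul_rGamma h2
  have p := inv_two_cpow_mul_two_cpow (x := 2 * a - c + 1 - b) (y := 1 - (c + b)) (z := -2 * a)
    (by ring)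
  have p' := two_mul_two_cpow (x := -2 * a) (z := 1 - 2 * a) (by ring)
  have e1 : (Real.sqrt pi : ℂ) * ((2 : ℂ) ^ (2 * a - c + 1 - b))⁻¹ *
      (Gamma (b / 2 + c / 2) * rGamma (c + b)) =
      rGamma (c / 2 + b / 2 + 1 / 2) * (pi * 2 ^ (1 - 2 * a) / 2) := by
    rw [d, ← p', ← p, ← sqrt_pi_mul_self]
    linear_combination rGamma (c / 2 + b / 2 + 1 / 2) * (Real.sqrt pi : ℂ) * (Real.sqrt pi : ℂ) *
      ((2 : ℂ) ^ (2 * a - c + 1 - b))⁻¹ * 2 ^ (1 - (c + b)) * g1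
  have e2 : (Real.sqrt pi : ℂ) * ((2 : ℂ) ^ (2 * a - c + 1 - b))⁻¹ *
      (Gamma (c / 2 + b / 2 + 1 / 2) * rGamma (c + b)) =
      rGamma (b / 2 + c / 2) * (pi * 2 ^ (1 - 2 * a) / 2) := by
    rw [d, ← p', ← p, ← sqrt_pi_mul_self]
    linear_combination rGamma (b / 2 + c / 2) * (Real.sqrt pi : ℂ) * (Real.sqrt pi : ℂ) *
      ((2 : ℂ) ^ (2 * a - c + 1 - b))⁻¹ * 2 ^ (1 - (c + b)) * g2
  have key' : 2 * (Gamma (a + 1) * Phi a b (-b) c (2 * a - c + 1)) = pi * 2 ^ (1 - 2 * a) * (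
      rGamma (-b / 2 + c / 2) * rGamma (c / 2 + b / 2 + 1 / 2) *
        (rGamma (-b / 2 + a - c / 2 + 1 / 2) * rGamma (a - c / 2 + 1 + b / 2)) +
      rGamma (b / 2 + c / 2) * rGamma (-b / 2 + c / 2 + 1 / 2) *
        (rGamma (a - c / 2 + 1 / 2 + b / 2) * rGamma (a - c / 2 + 1 - b / 2))) := by
    linear_combination Gamma (a + 1) * key + pi * 2 ^ (1 - 2 * a) * (
      rGamma (-b / 2 + c / 2) * rGamma (c / 2 + b / 2 + 1 / 2) *
        (rGamma (-b / 2 + a - c / 2 + 1 / 2) * rGamma (a - c / 2 + 1 + b / 2)) +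
      rGamma (b / 2 + c / 2) * rGamma (-b / 2 + c / 2 + 1 / 2) *
        (rGamma (a - c / 2 + 1 / 2 + b / 2) * rGamma (a - c / 2 + 1 - b / 2))) * gs
  simp only [rGamma] at key' e1 e2
  linear_combination Gamma c * Gamma (2 * a - c + 1) * (1 / 2 * key' -
    (Gamma (a - c / 2 + 1 + b / 2))⁻¹ * (Gamma (-b / 2 + a - c / 2 + 1 / 2))⁻¹ *
      (Gamma (-b / 2 + c / 2))⁻¹ * e1 -
    (Gamma (a - c / 2 + 1 / 2 + b / 2))⁻¹ * (Gamma (a - c / 2 + 1 - b / 2))⁻¹ *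
      (Gamma (-b / 2 + c / 2 + 1 / 2))⁻¹ * e2)

/-- Duplication splits `Γ(2 c - a)` and `Γ(a)`, whose factors cancel against the numerators. -/
lemma IsHyp3F2One.watson_succ (hF : IsHyp3F2One F) {a b c : ℂ}
    (h : Regular a b c (2 * c) (1 + b / 2 + a / 2)) (h1 : NonPole (c - a / 2))
    (h2 : NonPole (a / 2)) (h3 : NonPole (1 / 2 - a / 2 + c)) (h4 : NonPole (a / 2 + 1 / 2))
    (hab : b / 2 - a / 2 ≠ 0) (hc : -a / 2 - b / 2 + c ≠ 0) :
      F a b c (2 * c) (1 + b / 2 + a / 2) =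
        (1 / 2 * (Gamma (c - a / 2) * Gamma (a / 2) / (Gamma (c - b / 2) * Gamma (b / 2))) -
          1 / 2 * (Gamma (1 / 2 - a / 2 + c) * Gamma (a / 2 + 1 / 2) /
            (Gamma (1 / 2 - b / 2 + c) * Gamma (b / 2 + 1 / 2)))) *
          Gamma (1 + b / 2 + a / 2) * Gamma (2 * c) * Gamma (-a / 2 + 1 - b / 2 + c) /
        (Gamma (2 * c - a) * Gamma c * Gamma a * (b / 2 - a / 2) * (-a / 2 - b / 2 + c)) := by
  have key := Phi_watson_succ a b c
  rw [hF.eq h, show 2 * c + (1 + b / 2 + a / 2) - a - b - c = -a / 2 + 1 - b / 2 + c by ring]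
  have d1 := rGamma_of_eq_two_mul (y := 2 * c - a) (c - a / 2) (by ring)
  have d2 := rGamma_of_eq_two_mul (y := a) (a / 2) (by ring)
  rw [show c - a / 2 + 1 / 2 = 1 / 2 - a / 2 + c by ring] at d1
  have p1 := two_cpow_mul_two_cpow (x := 1 - (2 * c - a)) (y := 1 - a) (z := 2 - 2 * c) (by ring)
  rw [← two_mul_two_cpow (x := 1 - 2 * c) (z := 2 - 2 * c) (by ring)] at p1
  have d : rGamma (2 * c - a) * rGamma a =
      rGamma (c - a / 2) * rGamma (1 / 2 - a / 2 + c) * (rGamma (a / 2) * rGamma (a / 2 + 1 / 2)) *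
        (pi * (2 * 2 ^ (1 - 2 * c))) := by
    rw [d1, d2, ← p1, ← sqrt_pi_mul_self]
    ring
  have g1 := Gamma_mul_rGamma h1
  have g2 := Gamma_mul_rGamma h2
  have g3 := Gamma_mul_rGamma h3
  have g4 := Gamma_mul_rGamma h4
  have e1 : Gamma (c - a / 2) * Gamma (a / 2) * (rGamma (2 * c - a) * rGamma a) =
      rGamma (1 / 2 - a / 2 + c) * rGamma (a / 2 + 1 / 2) * (pi * (2 * 2 ^ (1 - 2 * c))) := by
    rw [d]
    linear_combination rGamma (1 / 2 - a / 2 + c) * rGamma (a / 2 + 1 / 2) *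
      (pi * (2 * 2 ^ (1 - 2 * c))) * (Gamma (a / 2) * rGamma (a / 2) * g1 + g2)
  have e2 : Gamma (1 / 2 - a / 2 + c) * Gamma (a / 2 + 1 / 2) * (rGamma (2 * c - a) * rGamma a) =
      rGamma (c - a / 2) * rGamma (a / 2) * (pi * (2 * 2 ^ (1 - 2 * c))) := by
    rw [d]
    linear_combination rGamma (c - a / 2) * rGamma (a / 2) * (pi * (2 * 2 ^ (1 - 2 * c))) *
      (Gamma (a / 2 + 1 / 2) * rGamma (a / 2 + 1 / 2) * g3 + g4)
  rw [show (a - b) * (c - a / 2 - b / 2) = -2 * ((b / 2 - a / 2) * (-a / 2 - b / 2 + c)) by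
      ring] at key
  rw [mul_assoc (_ * _ * _) (b / 2 - a / 2)]
  have hk : (b / 2 - a / 2) * (-a / 2 - b / 2 + c) ≠ 0 := mul_ne_zero hab hc
  generalize (b / 2 - a / 2) * (-a / 2 - b / 2 + c) = k at *
  simp only [rGamma] at key e1 e2
  linear_combination Gamma (2 * c) * Gamma (1 + b / 2 + a / 2) * Gamma (-a / 2 + 1 - b / 2 + c) *
    (k⁻¹ * (-1 / 2 * key - 1 / 2 * (Gamma c)⁻¹ * (Gamma (c - b / 2))⁻¹ * (Gamma (b / 2))⁻¹ * e1 +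
      1 / 2 * (Gamma c)⁻¹ * (Gamma (1 / 2 - b / 2 + c))⁻¹ * (Gamma (b / 2 + 1 / 2))⁻¹ * e2) -
    Phi a b c (2 * c) (1 + b / 2 + a / 2) * inv_mul_cancel₀ hk)

/-- Here the excess `3 + b - 2 a - 2 c` is the doubled argument, so that `Γ` of its halves is finite
by regularity. -/
lemma IsHyp3F2One.dixon_succ (hF : IsHyp3F2One F) {a b c : ℂ}
    (h : Regular a b c (b + 2 - a) (1 + b - c)) (ha : a - 1 ≠ 0) :
      F a b c (b + 2 - a) (1 + b - c) =
        -(Gamma (b + 2 - a) * Gamma (1 + b - c) * Gamma (b / 2 - c - a + 2) *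
            (Real.sqrt pi : ℂ) /
          (Gamma (-a + 1 + b / 2) * Gamma (b / 2 - c + 1) * Gamma (b / 2 + 1 / 2) * (a - 1) *
            Gamma (-c - a + b + 2) * (2 : ℂ) ^ b)) +
        Gamma (b + 2 - a) * Gamma (1 + b - c) * Gamma (b / 2 - c - a + 3 / 2) *
            (Real.sqrt pi : ℂ) /
          ((a - 1) * Gamma (-c - a + b + 2) * Gamma (b / 2) * Gamma (b / 2 + 3 / 2 - a) *
            (2 : ℂ) ^ b * Gamma (1 / 2 + b / 2 - c)) := by
  have key := Phi_dixon_succ a b c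
  have hs := h.2.2
  rw [hF.eq h]
  rw [show b + 2 - a + (1 + b - c) - a - b - c = 3 + b - 2 * a - 2 * c by ring] at hs ⊢
  have d := rGamma_of_eq_two_mul (y := 3 + b - 2 * a - 2 * c) (b / 2 - c - a + 3 / 2) (by ring)
  obtain ⟨h1, h2⟩ := hs.of_eq_two_mul (x := b / 2 - c - a + 3 / 2) (by ring)
  rw [show b / 2 - c - a + 3 / 2 + 1 / 2 = b / 2 - c - a + 2 by ring] at d h2
  have gs := Gamma_mul_rGamma hs
  have g1 := Gamma_mul_rGamma h1
  have g2 := Gamma_mul_rGamma h2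
  have p := inv_two_cpow_mul_two_cpow (x := b) (y := 1 - (3 + b - 2 * a - 2 * c))
    (z := 2 * a + 2 * c - 2 * b - 2) (by ring)
  have p' := two_mul_two_cpow (x := 2 * a + 2 * c - 2 * b - 2) (z := 2 * a + 2 * c - 2 * b - 1)
    (by ring)
  rw [d] at gs
  have e1 : Gamma (3 + b - 2 * a - 2 * c) * (pi * 2 ^ (2 * a + 2 * c - 2 * b - 1)) *
      rGamma (b / 2 - c - a + 2) = 2 * Gamma (b / 2 - c - a + 3 / 2) * (Real.sqrt pi : ℂ) *
        (2 ^ b)⁻¹ := by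
    rw [← p', ← p, ← sqrt_pi_mul_self]
    linear_combination 2 * (Real.sqrt pi : ℂ) * (2 ^ b)⁻¹ * (Gamma (b / 2 - c - a + 3 / 2) * gs -
      Gamma (3 + b - 2 * a - 2 * c) * rGamma (b / 2 - c - a + 2) * (Real.sqrt pi : ℂ) *
        2 ^ (1 - (3 + b - 2 * a - 2 * c)) * g1)
  have e2 : Gamma (3 + b - 2 * a - 2 * c) * (pi * 2 ^ (2 * a + 2 * c - 2 * b - 1)) *
      rGamma (b / 2 - c - a + 3 / 2) = 2 * Gamma (b / 2 - c - a + 2) * (Real.sqrt pi : ℂ) *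
        (2 ^ b)⁻¹ := by
    rw [← p', ← p, ← sqrt_pi_mul_self]
    linear_combination 2 * (Real.sqrt pi : ℂ) * (2 ^ b)⁻¹ * (Gamma (b / 2 - c - a + 2) * gs -
      Gamma (3 + b - 2 * a - 2 * c) * rGamma (b / 2 - c - a + 3 / 2) * (Real.sqrt pi : ℂ) *
        2 ^ (1 - (3 + b - 2 * a - 2 * c)) * g2)
  generalize a - 1 = k at *
  simp only [rGamma] at key e1 e2
  linear_combination Gamma (b + 2 - a) * Gamma (1 + b - c) * (
    1 / 2 * k⁻¹ * (Gamma (3 + b - 2 * a - 2 * c) * key + (Gamma (-c - a + b + 2))⁻¹ *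
      ((Gamma (b / 2))⁻¹ * (Gamma (1 / 2 + b / 2 - c))⁻¹ * (Gamma (b / 2 + 3 / 2 - a))⁻¹ * e1 -
      (Gamma (b / 2 + 1 / 2))⁻¹ * (Gamma (b / 2 - c + 1))⁻¹ * (Gamma (-a + 1 + b / 2))⁻¹ * e2)) -
    Gamma (3 + b - 2 * a - 2 * c) * Phi a b c (b + 2 - a) (1 + b - c) * inv_mul_cancel₀ ha)

/-- Duplication splits `Γ(c + 1)` and `Γ(2 a - b)`, and the factors `c` and `2 a - b - 1` of the
first summand lower the arguments of the reciprocal Gamma functions that remain. -/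
lemma IsHyp3F2One.watson_succ_pred (hF : IsHyp3F2One F) {a b c : ℂ}
    (h : Regular a b c (1 + c / 2 + b / 2) (2 * a - 1)) (h1 : NonPole (a - b / 2))
    (h2 : NonPole (c / 2 + 1 / 2)) (h3 : NonPole (1 + c / 2)) (h4 : NonPole (-b / 2 + a + 1 / 2))
    (hk : -c / 2 + b / 2 ≠ 0) :
      F a b c (1 + c / 2 + b / 2) (2 * a - 1) =
        (-1 / 4 * (c * (-b - 1 + 2 * a) * Gamma (a - b / 2) * Gamma (c / 2 + 1 / 2) /
            (Gamma (-c / 2 + a) * Gamma (b / 2 + 1 / 2))) +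
          Gamma (1 + c / 2) * Gamma (-b / 2 + a + 1 / 2) /
            (Gamma (-c / 2 + a - 1 / 2) * Gamma (b / 2))) *
          Gamma (1 + c / 2 + b / 2) * Gamma (a - b / 2 - c / 2) * Gamma (a - 1 / 2) *
          (2 : ℂ) ^ (c - b + 2 * a - 1) /
        ((Real.sqrt pi : ℂ) * Gamma (c + 1) * Gamma (2 * a - b) * (-c / 2 + b / 2)) := by
  have key := Phi_watson_succ_pred a b c
  have e0 := Gamma_sub_half_eq h.2.1
  rw [hF.eq h, show 1 + c / 2 + b / 2 + (2 * a - 1) - a - b - c = a - b / 2 - c / 2 by ring]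
  have hπ : (Real.sqrt pi : ℂ) ≠ 0 := by exact_mod_cast (Real.sqrt_pos.2 Real.pi_pos).ne'
  have d1 := rGamma_of_eq_two_mul (y := c + 1) (c / 2 + 1 / 2) (by ring)
  have d2 := rGamma_of_eq_two_mul (y := 2 * a - b) (a - b / 2) (by ring)
  rw [show c / 2 + 1 / 2 + 1 / 2 = 1 + c / 2 by ring] at d1
  rw [show a - b / 2 + 1 / 2 = -b / 2 + a + 1 / 2 by ring] at d2
  have p1 := two_cpow_mul_two_cpow (x := 1 - (c + 1)) (y := 1 - (2 * a - b)) (z := 1 - c - 2 *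
      a + b)
    (by ring)
  have p2 := two_cpow_mul_two_cpow (x := 1 - c - 2 * a + b) (y := c - b + 2 * a - 1) (z :=
      0) (by ring)
  rw [Complex.cpow_zero, ← p1] at p2
  have d : (Real.sqrt pi : ℂ)⁻¹ * (2 : ℂ) ^ (c - b + 2 * a - 1) * (rGamma (c + 1) * rGamma (2 *
      a - b)) =
      rGamma (c / 2 + 1 / 2) * rGamma (1 + c / 2) *
        (rGamma (a - b / 2) * rGamma (-b / 2 + a + 1 / 2)) * (Real.sqrt pi : ℂ) := by
    rw [d1, d2]
    linear_combination (rGamma (c / 2 + 1 / 2) * rGamma (1 + c / 2) *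
        (rGamma (a - b / 2) * rGamma (-b / 2 + a + 1 / 2)) * (Real.sqrt pi : ℂ)) *
      ((Real.sqrt pi : ℂ)⁻¹ * (Real.sqrt pi : ℂ) * p2 + inv_mul_cancel₀ hπ)
  have g1 := Gamma_mul_rGamma h1
  have g2 := Gamma_mul_rGamma h2
  have g3 := Gamma_mul_rGamma h3
  have g4 := Gamma_mul_rGamma h4
  have r1 := rGamma_eq (c / 2)
  have r2 := rGamma_eq (-b / 2 + a - 1 / 2)
  rw [add_comm] at r1
  rw [show -b / 2 + a - 1 / 2 + 1 = -b / 2 + a + 1 / 2 by ring] at r2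
  have e1 : (Real.sqrt pi : ℂ)⁻¹ * (2 : ℂ) ^ (c - b + 2 * a - 1) *
      (c * (-b - 1 + 2 * a) * Gamma (a - b / 2) * Gamma (c / 2 + 1 / 2) *
        (rGamma (c + 1) * rGamma (2 * a - b))) =
      4 * rGamma (c / 2) * rGamma (-b / 2 + a - 1 / 2) * (Real.sqrt pi : ℂ) := by
    rw [r1, r2]
    linear_combination c * (-b - 1 + 2 * a) * Gamma (a - b / 2) * Gamma (c / 2 + 1 / 2) * d +
      c * (-b - 1 + 2 * a) * rGamma (1 + c / 2) * rGamma (-b / 2 + a + 1 / 2) * (Real.sqrt pi : ℂ) *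
        (Gamma (c / 2 + 1 / 2) * rGamma (c / 2 + 1 / 2) * g1 + g2)
  have e2 : (Real.sqrt pi : ℂ)⁻¹ * (2 : ℂ) ^ (c - b + 2 * a - 1) *
      (Gamma (1 + c / 2) * Gamma (-b / 2 + a + 1 / 2) * (rGamma (c + 1) * rGamma (2 * a - b))) =
      rGamma (c / 2 + 1 / 2) * rGamma (a - b / 2) * (Real.sqrt pi : ℂ) := by
    linear_combination Gamma (1 + c / 2) * Gamma (-b / 2 + a + 1 / 2) * d +
      rGamma (c / 2 + 1 / 2) * rGamma (a - b / 2) * (Real.sqrt pi : ℂ) *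
        (Gamma (1 + c / 2) * rGamma (1 + c / 2) * g4 + g3)
  rw [show c - b = -2 * (-c / 2 + b / 2) by ring] at key
  generalize -c / 2 + b / 2 = k at *
  simp only [rGamma] at key e0 e1 e2
  linear_combination Gamma (1 + c / 2 + b / 2) * Gamma (a - b / 2 - c / 2) * (
    k⁻¹ * (-1 / 2 * Gamma (2 * a - 1) * key +
      1 / 2 * ((Gamma (-b / 2 + a - 1 / 2))⁻¹ * (Gamma (c / 2))⁻¹ *
          ((Gamma (-c / 2 + a))⁻¹ * (Gamma (b / 2 + 1 / 2))⁻¹) -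
        (Gamma (a - b / 2))⁻¹ * (Gamma (c / 2 + 1 / 2))⁻¹ *
          ((Gamma (-c / 2 + a - 1 / 2))⁻¹ * (Gamma (b / 2))⁻¹)) * e0 +
      Gamma (a - 1 / 2) *
        (1 / 4 * (Gamma (-c / 2 + a))⁻¹ * (Gamma (b / 2 + 1 / 2))⁻¹ * e1 -
        (Gamma (-c / 2 + a - 1 / 2))⁻¹ * (Gamma (b / 2))⁻¹ * e2)) -
    Gamma (2 * a - 1) * Phi a b c (1 + c / 2 + b / 2) (2 * a - 1) * inv_mul_cancel₀ hk)

lemma IsHyp3F2One.whipple_den_succ (hF : IsHyp3F2One F) {a b c : ℂ}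
    (h : Regular a (-a + 1) b c (-c + 2 + 2 * b)) (hk : c - 1 - b ≠ 0) :
      F a (-a + 1) b c (-c + 2 + 2 * b) =
        (-(1 / ((c - 1 - b) * Gamma (1 / 2 + a / 2 - c / 2 + b) *
            Gamma (-c / 2 - a / 2 + 1 + b) * Gamma (c / 2 + a / 2) *
            Gamma (-a / 2 + c / 2 + 1 / 2))) +
          1 / ((c - 1 - b) * Gamma (a / 2 - c / 2 + 1 + b) * Gamma (-a / 2 + c / 2) *
            Gamma (-1 / 2 + c / 2 + a / 2) * Gamma (3 / 2 - c / 2 - a / 2 + b))) *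
          pi * (2 : ℂ) ^ (-2 * b) * Gamma (-c + 2 + 2 * b) * Gamma c := by
  have key := Phi_whipple_den_succ (a := a) (b := b) (e := c) (f := -c + 2 + 2 * b) (by ring)
  have hs := h.2.2
  rw [hF.eq h]
  rw [show c + (-c + 2 + 2 * b) - a - (-a + 1) - b = b + 1 by ring] at hs ⊢
  have gs := Gamma_mul_rGamma hs
  rw [show -a + 1 = 1 - a by ring]
  rw [whippleProd, whippleProd] at key
  rw [show c - (-c + 2 + 2 * b) = 2 * (c - 1 - b) by ring,
    show (a + (c - 1)) / 2 = -1 / 2 + c / 2 + a / 2 by ring,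
    show (1 - a + (c - 1)) / 2 = -a / 2 + c / 2 by ring,
    show (a + (-c + 2 + 2 * b)) / 2 = a / 2 - c / 2 + 1 + b by ring,
    show (1 - a + (-c + 2 + 2 * b)) / 2 = 3 / 2 - c / 2 - a / 2 + b by ring,
    show (a + c) / 2 = c / 2 + a / 2 by ring,
    show (1 - a + c) / 2 = -a / 2 + c / 2 + 1 / 2 by ring,
    show (a + (-c + 2 + 2 * b - 1)) / 2 = 1 / 2 + a / 2 - c / 2 + b by ring,
    show (1 - a + (-c + 2 + 2 * b - 1)) / 2 = -c / 2 - a / 2 + 1 + b by ring,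
    ← two_mul_two_cpow (x := -2 * b) (z := 1 - 2 * b) (by ring)] at key
  generalize c - 1 - b = k at *
  simp only [rGamma] at key gs
  linear_combination Gamma c * Gamma (-c + 2 + 2 * b) * (1 / 2 * k⁻¹ * Gamma (b + 1) * key +
    k⁻¹ * pi * 2 ^ (-2 * b) *
      ((Gamma (-1 / 2 + c / 2 + a / 2))⁻¹ * (Gamma (-a / 2 + c / 2))⁻¹ *
        ((Gamma (a / 2 - c / 2 + 1 + b))⁻¹ * (Gamma (3 / 2 - c / 2 - a / 2 + b))⁻¹) -
      (Gamma (c / 2 + a / 2))⁻¹ * (Gamma (-a / 2 + c / 2 + 1 / 2))⁻¹ *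
        ((Gamma (1 / 2 + a / 2 - c / 2 + b))⁻¹ * (Gamma (-c / 2 - a / 2 + 1 + b))⁻¹)) * gs -
    Gamma (b + 1) * Phi a (1 - a) b c (-c + 2 + 2 * b) * inv_mul_cancel₀ hk)

end

/-! ### The evaluations -/

theorem mainTheorem2 :
    (∃ F : ℂ → ℂ → ℂ → ℂ → ℂ → ℂ, IsHyp3F2One F) ∧
    ∀ F : ℂ → ℂ → ℂ → ℂ → ℂ → ℂ, IsHyp3F2One F →
    -- (1)
    (∀ a b c : ℂ, Regular a b (-b + 2) c (2 * a + 2 - c) →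
      NonPole (a - c / 2 + 1 - b / 2) → NonPole (b / 2 - 1 + c / 2) →
      NonPole (3 / 2 + a - b / 2 - c / 2) → NonPole (b / 2 + c / 2 - 1 / 2) →
      -b + 1 ≠ 0 → -c + a + 1 ≠ 0 →
      F a b (-b + 2) c (2 * a + 2 - c) =
        (1 / 2 * (Gamma (a - c / 2 + 1 - b / 2) * Gamma (b / 2 - 1 + c / 2) /
              (Gamma (a + b / 2 - c / 2) * Gamma (-b / 2 + c / 2))) -
          1 / 2 * (Gamma (3 / 2 + a - b / 2 - c / 2) * Gamma (b / 2 + c / 2 - 1 / 2) /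
              (Gamma (a - c / 2 + 1 / 2 + b / 2) * Gamma (-b / 2 + c / 2 + 1 / 2)))) *
          Gamma (2 * a + 2 - c) * Gamma c /
        ((-b + 1) * (-c + a + 1) * Gamma (c + b - 2) * Gamma (2 + 2 * a - b - c))) ∧
    -- (2)
    (∀ a b c : ℂ, Regular a 2 b c 4 →
      (a - 3) * (b - 1) * (-2 + a) * (a - 1) * (b - 3) * (b - 2) ≠ 0 →
      F a 2 b c 4 =
        -6 * ((2 * c - 5 + b - a * b + a) * Gamma c * Gamma (-b + 2 + c - a) /
          ((a - 3) * (b - 1) * (-2 + a) * (a - 1) * (b - 3) * (b - 2) *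
            Gamma (c - a) * Gamma (c - b))) +
        6 * (c - 2) * (c - 1) * (a * b - 3 * b - 3 * a + 3 + 2 * c) /
          ((a - 3) * (b - 1) * (-2 + a) * (a - 1) * (b - 3) * (b - 2))) ∧
    -- (3)
    (∀ a b c : ℂ, Regular a 2 b c (4 + a - c + b) →
      (-a - 2 + c) * (c - 3 - b) * (c - 2 - b) * (c - 1 - b) * (-a - 3 + c) * (-a + c - 1) ≠ 0 →
      F a 2 b c (4 + a - c + b) =
        (-a - 2 + c - b) * (-a - 3 + c - b) * (c - 2) * (c - 1) *
            (3 - 4 * c - c * a + c ^ 2 + 3 * a + a * b + 3 * b - b * c) /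
          ((-a - 2 + c) * (c - 3 - b) * (c - 2 - b) * (c - 1 - b) * (-a - 3 + c) *
            (-a + c - 1)) +
        (a + 5 - c * a + c ^ 2 - 4 * c + a * b - b * c + b) *
            Gamma (4 + a - c + b) * Gamma c /
          ((-a - 2 + c) * (c - 3 - b) * (c - 2 - b) * (c - 1 - b) * (-a - 3 + c) *
            (-a + c - 1) * Gamma b * Gamma a)) ∧
    -- (4)
    (∀ (a b : ℂ) (n : ℕ), b - n ≠ 0 →
      Regular a b (-(n * (n - b + a) / (b - n))) (1 + b - a * n / (b - n)) (1 + a + n) →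
      NonPole (-b) → sin (pi * a) ≠ 0 →
      F a b (-(n * (n - b + a) / (b - n))) (1 + b - a * n / (b - n)) (1 + a + n) =
        (-1) ^ n * sin (pi * b) * Gamma (1 + b + a * n / (-b + n)) * Gamma (-b) /
          (sin (pi * a) * Gamma (1 + a) * Gamma (-a - n) *
            Gamma (n + 1 + a * n / (-b + n)))) ∧
    -- (5)
    (∀ (a : ℂ) (n : ℕ),
      Regular (3 * n - 3 / 2) (n - a - 1 / 2) (2 * a) (2 * a + 1 / 2 + n) (3 * n - a - 1 / 2) →
      NonPole (a - n + 1 / 2) →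
      F (3 * n - 3 / 2) (n - a - 1 / 2) (2 * a) (2 * a + 1 / 2 + n) (3 * n - a - 1 / 2) =
        (2 * a / 3 + 1 / 3) * Gamma (-3 * n + 5 / 2) * Gamma (a - n + 1 / 2) *
            Gamma (2 * a + 1 / 2 + n) /
          (Gamma (1 / 2 + n) * Gamma (3 / 2 + a - 3 * n) * Gamma (2 * a + 2) *
            Gamma (3 / 2 - n))) ∧
    -- (6)
    (∀ (a b : ℂ) (n : ℕ), b + n ≠ 0 →
      Regular a b (-n + a * n / (b + n)) (1 + b + a * n / (b + n)) (a - n + 1) →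
      NonPole (-b) → sin (pi * a) ≠ 0 →
      F a b (-n + a * n / (b + n)) (1 + b + a * n / (b + n)) (a - n + 1) =
        (-1) ^ n * sin (pi * b) * Gamma (1 + b + a * n / (b + n)) * Gamma (-b) /
          (sin (pi * a) * Gamma (1 + a) * Gamma (1 - n + a * n / (b + n)) * Gamma (n - a))) ∧
    -- (7)
    (∀ a b c : ℂ, Regular a b c (2 * c - 1) (a / 2 + b / 2 + 1 / 2) →
      F a b c (2 * c - 1) (a / 2 + b / 2 + 1 / 2) =
        (Real.sqrt pi : ℂ) * Gamma (c - 1 / 2) * Gamma (a / 2 + b / 2 + 1 / 2) *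
          Gamma (c - a / 2 - b / 2 - 1 / 2) *
          (1 / (Gamma (b / 2 + 1 / 2) * Gamma (c - 1 / 2 - a / 2) *
              Gamma (c - 1 / 2 - b / 2) * Gamma (a / 2 + 1 / 2)) +
            1 / (Gamma (a / 2) * Gamma (b / 2) * Gamma (c - a / 2) * Gamma (c - b / 2)))) ∧
    -- (8)
    (∀ a b c : ℂ, Regular a b c (1 + 2 * b) (c / 2 + a / 2) →
      NonPole (a / 2) → NonPole (a / 2 + 1 / 2) →
      F a b c (1 + 2 * b) (c / 2 + a / 2) =
        (Gamma (a / 2) /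
            (Gamma (1 + b - c / 2) * Gamma (-a / 2 + b + 1 / 2) * Gamma (c / 2)) +
          Gamma (a / 2 + 1 / 2) /
            (Gamma (1 / 2 + b - c / 2) * Gamma (-a / 2 + 1 + b) * Gamma (c / 2 + 1 / 2))) *
          (Real.sqrt pi : ℂ) * Gamma (c / 2 + a / 2) * Gamma (1 + 2 * b) *
          Gamma (-c / 2 - a / 2 + 1 + b) /
        ((2 : ℂ) ^ (-a + 1 + 2 * b) * Gamma (b + 1) * Gamma a)) ∧
    -- (9)
    (∀ a b c : ℂ, Regular a b (-b + 1) c (2 * a - c) →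
      NonPole (b / 2 + c / 2 - 1 / 2) → NonPole (b / 2 + c / 2) →
      F a b (-b + 1) c (2 * a - c) =
        ((Real.sqrt pi : ℂ) * Gamma (a - 1) * Gamma c * Gamma (b / 2 + c / 2 - 1 / 2) /
            ((2 : ℂ) ^ (2 * a - b - c) * Gamma a * Gamma (-b / 2 + c / 2 + 1 / 2) *
              Gamma (a - b / 2 - c / 2) * Gamma (a + b / 2 - c / 2 - 1 / 2) *
              Gamma (c + b - 1)) +
          (Real.sqrt pi : ℂ) * Gamma (b / 2 + c / 2) * Gamma (a - 1) * Gamma c /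
            ((2 : ℂ) ^ (2 * a - b - c) * Gamma a * Gamma (-b / 2 + c / 2) *
              Gamma (-b / 2 + a - c / 2 + 1 / 2) * Gamma (a + b / 2 - c / 2) *
              Gamma (c + b - 1))) * Gamma (2 * a - c)) ∧
    -- (10)
    (∀ a b c : ℂ, Regular a b (-b) c (2 * a - c + 1) →
      NonPole (b / 2 + c / 2) → NonPole (c / 2 + b / 2 + 1 / 2) →
      F a b (-b) c (2 * a - c + 1) =
        (Real.sqrt pi : ℂ) * Gamma (2 * a - c + 1) * Gamma c * Gamma (b / 2 + c / 2) /
          ((2 : ℂ) ^ (2 * a - c + 1 - b) * Gamma (a - c / 2 + 1 + b / 2) *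
            Gamma (-b / 2 + a - c / 2 + 1 / 2) * Gamma (-b / 2 + c / 2) * Gamma (c + b)) +
        (Real.sqrt pi : ℂ) * Gamma (2 * a - c + 1) * Gamma (c / 2 + b / 2 + 1 / 2) * Gamma c /
          ((2 : ℂ) ^ (2 * a - c + 1 - b) * Gamma (a - c / 2 + 1 / 2 + b / 2) *
            Gamma (a - c / 2 + 1 - b / 2) * Gamma (-b / 2 + c / 2 + 1 / 2) *
            Gamma (c + b))) ∧
    -- (11)
    (∀ a b c : ℂ, Regular a b c (2 * c) (1 + b / 2 + a / 2) →
      NonPole (c - a / 2) → NonPole (a / 2) →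
      NonPole (1 / 2 - a / 2 + c) → NonPole (a / 2 + 1 / 2) →
      b / 2 - a / 2 ≠ 0 → -a / 2 - b / 2 + c ≠ 0 →
      F a b c (2 * c) (1 + b / 2 + a / 2) =
        (1 / 2 * (Gamma (c - a / 2) * Gamma (a / 2) / (Gamma (c - b / 2) * Gamma (b / 2))) -
          1 / 2 * (Gamma (1 / 2 - a / 2 + c) * Gamma (a / 2 + 1 / 2) /
            (Gamma (1 / 2 - b / 2 + c) * Gamma (b / 2 + 1 / 2)))) *
          Gamma (1 + b / 2 + a / 2) * Gamma (2 * c) * Gamma (-a / 2 + 1 - b / 2 + c) /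
        (Gamma (2 * c - a) * Gamma c * Gamma a * (b / 2 - a / 2) * (-a / 2 - b / 2 + c))) ∧
    -- (12)
    (∀ (a b c : ℂ) (m n : ℤ),
      Regular a b c (c / 2 + b / 2 + n / 2 + 1 / 2 + m / 2) (-n + 2 * a) →
      WatsonRegular c (-b + 2 * a - n) (a - n) m n →
      F a b c (c / 2 + b / 2 + n / 2 + 1 / 2 + m / 2) (-n + 2 * a) =
        watsonW F c (-b + 2 * a - n) (a - n) m n *
          Gamma (-c / 2 - b / 2 + a - n / 2 + 1 / 2 + m / 2) *
          Gamma (c / 2 + b / 2 + n / 2 + 1 / 2 + m / 2) /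
        (Gamma (-c / 2 + b / 2 + n / 2 + 1 / 2 + m / 2) *
          Gamma (c / 2 - b / 2 + a - n / 2 + 1 / 2 + m / 2))) ∧
    -- (13)
    (∀ (a b c : ℂ) (m n : ℤ),
      Regular a (-a + m + 1) b c (-c + n + 2 * b + 1 + m) →
      WatsonRegular (a - c + n + 2 * b) (-c - a + n + 1 + m + 2 * b) b m n →
      F a (-a + m + 1) b c (-c + n + 2 * b + 1 + m) =
        watsonW F (a - c + n + 2 * b) (-c - a + n + 1 + m + 2 * b) b m n *
          Gamma (b + n) * Gamma c /
        (Gamma (c - b) * Gamma (2 * b + n))) ∧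
    -- (14)
    (∀ a b c : ℂ, Regular a b c (b + 2 - a) (1 + b - c) → a - 1 ≠ 0 →
      F a b c (b + 2 - a) (1 + b - c) =
        -(Gamma (b + 2 - a) * Gamma (1 + b - c) * Gamma (b / 2 - c - a + 2) *
            (Real.sqrt pi : ℂ) /
          (Gamma (-a + 1 + b / 2) * Gamma (b / 2 - c + 1) * Gamma (b / 2 + 1 / 2) * (a - 1) *
            Gamma (-c - a + b + 2) * (2 : ℂ) ^ b)) +
        Gamma (b + 2 - a) * Gamma (1 + b - c) * Gamma (b / 2 - c - a + 3 / 2) *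
            (Real.sqrt pi : ℂ) /
          ((a - 1) * Gamma (-c - a + b + 2) * Gamma (b / 2) * Gamma (b / 2 + 3 / 2 - a) *
            (2 : ℂ) ^ b * Gamma (1 / 2 + b / 2 - c))) ∧
    -- (15)
    (∀ a b c : ℂ, Regular a b c (1 + c / 2 + b / 2) (2 * a - 1) →
      NonPole (a - b / 2) → NonPole (c / 2 + 1 / 2) →
      NonPole (1 + c / 2) → NonPole (-b / 2 + a + 1 / 2) →
      -c / 2 + b / 2 ≠ 0 →
      F a b c (1 + c / 2 + b / 2) (2 * a - 1) =
        (-1 / 4 * (c * (-b - 1 + 2 * a) * Gamma (a - b / 2) * Gamma (c / 2 + 1 / 2) /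
            (Gamma (-c / 2 + a) * Gamma (b / 2 + 1 / 2))) +
          Gamma (1 + c / 2) * Gamma (-b / 2 + a + 1 / 2) /
            (Gamma (-c / 2 + a - 1 / 2) * Gamma (b / 2))) *
          Gamma (1 + c / 2 + b / 2) * Gamma (a - b / 2 - c / 2) * Gamma (a - 1 / 2) *
          (2 : ℂ) ^ (c - b + 2 * a - 1) /
        ((Real.sqrt pi : ℂ) * Gamma (c + 1) * Gamma (2 * a - b) * (-c / 2 + b / 2))) ∧
    -- (16)
    (∀ a b c : ℂ, Regular a (-a + 1) b c (-c + 2 + 2 * b) → c - 1 - b ≠ 0 →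
      F a (-a + 1) b c (-c + 2 + 2 * b) =
        (-(1 / ((c - 1 - b) * Gamma (1 / 2 + a / 2 - c / 2 + b) *
            Gamma (-c / 2 - a / 2 + 1 + b) * Gamma (c / 2 + a / 2) *
            Gamma (-a / 2 + c / 2 + 1 / 2))) +
          1 / ((c - 1 - b) * Gamma (a / 2 - c / 2 + 1 + b) * Gamma (-a / 2 + c / 2) *
            Gamma (-1 / 2 + c / 2 + a / 2) * Gamma (3 / 2 - c / 2 - a / 2 + b))) *
          pi * (2 : ℂ) ^ (-2 * b) * Gamma (-c + 2 + 2 * b) * Gamma c) :=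
  ⟨⟨_, isHyp3F2One_Gamma_mul_Phi⟩, fun _ hF =>
    ⟨fun _ _ _ => hF.whipple_succ, fun _ _ _ => hF.two_four, fun _ _ _ => hF.two_excess_two,
      fun _ _ _ => hF.excess_two_add, fun _ _ => hF.excess_two_half,
      fun _ _ _ => hF.excess_two_sub, fun _ _ _ => hF.watson_den_pred,
      fun _ _ _ => hF.watson_pred_succ, fun _ _ _ => hF.whipple_den_pred,
      fun _ _ _ => hF.whipple_num_pred, fun _ _ _ => hF.watson_succ,
      fun _ _ _ _ _ => hF.watson_kummer, fun _ _ _ _ _ => hF.whipple_kummer,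
      fun _ _ _ => hF.dixon_succ, fun _ _ _ => hF.watson_succ_pred,
      fun _ _ _ => hF.whipple_den_succ⟩⟩
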